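/- Let $b\ge 2$, and let $\mathbb T^b$ be the infinite rooted $b$-ary tree, in which every vertex has $b$ children. Let $T$ be its complete subtree of depth $m\ge 0$ (levels $0,\dots,m$), with $n=(b^{m+1}-1)/(b-1)$ vertices; its boundary $\partial T$ is the set of children of its leaves. For $\beta\ge 0$, $h\in\mathbb R$, a finite set $A$ of vertices and a configuration $\eta\in\{\pm1\}^{\mathbb T^b}$, let $\mu_A^\eta$ be the Gibbs distribution $\mu_A^\eta(\sigma)\propto\exp\bigl[\beta\bigl(\sum_{xy}\sigma_x\sigma_y+h\sum_{x\in A}\sigma_x\bigr)\bigr]$ on the configurations $\sigma$ that agree with $\eta$ outside $A$, where the first sum runs over the edges $xy$ that meet $A$. For a boundary condition $\tau\in\{\pm1\}^{\mathbb T^b}$ put $\mu=\mu_T^\tau$. The (heat-bath) Glauber dynamics on $T$ with boundary condition $\tau$ is the continuous-time Markov chain with generator $(\mathcal Lf)(\sigma)=\sum_{x\in T}c_x(\sigma)[f(\sigma^x)-f(\sigma)]$, where $\sigma^x$ is $\sigma$ with the spin at $x$ flipped and $c_x(\sigma)=\mu_{\{x\}}^{\sigma}(\sigma^x)$. Let $\mathcal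 D(f)=\frac12\sum_{x\in T}\mu\bigl(c_x\,[f(\sigma^x)-f(\sigma)]^2\bigr)$ and $\mathrm{Ent}(f)=\mu(f\log f)-\mu(f)\log\mu(f)$. The logarithmic Sobolev constant is $c_{\rm sob}(\mu)=\inf_f \mathcal D(\sqrt f)/\mathrm{Ent}(f)$, the infimum over non-constant $f\ge 0$. For $1\le p\le\infty$ let $T_p$ be the infimum of the times $t>0$ such that $\sup_\sigma\bigl\|e^{t\mathcal L}(\sigma,\cdot)/\mu(\cdot)-1\bigr\|_{L^p(\mu)}\le 1/e$; $T_1$ is the usual mixing time. Let $\beta_1=\frac12\log\frac{\sqrt b+1}{\sqrt b-1}$, and let $h_c(\beta)$ be the critical field, i.e. the supremum of the $|h|$ for which the infinite-volume Gibbs measure on $\mathbb T^b$ with parameters $\beta,h$ is not unique ($h_c(\beta)=0$ if it is unique for all $h$). Theorem. In both of the following situations there is a constant $C\in(0,\infty)$, depending only on $b,\beta,h$, such that for every $m\ge 0$ and every $\tau$ as described, $c_{\rm sob}(\mu_T^\tau)\ge 1/C$, and moreover, if $m\ge 1$, the dynamics mixes in time $T_p\le C\log n$ for all $1\le p\le\infty$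 (in particular its mixing time $T_1$ is $O(\log n)$): (i) the boundary condition $\tau$ is arbitrary, and either $\beta<\beta_1$ (with $h$ arbitrary) or $|h|>h_c(\beta)$ (with $\beta\ge0$ arbitrary); (ii) $\tau$ is the all-$(+)$ boundary condition, and $\beta\ge0$ and $h\in\mathbb R$ are arbitrary. -/

import Mathlib

open scoped ENNReal

noncomputable section

namespace IsingTree

/-! ### The infinite rooted `b`-ary tree and its finite complete subtrees -/

/-- Vertices of the infinite rooted `b`-ary tree: words over `Fin b`. The root is the empty word,
the children of `x` are the words `i :: x`, so the parent of a nonempty word is its tail. -/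
abbrev Vertex (b : ℕ) : Type := List (Fin b)

/-- The set of children of `x`. -/
def children {b : ℕ} (x : Vertex b) : Finset (Vertex b) :=
  Finset.univ.image fun i : Fin b => i :: x

/-- The vertices at distance `k` from the root. -/
def level (b : ℕ) : ℕ → Finset (Vertex b)
  | 0 => {[]}
  | k + 1 => (level b k).biUnion children

/-- The complete `b`-ary tree of depth `m` (levels `0, …, m`). Its boundary consists of the
children of its leaves, i.e. of level `m + 1`. -/
def tree (b m : ℕ) : Finset (Vertex b) := (Finset.range (m + 1)).biUnion (level b)

theorem mem_level {b : ℕ} (k : ℕ) (x : Vertex b) : x ∈ level b k ↔ x.length = k := by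
  induction k generalizing x with
  | zero => simp [level]
  | succ k ih =>
    cases x with
    | nil => simp [level, children]
    | cons i y => simp [level, children, ih]

theorem mem_tree {b : ℕ} (m : ℕ) (x : Vertex b) : x ∈ tree b m ↔ x.length ≤ m := by
  simp [tree, mem_level]

/-- An edge of the tree is named by its lower endpoint `c ≠ []`; it joins `c` to its parent
`c.tail`. This is the set of edges that have at least one endpoint in `A`. -/
def edgesMeeting {b : ℕ} (A : Finset (Vertex b)) : Finset (Vertex b) :=
  (A ∪ A.biUnion children).erase []

/-! ### The Ising model -/

/-- The numerical value of a spin: `true` is `+1`, `false` is `-1`. -/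
def spin (s : Bool) : ℝ := if s then 1 else -1

/-- The configuration that equals `ζ` on `A` and `η` outside `A`. -/
def glue {b : ℕ} (A : Finset (Vertex b)) (η : Vertex b → Bool) (ζ : A → Bool) :
    Vertex b → Bool :=
  fun x => if hx : x ∈ A then ζ ⟨x, hx⟩ else η x

/-- The unnormalized Gibbs weight in the finite volume `A`,
`exp (β (∑ σ_x σ_y + h ∑ σ_x))`, the first sum over the edges meeting `A`, the second over `A`.
(Edges that do not meet `A` only contribute a constant factor.) -/
def weight {b : ℕ} (β h : ℝ) (A : Finset (Vertex b)) (σ : Vertex b → Bool) : ℝ :=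
  Real.exp (β * (∑ c ∈ edgesMeeting A, spin (σ c) * spin (σ c.tail) + h * ∑ x ∈ A, spin (σ x)))

/-- The Gibbs distribution in the finite volume `A` with configuration `η` outside `A`: the
probability that the configuration in `A` is `ζ`. -/
def gibbs {b : ℕ} (β h : ℝ) (A : Finset (Vertex b)) (η : Vertex b → Bool) (ζ : A → Bool) : ℝ :=
  weight β h A (glue A η ζ) / ∑ ξ : A → Bool, weight β h A (glue A η ξ)

/-- Infinite-volume Gibbs measures on the infinite `b`-ary tree: probability measures that satisfy
the Dobrushin–Lanford–Ruelle equations for all finite volumes. -/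
def IsGibbsMeasure {b : ℕ} (β h : ℝ) (ν : MeasureTheory.Measure (Vertex b → Bool)) : Prop :=
  MeasureTheory.IsProbabilityMeasure ν ∧
    ∀ (A : Finset (Vertex b)) (B : Set (Vertex b → Bool)), MeasurableSet B →
      ∫⁻ η, ∑ ζ : A → Bool, ENNReal.ofReal (gibbs β h A η ζ) * B.indicator 1 (glue A η ζ) ∂ν = ν B

/-- There is more than one infinite-volume Gibbs measure. -/
def MultipleGibbs (b : ℕ) (β h : ℝ) : Prop :=
  ∃ ν₁ ν₂ : MeasureTheory.Measure (Vertex b → Bool),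
    IsGibbsMeasure β h ν₁ ∧ IsGibbsMeasure β h ν₂ ∧ ν₁ ≠ ν₂

/-- The critical field `h_c(β)`: the supremum of the `|h|` for which the infinite-volume Gibbs
measure is not unique (and `0` if it is unique for all `h`). -/
def criticalField (b : ℕ) (β : ℝ) : ℝ :=
  sSup {r : ℝ | ∃ h : ℝ, |h| = r ∧ MultipleGibbs b β h}

/-- The critical inverse temperature `β₁ = (1/2) log ((√b + 1) / (√b - 1))`. -/
def beta1 (b : ℕ) : ℝ := 1 / 2 * Real.log ((√(b : ℝ) + 1) / (√(b : ℝ) - 1))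

/-! ### The heat-bath Glauber dynamics on the tree of depth `m` with boundary condition `τ` -/

/-- Configurations on the tree of depth `m`. Together with a boundary condition `τ` they stand for
the configurations on the tree and its boundary that agree with `τ` on the boundary. -/
abbrev Config (b m : ℕ) : Type := tree b m → Bool

/-- The configuration `σ^x`, i.e. `σ` with the spin at `x` flipped. -/
def flipAt {b m : ℕ} (σ : Config b m) (x : tree b m) : Config b m := Function.update σ x (!σ x)

section Dynamics

variable {b : ℕ} (β h : ℝ) (m : ℕ) (τ : Vertex b → Bool)

/-- The Gibbs distribution `μ` on the tree of depth `m` with boundary condition `τ`. -/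
def mu (σ : Config b m) : ℝ := gibbs β h (tree b m) τ σ

/-- `mu` as a measure. -/
def muMeasure : MeasureTheory.Measure (Config b m) :=
  ∑ σ : Config b m, ENNReal.ofReal (mu β h m τ σ) • MeasureTheory.Measure.dirac σ

/-- The heat-bath flip rate `c_x(σ)`: the conditional probability under `μ` of the flipped spin at
`x`, given the spins of `σ` outside `x`. -/
def rate (x : tree b m) (σ : Config b m) : ℝ :=
  gibbs β h {x.1} (glue (tree b m) τ σ) fun _ => !σ x

/-- The generator `(L f)(σ) = ∑ x, c_x(σ) (f(σ^x) - f(σ))`. -/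
def generator : (Config b m → ℝ) →ₗ[ℝ] (Config b m → ℝ) where
  toFun f := fun σ => ∑ x : tree b m, rate β h m τ x σ * (f (flipAt σ x) - f σ)
  map_add' f g := by
    funext σ
    simp only [Pi.add_apply, ← Finset.sum_add_distrib]
    exact Finset.sum_congr rfl fun x _ => by ring
  map_smul' a f := by
    funext σ
    simp only [Pi.smul_apply, smul_eq_mul, RingHom.id_apply, Finset.mul_sum]
    exact Finset.sum_congr rfl fun x _ => by ring

/-- The transition kernel `P_t = e^{tL}`, as a matrix. -/
def transition (t : ℝ) : Matrix (Config b m) (Config b m) ℝ :=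
  NormedSpace.exp (t • LinearMap.toMatrix' (generator β h m τ))

/-- The Dirichlet form `(1/2) ∑ x, μ (c_x (f(σ^x) - f(σ))²)`. -/
def dirichlet (f : Config b m → ℝ) : ℝ :=
  1 / 2 * ∑ x : tree b m, ∑ σ : Config b m,
    mu β h m τ σ * (rate β h m τ x σ * (f (flipAt σ x) - f σ) ^ 2)

/-- The expectation of `f` under `μ`. -/
def expect (f : Config b m → ℝ) : ℝ := ∑ σ : Config b m, mu β h m τ σ * f σ

/-- The entropy `μ(f log f) - μ(f) log μ(f)` of a nonnegative function `f`. -/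
def ent (f : Config b m → ℝ) : ℝ :=
  expect β h m τ (fun σ => f σ * Real.log (f σ)) -
    expect β h m τ f * Real.log (expect β h m τ f)

/-- The logarithmic Sobolev constant: the infimum of `D(√f) / Ent(f)` over the nonnegative
non-constant functions `f`. -/
def logSobolev : ℝ :=
  sInf {r : ℝ | ∃ f : Config b m → ℝ, (∀ σ, 0 ≤ f σ) ∧ (∃ σ σ', f σ ≠ f σ') ∧
    r = dirichlet β h m τ (fun σ => √(f σ)) / ent β h m τ f}

/-- The density `h_t^σ(η) = P_t(σ, η) / μ(η)`. -/
def density (t : ℝ) (σ η : Config b m) : ℝ := transition β h m τ t σ η / mu β h m τ η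

/-- The mixing time `T_p`: the infimum of the times `t > 0` at which the `L^p(μ)` norm of
`h_t^σ - 1` is at most `1/e` for all initial configurations `σ` (it is `∞` if there is none).
`T_1` is the usual (total variation) mixing time. -/
def mixingTime (p : ℝ≥0∞) : ℝ≥0∞ :=
  ⨅ (t : ℝ) (_ : 0 < t ∧ ∀ σ : Config b m,
    MeasureTheory.eLpNorm (fun η => density β h m τ t σ η - 1) p (muMeasure β h m τ) ≤
      ENNReal.ofReal (Real.exp (-1))), ENNReal.ofReal t

end Dynamics

end IsingTree

end

/-! The Gibbs measure on a finite tree is a tree-indexed Markov chain. Summing out the spins below a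
vertex `x` turns them into an effective field `α x`, with `α x = g + ∑ msgFun β (α child)` and `g =
β h` (`mu_eq_treeW`). The boundary condition enters only through these fields. The influence of the
parent on the spin at `x` is `influence β (α x)`; it is also the derivative of `msgFun β` at `α x`,
and it is at most `tanh β`. The only model-dependent input is `FieldBounds`: `b * tanh β * influence
≤ ρ < 1` except in the last `J` levels, with `J` and `ρ` independent of the depth.

This input holds for the following reasons. If `β < β₁`, then `b * tanh β ^ 2 < 1`. In general,
iterating `fieldMap`, `a ↦ g + b * msgFun β a`, from its upper bound gives a sequence that decreases
to the largest fixed point. Right of that point the map is below the diagonal, so `b * influence ≤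
1` there, and the extra factor `tanh β < 1` gives strictness. Under the plus boundary condition the
fields are exactly these iterates. If the fixed point is unique, the iterates from above and below
squeeze the fields of every boundary condition. Uniqueness holds for `|h| > h_c`, because two fixed
points would give two homogeneous Markov chains that are both Gibbs measures
(`multipleGibbs_of_ne`).

From `FieldBounds` to the logarithmic Sobolev inequality: by the chain rule and tensorization, the
entropy of `f` is at most the sum over vertices of the entropy carried by the spin there once
everything below is averaged out (`entropy_le_totalSum`). Such a root entropy, times the mean of
`f`, is at most a constant times the squared covariance of `f` with the root spin. Split the root
spin into its deviation from the conditional expectation given the spins below a block, and the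
centred conditional expectation (the posterior). The first part costs the energy of `√f` in the
block. The second is tightly concentrated: its variance decays like `ρ ^ l` with the depth of the
block, and `j` further levels, each contracting by `tanh β`, upgrade this to a bounded moment of
`exp (|X| / θ ^ j)`. The entropy inequality then bounds its squared covariance with `f` by `θ ^ j`
times the mean of `f` times the entropy in the top levels (`rootEntropy_le`). Summed over all
vertices, each root entropy is counted a number of times linear in `j`, which loses against `θ ^ j`;
the term is absorbed in the left side (`exists_entropy_le_energy`).

From the logarithmic Sobolev inequality to mixing: hypercontractivity raises the exponent from `1 +
1/n` to `2` in time of order `log n`. All probabilities are at least `r ^ n`, so the initial moment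
of exponent `1 + 1/n` is bounded uniformly in `n`. The Poincaré inequality adds a bounded time, and
symmetry of the kernel turns the `L²` bound into a uniform bound on the density at twice the time,
which covers all `p` at once (`abs_heat_div_sub_one_le`). -/

noncomputable section

namespace IsingTree

/-! ### Entropy on finite probability spaces -/

section Entropy

variable {Ω ι : Type*} [Fintype Ω] [Fintype ι]

/-- The average of `f` with respect to the weights `w`. -/
def avg (w f : Ω → ℝ) : ℝ := ∑ σ, w σ * f σ

/-- The entropy of `f` with respect to the weights `w`. -/
def entropy (w f : Ω → ℝ) : ℝ :=
  avg w (fun σ => f σ * Real.log (f σ)) - avg w f * Real.log (avg w f)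

/-- Probability weights. -/
def IsProb (w : Ω → ℝ) : Prop := (∀ σ, 0 ≤ w σ) ∧ ∑ σ, w σ = 1

theorem avg_nonneg {w f : Ω → ℝ} (hw : ∀ σ, 0 ≤ w σ) (hf : ∀ σ, 0 ≤ f σ) : 0 ≤ avg w f :=
  Finset.sum_nonneg fun σ _ => mul_nonneg (hw σ) (hf σ)

theorem avg_mono {w f g : Ω → ℝ} (hw : ∀ σ, 0 ≤ w σ) (h : ∀ σ, f σ ≤ g σ) : avg w f ≤ avg w g :=
  Finset.sum_le_sum fun σ _ => mul_le_mul_of_nonneg_left (h σ) (hw σ)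

theorem avg_const {w : Ω → ℝ} (hw : IsProb w) (c : ℝ) : avg w (fun _ => c) = c := by
  simp [avg, ← Finset.sum_mul, hw.2]

theorem avg_add (w f g : Ω → ℝ) : avg w (fun σ => f σ + g σ) = avg w f + avg w g := by
  simp [avg, mul_add, Finset.sum_add_distrib]

theorem avg_sub (w f g : Ω → ℝ) : avg w (fun σ => f σ - g σ) = avg w f - avg w g := by
  simp [avg, mul_sub, Finset.sum_sub_distrib]

theorem avg_const_mul (w f : Ω → ℝ) (c : ℝ) : avg w (fun σ => c * f σ) = c * avg w f := by
  simp only [avg, Finset.mul_sum]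
  exact Finset.sum_congr rfl fun σ _ => by ring

theorem avg_mul_const (w f : Ω → ℝ) (c : ℝ) : avg w (fun σ => f σ * c) = avg w f * c := by
  simp only [avg, Finset.sum_mul]
  exact Finset.sum_congr rfl fun σ _ => by ring

omit [Fintype ι] in
theorem avg_sum (w : Ω → ℝ) (s : Finset ι) (f : ι → Ω → ℝ) :
    avg w (fun σ => ∑ i ∈ s, f i σ) = ∑ i ∈ s, avg w (f i) := by
  simp only [avg, Finset.mul_sum]
  exact Finset.sum_comm

theorem avg_comm {Ω' : Type*} [Fintype Ω'] (w : Ω → ℝ) (w' : Ω' → ℝ) (f : Ω → Ω' → ℝ) :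
    avg w (fun σ => avg w' (f σ)) = avg w' (fun σ' => avg w fun σ => f σ σ') := by
  simp only [avg, Finset.mul_sum]
  rw [Finset.sum_comm]
  exact Finset.sum_congr rfl fun σ _ => Finset.sum_congr rfl fun σ' _ => by ring

theorem abs_avg_le {w : Ω → ℝ} (hw : ∀ σ, 0 ≤ w σ) (f : Ω → ℝ) :
    |avg w f| ≤ avg w fun σ => |f σ| := by
  refine (Finset.abs_sum_le_sum_abs _ _).trans (le_of_eq ?_)
  exact Finset.sum_congr rfl fun σ _ => by rw [abs_mul, abs_of_nonneg (hw σ)]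

theorem avg_mul_sq_le {w : Ω → ℝ} (hw : ∀ σ, 0 ≤ w σ) (f g : Ω → ℝ) :
    avg w (fun σ => f σ * g σ) ^ 2 ≤ avg w (fun σ => f σ ^ 2) * avg w (fun σ => g σ ^ 2) := by
  have := Finset.sum_mul_sq_le_sq_mul_sq Finset.univ (fun σ => √(w σ) * f σ)
    (fun σ => √(w σ) * g σ)
  have e : ∀ σ, √(w σ) * √(w σ) = w σ := fun σ => Real.mul_self_sqrt (hw σ)
  simp only [avg]
  calc (∑ σ, w σ * (f σ * g σ)) ^ 2
      = (∑ σ, (√(w σ) * f σ) * (√(w σ) * g σ)) ^ 2 := by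
        congr 1; exact Finset.sum_congr rfl fun σ _ => by
          linear_combination (f σ * g σ) * (-e σ)
    _ ≤ _ := this
    _ = _ := by
        congr 1 <;> exact Finset.sum_congr rfl fun σ _ => by rw [mul_pow, Real.sq_sqrt (hw σ)]

theorem avg_sq_le {w : Ω → ℝ} (hw : IsProb w) (f : Ω → ℝ) :
    avg w f ^ 2 ≤ avg w (fun σ => f σ ^ 2) := by
  simpa [avg_const hw] using avg_mul_sq_le hw.1 f (fun _ => 1)

theorem avg_eq_zero_of_nonneg {w f : Ω → ℝ} (hw : ∀ σ, 0 ≤ w σ) (hf : ∀ σ, 0 ≤ f σ)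
    (h : avg w f = 0) (σ : Ω) : w σ * f σ = 0 :=
  (Finset.sum_eq_zero_iff_of_nonneg fun σ _ => mul_nonneg (hw σ) (hf σ)).1 h σ (Finset.mem_univ σ)

/-- This is `log z ≥ 1 - 1 / z` at `z = x / y`, multiplied by `x`; at `x = 0` the convention `0 *
log 0 = 0` is used. It is the source of most entropy inequalities below. -/
theorem sub_le_mul_log_sub {x y : ℝ} (hx : 0 ≤ x) (hy : 0 < y) :
    x - y ≤ x * Real.log x - x * Real.log y := by
  rcases hx.eq_or_lt with rfl | hx
  · simp [hy.le]
  · have := Real.one_sub_inv_le_log_of_pos (div_pos hx hy)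
    rw [Real.log_div hx.ne' hy.ne'] at this
    have h2 := mul_le_mul_of_nonneg_left this hx.le
    have : x * (1 - (x / y)⁻¹) = x - y := by field_simp
    linarith

/-- The entropy inequality. -/
theorem avg_mul_le_entropy {w f : Ω → ℝ} (hw : IsProb w) (hf : ∀ σ, 0 ≤ f σ) (X : Ω → ℝ) :
    avg w (fun σ => f σ * X σ) ≤
      avg w f * Real.log (avg w fun σ => Real.exp (X σ)) + entropy w f := by
  have hZ : 0 < avg w fun σ => Real.exp (X σ) := by
    obtain ⟨σ, -, hσ⟩ : ∃ σ ∈ Finset.univ, 0 < w σ := by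
      by_contra! h
      have := Finset.sum_nonpos h
      rw [hw.2] at this; linarith
    exact Finset.sum_pos' (fun σ _ => mul_nonneg (hw.1 σ) (Real.exp_pos _).le)
      ⟨σ, Finset.mem_univ σ, mul_pos hσ (Real.exp_pos _)⟩
  rcases (avg_nonneg hw.1 hf).eq_or_lt with h0 | hF
  · have h1 : ∀ g : ℝ → ℝ → ℝ, avg w (fun σ => f σ * g (f σ) (X σ)) = 0 := fun g =>
      Finset.sum_eq_zero fun σ _ => by
        rw [← mul_assoc, avg_eq_zero_of_nonneg hw.1 hf h0.symm σ, zero_mul]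
    have a := h1 fun _ x => x
    have b := h1 fun y _ => Real.log y
    rw [entropy, a, b, ← h0]; simp
  · set F := avg w f
    set Z := avg w fun σ => Real.exp (X σ)
    -- Nonnegativity of the relative entropy of `f` with respect to `F * exp X / Z`, which has the
    -- same mass `F`.
    have key : avg w (fun σ => f σ - F * Real.exp (X σ) / Z) ≤
        avg w (fun σ => f σ * Real.log (f σ) - f σ * Real.log (F * Real.exp (X σ) / Z)) :=
      avg_mono hw.1 fun σ => sub_le_mul_log_sub (hf σ) (by positivity)
    have e1 : avg w (fun σ => f σ - F * Real.exp (X σ) / Z) = 0 := by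
      rw [avg_sub]
      have : avg w (fun σ => F * Real.exp (X σ) / Z) = F := by
        have : (fun σ => F * Real.exp (X σ) / Z) = fun σ => (F / Z) * Real.exp (X σ) := by
          funext σ; ring
        rw [this, avg_const_mul]
        change F / Z * Z = F
        field_simp
      rw [this]; simp [F]
    have e2 : avg w (fun σ => f σ * Real.log (f σ) - f σ * Real.log (F * Real.exp (X σ) / Z)) =
        avg w (fun σ => f σ * Real.log (f σ)) - (F * (Real.log F - Real.log Z) +
          avg w fun σ => f σ * X σ) := by
      rw [avg_sub]
      congr 1
      have : (fun σ => f σ * Real.log (F * Real.exp (X σ) / Z)) =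
          fun σ => f σ * (Real.log F - Real.log Z) + f σ * X σ := by
        funext σ
        rw [Real.log_div (by positivity) hZ.ne', Real.log_mul hF.ne' (Real.exp_pos _).ne',
          Real.log_exp]
        ring
      rw [this, avg_add, avg_mul_const]
    rw [e1, e2] at key
    change _ ≤ F * Real.log Z + (avg w (fun σ => f σ * Real.log (f σ)) - F * Real.log F)
    linarith

theorem entropy_nonneg {w f : Ω → ℝ} (hw : IsProb w) (hf : ∀ σ, 0 ≤ f σ) : 0 ≤ entropy w f := by
  have := avg_mul_le_entropy hw hf fun _ => 0
  simpa [avg_const hw] using this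

theorem entropy_const {w : Ω → ℝ} (hw : IsProb w) (c : ℝ) : entropy w (fun _ => c) = 0 := by
  simp [entropy, avg_const hw]

/-- Convexity of the entropy. -/
theorem entropy_sum_le {w : Ω → ℝ} (hw : ∀ σ, 0 ≤ w σ) {l : ι → ℝ} (hl : ∀ i, 0 ≤ l i)
    {f : ι → Ω → ℝ} (hf : ∀ i σ, 0 ≤ f i σ) :
    entropy w (fun σ => avg l fun i => f i σ) ≤ avg l fun i => entropy w (f i) := by
  have hF : ∀ i, 0 ≤ avg w (f i) := fun i => avg_nonneg hw (hf i)
  set F : ℝ := avg l fun i => avg w (f i) with hFdef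
  have hFc : avg w (fun σ => avg l fun i => f i σ) = F := avg_comm w l fun σ i => f i σ
  have hF0 : 0 ≤ F := avg_nonneg hl hF
  have main : ∀ σ, 0 < w σ → (avg l fun i => f i σ) * Real.log (avg l fun i => f i σ) -
      (avg l fun i => f i σ) * Real.log F ≤
      avg l fun i => (f i σ * Real.log (f i σ) - f i σ * Real.log (avg w (f i))) := by
    intro σ hσ
    set A := avg l fun i => f i σ with hA
    have hA0 : 0 ≤ A := avg_nonneg hl fun i => hf i σ
    rcases hA0.eq_or_lt with h0 | hApos
    · rw [← h0]
      simp only [zero_mul, sub_zero]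
      refine (Finset.sum_eq_zero fun i _ => ?_).ge
      have := avg_eq_zero_of_nonneg hl (fun i => hf i σ) h0.symm i
      beta_reduce
      rw [← mul_sub, ← mul_assoc, this, zero_mul]
    · have hFpos : 0 < F := by
        refine hF0.lt_of_ne fun h => hApos.ne' (Finset.sum_eq_zero fun i _ => ?_)
        rcases mul_eq_zero.1 (avg_eq_zero_of_nonneg hl hF h.symm i) with h1 | h1
        · rw [h1, zero_mul]
        · have := avg_eq_zero_of_nonneg hw (hf i) h1 σ
          beta_reduce
          rw [(mul_eq_zero.1 this).resolve_left hσ.ne', mul_zero]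
      -- The log-sum inequality at a fixed `σ`: compare each `f i σ` with `A` distributed in
      -- proportion to the means `avg w (f i)`.
      have key : avg l (fun i => f i σ - avg w (f i) * (A / F)) ≤ avg l (fun i =>
          (f i σ * Real.log (f i σ) - f i σ * Real.log (avg w (f i))) -
            f i σ * Real.log (A / F)) := by
        refine avg_mono hl fun i => ?_
        rcases (hF i).eq_or_lt with h1 | h1
        · have := avg_eq_zero_of_nonneg hw (hf i) h1.symm σ
          rw [(mul_eq_zero.1 this).resolve_left hσ.ne', ← h1]; simp
        · have := sub_le_mul_log_sub (hf i σ) (mul_pos h1 (div_pos hApos hFpos))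
          rw [Real.log_mul h1.ne' (div_pos hApos hFpos).ne'] at this
          linarith
      rw [avg_sub, avg_sub, avg_mul_const, avg_mul_const, ← hFdef, ← hA,
        Real.log_div hApos.ne' hFpos.ne'] at key
      have : F * (A / F) = A := by field_simp
      rw [this] at key
      linarith
  have h3 : entropy w (fun σ => avg l fun i => f i σ) =
      avg w fun σ => ((avg l fun i => f i σ) * Real.log (avg l fun i => f i σ) -
        (avg l fun i => f i σ) * Real.log F) := by
    rw [entropy, avg_sub, avg_mul_const, hFc]
  have h4 : (avg l fun i => entropy w (f i)) = avg w fun σ => avg l fun i =>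
      (f i σ * Real.log (f i σ) - f i σ * Real.log (avg w (f i))) := by
    rw [avg_comm]
    congr 1; funext i
    rw [entropy, avg_sub, avg_mul_const]
  rw [h3, h4]
  refine Finset.sum_le_sum fun σ _ => ?_
  rcases (hw σ).eq_or_lt with h | h
  · simp [← h]
  · exact mul_le_mul_of_nonneg_left (main σ h) h.le

/-- From `log (f / F) ≤ f / F - 1`, where `F` is the mean: the entropy is at most the variance over
the mean. -/
theorem entropy_mul_avg_le {w f : Ω → ℝ} (hw : IsProb w) (hf : ∀ σ, 0 ≤ f σ) :
    avg w f * entropy w f ≤ avg w (fun σ => f σ ^ 2) - avg w f ^ 2 := by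
  rcases (avg_nonneg hw.1 hf).eq_or_lt with h0 | hF
  · rw [← h0]
    simpa using avg_nonneg hw.1 fun σ => sq_nonneg (f σ)
  · set F := avg w f
    have key : avg w (fun σ => f σ * Real.log (f σ) - f σ * Real.log F) ≤
        avg w (fun σ => (1 / F) * f σ ^ 2 - f σ) := by
      refine avg_mono hw.1 fun σ => ?_
      rcases (hf σ).eq_or_lt with h | h
      · simp [← h]
      · have := Real.log_le_sub_one_of_pos (div_pos h hF)
        rw [Real.log_div h.ne' hF.ne'] at this
        have h2 := mul_le_mul_of_nonneg_left this h.le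
        calc _ = f σ * (Real.log (f σ) - Real.log F) := by ring
          _ ≤ _ := h2
          _ = _ := by ring
    rw [avg_sub, avg_mul_const, avg_sub, avg_const_mul] at key
    have : entropy w f ≤ 1 / F * avg w (fun σ => f σ ^ 2) - F := key
    calc F * entropy w f ≤ F * (1 / F * avg w (fun σ => f σ ^ 2) - F) := by gcongr
      _ = _ := by field_simp

/-- The left side is the variance of `√f`. The bound shows that non-constant functions have positive
entropy, and it yields a Poincaré inequality from a logarithmic Sobolev inequality with the same
constant. -/
theorem avg_sub_sq_avg_sqrt_le_entropy {w f : Ω → ℝ} (hw : IsProb w) (hf : ∀ σ, 0 ≤ f σ) :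
    avg w f - avg w (fun σ => √(f σ)) ^ 2 ≤ entropy w f := by
  rcases (avg_nonneg hw.1 hf).eq_or_lt with h0 | hF
  · have := entropy_nonneg hw hf
    have h2 := sq_nonneg (avg w fun σ => √(f σ))
    linarith
  · have hS : 0 < avg w fun σ => √(f σ) := by
      refine (avg_nonneg hw.1 fun σ => Real.sqrt_nonneg _).lt_of_ne fun h => hF.ne' ?_
      refine Finset.sum_eq_zero fun σ _ => ?_
      have := avg_eq_zero_of_nonneg hw.1 (fun σ => Real.sqrt_nonneg (f σ)) h.symm σ
      rcases mul_eq_zero.1 this with h | h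
      · rw [h, zero_mul]
      · rw [(Real.sqrt_eq_zero (hf σ)).1 h, mul_zero]
    set F := avg w f
    set S := avg w fun σ => √(f σ)
    have hSF : S ^ 2 ≤ F := by
      refine (avg_sq_le hw _).trans (le_of_eq ?_)
      congr 1; funext σ; exact Real.sq_sqrt (hf σ)
    -- `√f log (√f S / F) ≥ √f - F / S` pointwise
    have key : avg w (fun σ => (2 : ℝ) * (f σ - (F / S) * √(f σ))) ≤
        avg w (fun σ => f σ * Real.log (f σ) - f σ * (2 * Real.log (F / S))) := by
      refine avg_mono hw.1 fun σ => ?_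
      rcases (hf σ).eq_or_lt with h | h
      · simp [← h]
      · have hs : 0 < √(f σ) := Real.sqrt_pos.2 h
        have := sub_le_mul_log_sub hs.le (div_pos hF hS)
        have h2 := mul_le_mul_of_nonneg_left this hs.le
        rw [Real.log_sqrt h.le] at h2
        have e : √(f σ) * √(f σ) = f σ := Real.mul_self_sqrt h.le
        calc (2 : ℝ) * (f σ - (F / S) * √(f σ)) = 2 * (√(f σ) * (√(f σ) - F / S)) := by
              linear_combination (-2 : ℝ) * e
          _ ≤ 2 * (√(f σ) * (√(f σ) * (Real.log (f σ) / 2) - √(f σ) * Real.log (F / S))) := by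
              gcongr
          _ = (√(f σ) * √(f σ)) * Real.log (f σ) -
                (√(f σ) * √(f σ)) * (2 * Real.log (F / S)) := by ring
          _ = _ := by rw [e]
    rw [avg_const_mul, avg_sub, avg_const_mul, avg_sub, avg_mul_const] at key
    have e1 : F / S * S = F := by field_simp
    change 2 * (F - F / S * S) ≤ _ - F * (2 * Real.log (F / S)) at key
    rw [e1, Real.log_div hF.ne' hS.ne'] at key
    have h5 := Real.one_sub_inv_le_log_of_pos (show 0 < F / S ^ 2 by positivity)
    rw [Real.log_div hF.ne' (by positivity), Real.log_pow] at h5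
    have h6 := mul_le_mul_of_nonneg_left h5 hF.le
    have e2 : F * (1 - (F / S ^ 2)⁻¹) = F - S ^ 2 := by field_simp
    rw [e2] at h6
    push_cast at h6
    change _ ≤ avg w (fun σ => f σ * Real.log (f σ)) - F * Real.log F
    linarith

/-- A centred bounded observable with a small exponential moment has small covariance with any
density of moderate entropy. -/
theorem avg_mul_sq_le_entropy {w f : Ω → ℝ} (hw : IsProb w) (hf : ∀ σ, 0 ≤ f σ) {X : Ω → ℝ}
    (hX1 : ∀ σ, |X σ| ≤ 1) (hX0 : avg w X = 0) {δ K : ℝ} (hδ : 0 < δ) (hδ1 : δ ≤ 1) (hK : 1 ≤ K)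
    (hexp : avg w (fun σ => Real.exp (|X σ| / δ)) ≤ K) :
    avg w (fun σ => f σ * X σ) ^ 2 ≤ 36 * K ^ 2 * δ * avg w f * entropy w f := by
  have hF0 := avg_nonneg hw.1 hf
  have hE0 := entropy_nonneg hw hf
  set F := avg w f
  set E := entropy w f
  set c := avg w fun σ => f σ * X σ with hc
  -- the moment generating function
  have mgf : ∀ t : ℝ, |t| ≤ 1 / (2 * δ) →
      Real.log (avg w fun σ => Real.exp (t * X σ)) ≤ 8 * K * δ ^ 2 * t ^ 2 := by
    intro t ht
    have h1 : ∀ σ, Real.exp (t * X σ) ≤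
        1 + t * X σ + (8 * δ ^ 2 * t ^ 2) * Real.exp (|X σ| / δ) := by
      intro σ
      set y := t * X σ
      have hy : |y| ≤ |X σ| / (2 * δ) := by
        rw [abs_mul]
        calc |t| * |X σ| ≤ 1 / (2 * δ) * |X σ| := by gcongr
          _ = _ := by ring
      have h2 : Real.exp y ≤ 1 + y + y ^ 2 * Real.exp |y| := by
        have h3 : Real.exp y - 1 ≤ y * Real.exp y := by
          have := mul_le_mul_of_nonneg_right (Real.add_one_le_exp (-y)) (Real.exp_pos y).le
          rw [← Real.exp_add, neg_add_cancel, Real.exp_zero] at this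
          linarith
        rcases le_total 0 y with h0 | h0
        · rw [abs_of_nonneg h0]
          nlinarith [mul_le_mul_of_nonneg_left h3 h0]
        · rw [abs_of_nonpos h0]
          have h5 := Real.add_one_le_exp y
          have h6 : 1 ≤ Real.exp (-y) := Real.one_le_exp (by linarith)
          nlinarith [mul_le_mul_of_nonneg_left h6 (sq_nonneg y),
            mul_le_mul_of_nonneg_left h5 (neg_nonneg.2 h0)]
      -- Half of the exponent `|X| / δ` pays for `y ^ 2` and the other half for `exp |y|`; hence the
      -- restriction `|t| ≤ 1 / (2 * δ)`.
      have h4 : y ^ 2 * Real.exp |y| ≤ (8 * δ ^ 2 * t ^ 2) * Real.exp (|X σ| / δ) := by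
        have h5 : (|X σ| / (2 * δ)) ^ 2 / 2 ≤ Real.exp (|X σ| / (2 * δ)) := by
          have := Real.pow_div_factorial_le_exp (x := |X σ| / (2 * δ)) (by positivity) 2
          simpa using this
        have h6 : y ^ 2 = (8 * δ ^ 2 * t ^ 2) * ((|X σ| / (2 * δ)) ^ 2 / 2) := by
          rw [div_pow, sq_abs]; simp only [y]; field_simp; ring
        calc y ^ 2 * Real.exp |y|
            ≤ ((8 * δ ^ 2 * t ^ 2) * Real.exp (|X σ| / (2 * δ))) *
              Real.exp (|X σ| / (2 * δ)) := by
              rw [h6]; gcongr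
          _ = (8 * δ ^ 2 * t ^ 2) * Real.exp (|X σ| / δ) := by
              rw [mul_assoc, ← Real.exp_add]; congr 2; field_simp; ring
      linarith
    have h2 := avg_mono hw.1 h1
    rw [avg_add, avg_add, avg_const hw, avg_const_mul, avg_const_mul, hX0] at h2
    have hpos : 0 < avg w fun σ => Real.exp (t * X σ) := by
      have h0 : avg w (fun σ => 1 + t * X σ) ≤ avg w fun σ => Real.exp (t * X σ) :=
        avg_mono hw.1 fun σ => by linarith [Real.add_one_le_exp (t * X σ)]
      rw [avg_add, avg_const hw, avg_const_mul, hX0] at h0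
      linarith
    refine (Real.log_le_sub_one_of_pos hpos).trans ?_
    have : 8 * δ ^ 2 * t ^ 2 * avg w (fun σ => Real.exp (|X σ| / δ)) ≤
        8 * δ ^ 2 * t ^ 2 * K := by gcongr
    linarith
  have ineq : ∀ t : ℝ, |t| ≤ 1 / (2 * δ) → t * c ≤ F * (8 * K * δ ^ 2 * t ^ 2) + E := by
    intro t ht
    have := avg_mul_le_entropy hw hf fun σ => t * X σ
    have e : avg w (fun σ => f σ * (t * X σ)) = t * c := by
      rw [hc, ← avg_const_mul]; congr 1; funext σ; ring
    rw [e] at this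
    have h2 := mul_le_mul_of_nonneg_left (mgf t ht) hF0
    linarith
  have ineq' : ∀ t : ℝ, 0 ≤ t → t ≤ 1 / (2 * δ) → t * |c| ≤ F * (8 * K * δ ^ 2 * t ^ 2) + E := by
    intro t h0 ht
    rcases abs_cases c with ⟨h, -⟩ | ⟨h, -⟩
    · rw [h]; exact ineq t (by rwa [abs_of_nonneg h0])
    · rw [h]
      have := ineq (-t) (by rwa [abs_neg, abs_of_nonneg h0])
      rw [neg_sq] at this
      linarith
  have hcF : |c| ≤ F := by
    refine (abs_avg_le hw.1 _).trans (avg_mono hw.1 fun σ => ?_)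
    rw [abs_mul, abs_of_nonneg (hf σ)]
    exact mul_le_of_le_one_right (hf σ) (hX1 σ)
  rw [← sq_abs]
  rcases hF0.eq_or_lt with h0 | hF
  · rw [← h0] at hcF ⊢
    have : |c| = 0 := le_antisymm hcF (abs_nonneg _)
    rw [this]; simp
  by_cases hEF : E ≤ F
  · -- `t = √(E/F) / (2δ)`
    set r := √(E / F)
    have hr2 : r ^ 2 = E / F := Real.sq_sqrt (by positivity)
    have hr0 : 0 ≤ r := Real.sqrt_nonneg _
    have hr1 : r ≤ 1 := Real.sqrt_le_one.2 ((div_le_one hF).2 hEF)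
    have hEr : E = F * r ^ 2 := by rw [hr2]; field_simp
    have h1 := ineq' (r / (2 * δ)) (by positivity) (by gcongr)
    have h2 : r * |c| ≤ 2 * δ * (F * (2 * (K * r ^ 2)) + F * r ^ 2) := by
      have : F * (8 * K * δ ^ 2 * (r / (2 * δ)) ^ 2) = F * (2 * (K * r ^ 2)) := by field_simp; ring
      rw [this, hEr] at h1
      calc r * |c| = 2 * δ * (r / (2 * δ) * |c|) := by field_simp
        _ ≤ _ := by gcongr
    have h3 : |c| ≤ 6 * K * δ * F * r ∨ r = 0 := by
      rcases hr0.eq_or_lt with h | h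
      · right; exact h.symm
      · left
        have : r * |c| ≤ r * (6 * K * δ * F * r) := by
          have : 2 * δ * (F * (2 * (K * r ^ 2)) + F * r ^ 2) ≤
              2 * δ * (F * (2 * (K * r ^ 2)) + F * (K * r ^ 2)) := by
            have : 1 * r ^ 2 ≤ K * r ^ 2 := by gcongr
            gcongr; linarith
          nlinarith
        exact le_of_mul_le_mul_left this h
    rcases h3 with h3 | h3
    · calc |c| ^ 2 ≤ (6 * K * δ * F * r) ^ 2 := by gcongr
        _ = 36 * K ^ 2 * (δ * δ) * F * (F * r ^ 2) := by ring
        _ ≤ 36 * K ^ 2 * (δ * 1) * F * (F * r ^ 2) := by gcongr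
        _ = _ := by rw [← hEr]; ring
    · -- no entropy: let `t → 0`
      have hE : E = 0 := by rw [hEr, h3]; ring
      have hc0 : |c| = 0 := by
        by_contra hne
        have hcp : 0 < |c| := lt_of_le_of_ne (abs_nonneg _) (Ne.symm hne)
        have hKd : 0 < 16 * K * δ ^ 2 * F := by positivity
        set t := min (1 / (2 * δ)) (|c| / (16 * K * δ ^ 2 * F))
        have ht0 : 0 < t := lt_min (by positivity) (by positivity)
        have h4 := ineq' t ht0.le (min_le_left _ _)
        rw [hE] at h4
        have h5 : t * (16 * K * δ ^ 2 * F) ≤ |c| := by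
          rw [← le_div_iff₀ hKd]; exact min_le_right _ _
        nlinarith
      rw [hc0, hE]; simp
  -- For `E > F` the optimal `t` is out of range, so the largest admissible one is used. One factor
  -- `|c|` is bounded by `6 * K * δ * E`, the other by `F`; only one power of `δ` is gained, which
  -- fixes the power in the statement.
  · push Not at hEF
    have h1 := ineq' (1 / (2 * δ)) (by positivity) le_rfl
    have h2 : |c| ≤ 6 * K * δ * E := by
      have : F * (8 * K * δ ^ 2 * (1 / (2 * δ)) ^ 2) = F * (2 * K) := by field_simp; ring
      rw [this] at h1
      calc |c| = 2 * δ * (1 / (2 * δ) * |c|) := by field_simp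
        _ ≤ 2 * δ * (F * (2 * K) + E) := by gcongr
        _ ≤ 2 * δ * (E * (2 * K) + E * K) := by
            have : E * 1 ≤ E * K := by gcongr
            gcongr; linarith
        _ = _ := by ring
    calc |c| ^ 2 = |c| * |c| := sq _
      _ ≤ (6 * K * δ * E) * F := by gcongr
      _ ≤ (36 * (K * K) * δ * E) * F := by
          have : 6 * K ≤ 36 * (K * K) := by nlinarith
          gcongr
      _ = _ := by ring

end Entropy

/-! ### Product weights -/

section Product

variable {Ω ι : Type*} [Fintype Ω] [Fintype ι] [DecidableEq ι]

/-- The product of the weights `w i`. -/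
def piW (w : ι → Ω → ℝ) (σ : ι → Ω) : ℝ := ∏ i, w i (σ i)

omit [Fintype Ω] [DecidableEq ι] in
theorem piW_nonneg {w : ι → Ω → ℝ} (hw : ∀ i σ, 0 ≤ w i σ) (σ : ι → Ω) : 0 ≤ piW w σ :=
  Finset.prod_nonneg fun i _ => hw i _

theorem avg_piW_prod (w g : ι → Ω → ℝ) :
    avg (piW w) (fun σ => ∏ i, g i (σ i)) = ∏ i, avg (w i) (g i) := by
  simp only [avg, piW, ← Finset.prod_mul_distrib]
  rw [Finset.prod_univ_sum, Fintype.piFinset_univ]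

theorem sum_piW (w : ι → Ω → ℝ) : ∑ σ, piW w σ = ∏ i, ∑ σ, w i σ := by
  simpa [avg] using avg_piW_prod w fun _ _ => 1

theorem isProb_piW {w : ι → Ω → ℝ} (hw : ∀ i, IsProb (w i)) : IsProb (piW w) :=
  ⟨piW_nonneg fun i => (hw i).1, by rw [sum_piW]; exact Finset.prod_eq_one fun i _ => (hw i).2⟩

/-- Replacing the law of one coordinate. -/
theorem avg_piW_update (w : ι → Ω → ℝ) (i : ι) (hw : ∑ t, w i t = 1) (v : Ω → ℝ)
    (Φ : (ι → Ω) → ℝ) :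
    avg (piW (Function.update w i v)) Φ =
      avg (piW w) fun σ => avg v fun t => Φ (Function.update σ i t) := by
  -- The involution that exchanges coordinate `i` with the independent sample.
  let e : (ι → Ω) × Ω ≃ (ι → Ω) × Ω :=
    { toFun := fun p => (Function.update p.1 i p.2, p.1 i)
      invFun := fun p => (Function.update p.1 i p.2, p.1 i)
      left_inv := fun p => by simp
      right_inv := fun p => by simp }
  symm
  simp only [avg, Finset.mul_sum]
  rw [← Fintype.sum_prod_type' (fun σ t => piW w σ * (v t * Φ (Function.update σ i t)))]
  rw [← Equiv.sum_comp e]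
  rw [Fintype.sum_prod_type]
  refine Finset.sum_congr rfl fun σ _ => ?_
  have h1 : ∀ t, piW w (Function.update σ i t) * v (σ i) =
      w i t * piW (Function.update w i v) σ := by
    intro t
    simp only [piW]
    rw [← Finset.mul_prod_erase Finset.univ _ (Finset.mem_univ i),
      ← Finset.mul_prod_erase Finset.univ (fun j => Function.update w i v j (σ j))
        (Finset.mem_univ i)]
    have : ∏ j ∈ Finset.univ.erase i, w j (Function.update σ i t j) =
        ∏ j ∈ Finset.univ.erase i, Function.update w i v j (σ j) :=
      Finset.prod_congr rfl fun j hj => by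
        rw [Function.update_of_ne (Finset.ne_of_mem_erase hj),
          Function.update_of_ne (Finset.ne_of_mem_erase hj)]
    rw [this, Function.update_self, Function.update_self]
    ring
  have : ∀ t, piW w (e (σ, t)).1 * (v (e (σ, t)).2 *
      Φ (Function.update (e (σ, t)).1 i (e (σ, t)).2)) =
        w i t * (piW (Function.update w i v) σ * Φ σ) := by
    intro t
    simp only [e, Equiv.coe_fn_mk, Function.update_idem, Function.update_eq_self]
    rw [← mul_assoc, h1]; ring
  rw [Finset.sum_congr rfl fun t _ => this t, ← Finset.sum_mul, hw, one_mul]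

/-- Resampling one coordinate. -/
theorem avg_piW_resample {w : ι → Ω → ℝ} (i : ι) (hw : ∑ t, w i t = 1)
    (Φ : (ι → Ω) → ℝ) :
    avg (piW w) (fun σ => avg (w i) fun t => Φ (Function.update σ i t)) = avg (piW w) Φ := by
  rw [← avg_piW_update w i hw, Function.update_eq_self]

/-- Composition of product kernels. -/
theorem avg_piW_comp {Ω' : Type*} [Fintype Ω'] (w : ι → Ω → ℝ) (κ : ι → Ω → Ω' → ℝ)
    (w' : ι → Ω' → ℝ) (h : ∀ i (g : Ω' → ℝ), avg (w i) (fun t => avg (κ i t) g) = avg (w' i) g)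
    (g : (ι → Ω') → ℝ) :
    avg (piW w) (fun σ => avg (piW fun i => κ i (σ i)) g) = avg (piW w') g := by
  classical
  simp only [avg, Finset.mul_sum]
  rw [Finset.sum_comm]
  refine Finset.sum_congr rfl fun τ _ => ?_
  simp only [← mul_assoc, ← Finset.sum_mul]
  congr 1
  have := avg_piW_prod w fun i t => κ i t (τ i)
  simp only [avg] at this
  simp only [piW] at this ⊢
  rw [this]
  refine Finset.prod_congr rfl fun i _ => ?_
  have := h i fun t => if t = τ i then 1 else 0
  simpa [avg] using this

/-- Resampling a set of coordinates. -/
theorem avg_piW_piecewise {w : ι → Ω → ℝ} (hw : ∀ i, IsProb (w i)) (I : Finset ι)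
    (Φ : (ι → Ω) → ℝ) :
    avg (piW w) (fun σ => avg (piW w) fun σ' => Φ (I.piecewise σ' σ)) = avg (piW w) Φ := by
  let e : (ι → Ω) × (ι → Ω) ≃ (ι → Ω) × (ι → Ω) :=
    { toFun := fun p => (I.piecewise p.2 p.1, I.piecewise p.1 p.2)
      invFun := fun p => (I.piecewise p.2 p.1, I.piecewise p.1 p.2)
      left_inv := fun p => by ext i <;> by_cases h : i ∈ I <;> simp [h]
      right_inv := fun p => by ext i <;> by_cases h : i ∈ I <;> simp [h] }
  simp only [avg, Finset.mul_sum]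
  rw [← Fintype.sum_prod_type' (fun σ σ' => piW w σ * (piW w σ' * Φ (I.piecewise σ' σ)))]
  rw [← Equiv.sum_comp e, Fintype.sum_prod_type]
  refine Finset.sum_congr rfl fun σ _ => ?_
  have h2 : ∀ σ' : ι → Ω, I.piecewise (I.piecewise σ σ') (I.piecewise σ' σ) = σ := by
    intro σ'; ext i; by_cases h : i ∈ I <;> simp [h]
  have h3 : ∀ σ' : ι → Ω, piW w (I.piecewise σ' σ) * piW w (I.piecewise σ σ') =
      piW w σ * piW w σ' := by
    intro σ'
    simp only [piW, ← Finset.prod_mul_distrib]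
    refine Finset.prod_congr rfl fun i _ => ?_
    by_cases h : i ∈ I <;> simp [h, mul_comm]
  have : ∀ σ', piW w (e (σ, σ')).1 * (piW w (e (σ, σ')).2 *
      Φ (I.piecewise (e (σ, σ')).2 (e (σ, σ')).1)) = piW w σ' * (piW w σ * Φ σ) := by
    intro σ'
    simp only [e, Equiv.coe_fn_mk, h2]
    rw [← mul_assoc, h3]; ring
  rw [Finset.sum_congr rfl fun t _ => this t, ← Finset.sum_mul, (isProb_piW hw).2, one_mul]

/-- Tensorization of the entropy. -/
theorem entropy_piW_le {w : ι → Ω → ℝ} (hw : ∀ i, IsProb (w i)) {f : (ι → Ω) → ℝ}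
    (hf : ∀ σ, 0 ≤ f σ) :
    entropy (piW w) f ≤
      ∑ i, avg (piW w) fun σ => entropy (w i) fun t => f (Function.update σ i t) := by
  have hW := isProb_piW hw
  set F : Finset ι → (ι → Ω) → ℝ := fun I σ => avg (piW w) fun σ' => f (I.piecewise σ' σ) with hF
  have hF0 : ∀ I σ, 0 ≤ F I σ := fun I σ => avg_nonneg hW.1 fun _ => hf _
  -- `F I` is `f` with the coordinates in `I` averaged out. Enlarging `I` by one coordinate changes
  -- the average of `F I log (F I)` by a mean one-coordinate entropy of `F I`, which convexity
  -- bounds by that of `f`; the differences telescope.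
  have claim : ∀ I : Finset ι, avg (piW w) (fun σ => f σ * Real.log (f σ)) -
      avg (piW w) (fun σ => F I σ * Real.log (F I σ)) ≤
      ∑ i ∈ I, avg (piW w) fun σ => entropy (w i) fun t => f (Function.update σ i t) := by
    intro I
    induction I using Finset.induction_on with
    | empty =>
      have : F ∅ = f := by
        funext σ; simp only [hF, Finset.piecewise_empty]; exact avg_const hW _
      simp [this]
    | insert i I hi ih =>
      rw [Finset.sum_insert hi]
      have hpw : ∀ (σ' σ : ι → Ω) t, I.piecewise σ' (Function.update σ i t) =
          Function.update (I.piecewise σ' σ) i t := by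
        intro σ' σ t; ext j
        by_cases hj : j = i
        · subst hj; simp [hi]
        · by_cases h : j ∈ I <;> simp [h, hj]
      have hinsert : ∀ σ, F (insert i I) σ = avg (w i) fun t => F I (Function.update σ i t) := by
        intro σ
        simp only [hF]
        rw [avg_comm]
        simp only [hpw]
        rw [← avg_piW_resample i (hw i).2]
        refine congrArg _ (funext fun σ' => ?_)
        refine congrArg _ (funext fun t => congrArg f ?_)
        ext j
        by_cases hj : j = i
        · subst hj; simp
        · by_cases h : j ∈ I <;> simp [h, hj]
      have hsplit : avg (piW w) (fun σ => F I σ * Real.log (F I σ)) -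
          avg (piW w) (fun σ => F (insert i I) σ * Real.log (F (insert i I) σ)) =
          avg (piW w) fun σ => entropy (w i) fun t => F I (Function.update σ i t) := by
        rw [← avg_piW_resample i (hw i).2 (fun σ => F I σ * Real.log (F I σ)), ← avg_sub]
        refine congrArg _ (funext fun σ => ?_)
        rw [entropy, hinsert]
      have hcond : (avg (piW w) fun σ => entropy (w i) fun t => F I (Function.update σ i t)) ≤
          avg (piW w) fun σ => entropy (w i) fun t => f (Function.update σ i t) := by
        rw [← avg_piW_piecewise hw I
          (fun σ => entropy (w i) fun t => f (Function.update σ i t))]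
        refine avg_mono hW.1 fun σ => ?_
        simp only [hF, hpw]
        exact entropy_sum_le (hw i).1 hW.1 (f := fun σ' t => f (Function.update (I.piecewise σ' σ) i t))
          fun _ _ => hf _
      linarith
  have := claim Finset.univ
  have hu : F Finset.univ = fun _ => avg (piW w) f := by
    funext σ; simp [hF]
  rw [hu, avg_const hW] at this
  exact this

/-- Changing all coordinates by bijections costs at most a constant times the sum of the costs of
changing one coordinate. -/
theorem avg_piW_sub_sq_le {w : ι → Ω → ℝ} (hw : ∀ i σ, 0 ≤ w i σ) (φ : ι → Ω ≃ Ω) {K : ℝ}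
    (hK : 1 ≤ K) (hφ : ∀ i σ, w i (φ i σ) ≤ K * w i σ) (hinv : ∀ i σ, φ i (φ i σ) = σ)
    (g : (ι → Ω) → ℝ) :
    avg (piW w) (fun σ => (g σ - g fun i => φ i (σ i)) ^ 2) ≤ (2 * K) ^ (Fintype.card ι + 1) *
      ∑ i, avg (piW w) fun σ => (g σ - g (Function.update σ i (φ i (σ i)))) ^ 2 := by
  have hW := piW_nonneg hw
  -- The coordinates are changed one at a time. Each one costs a factor `2` from `(a + b)² ≤ 2a² +
  -- 2b²` and a factor `K` from transporting the weight through the change already made.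
  have claim : ∀ I : Finset ι,
      avg (piW w) (fun σ => (g σ - g (I.piecewise (fun i => φ i (σ i)) σ)) ^ 2) ≤
      (2 * K) ^ (I.card + 1) *
        ∑ i ∈ I, avg (piW w) fun σ => (g σ - g (Function.update σ i (φ i (σ i)))) ^ 2 := by
    intro I
    induction I using Finset.induction_on with
    | empty => simp [avg]
    | insert i I hi ih =>
      set a : ι → ℝ := fun i => avg (piW w) fun σ => (g σ - g (Function.update σ i (φ i (σ i)))) ^ 2
      have ha : ∀ i, 0 ≤ a i := fun i => avg_nonneg hW fun _ => sq_nonneg _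
      set B := avg (piW w) (fun σ => (g σ - g (I.piecewise (fun i => φ i (σ i)) σ)) ^ 2)
      let e : (ι → Ω) ≃ (ι → Ω) :=
        { toFun := fun σ => Function.update σ i (φ i (σ i))
          invFun := fun σ => Function.update σ i (φ i (σ i))
          left_inv := fun σ => by simp [hinv]
          right_inv := fun σ => by simp [hinv] }
      have hsplit : ∀ σ : ι → Ω, (insert i I).piecewise (fun i => φ i (σ i)) σ =
          I.piecewise (fun j => φ j (e σ j)) (e σ) := by
        intro σ; ext j
        by_cases hj : j = i
        · subst hj; simp [hi, e]
        · by_cases h : j ∈ I <;> simp [h, hj, e]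
      have hwe : ∀ σ, piW w (e σ) ≤ K * piW w σ := by
        intro σ
        simp only [piW]
        rw [← Finset.mul_prod_erase Finset.univ _ (Finset.mem_univ i),
          ← Finset.mul_prod_erase Finset.univ (fun j => w j (σ j)) (Finset.mem_univ i)]
        have : ∏ j ∈ Finset.univ.erase i, w j (e σ j) = ∏ j ∈ Finset.univ.erase i, w j (σ j) :=
          Finset.prod_congr rfl fun j hj => by
            simp [e, Function.update_of_ne (Finset.ne_of_mem_erase hj)]
        rw [this, ← mul_assoc]
        refine mul_le_mul_of_nonneg_right ?_ (Finset.prod_nonneg fun j _ => hw _ _)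
        simpa [e] using hφ i (σ i)
      have h2 : avg (piW w) (fun σ => (g (e σ) - g (I.piecewise (fun j => φ j (e σ j)) (e σ))) ^ 2)
          ≤ K * B := by
        simp only [avg, B, Finset.mul_sum]
        rw [← Equiv.sum_comp e fun σ => piW w σ *
          (g (e σ) - g (I.piecewise (fun j => φ j (e σ j)) (e σ))) ^ 2]
        refine Finset.sum_le_sum fun σ _ => ?_
        have : e (e σ) = σ := e.left_inv σ
        rw [this, ← mul_assoc]
        exact mul_le_mul_of_nonneg_right (hwe σ) (sq_nonneg _)
      have h1 : avg (piW w) (fun σ => (g σ - g ((insert i I).piecewise (fun i => φ i (σ i)) σ)) ^ 2)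
          ≤ avg (piW w) (fun σ => 2 * (g σ - g (e σ)) ^ 2 +
            2 * (g (e σ) - g (I.piecewise (fun j => φ j (e σ j)) (e σ))) ^ 2) := by
        refine avg_mono hW fun σ => ?_
        rw [hsplit]
        nlinarith [sq_nonneg ((g σ - g (e σ)) -
          (g (e σ) - g (I.piecewise (fun j => φ j (e σ j)) (e σ))))]
      rw [avg_add, avg_const_mul, avg_const_mul] at h1
      have h3 : avg (piW w) (fun σ => (g σ - g (e σ)) ^ 2) = a i := rfl
      rw [h3] at h1
      rw [Finset.sum_insert hi, Finset.card_insert_of_notMem hi]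
      change B ≤ (2 * K) ^ (I.card + 1) * ∑ i ∈ I, a i at ih
      change _ ≤ (2 * K) ^ (I.card + 1 + 1) * (a i + ∑ i ∈ I, a i)
      have h4 : (2 : ℝ) ≤ (2 * K) ^ (I.card + 1 + 1) := by
        calc (2 : ℝ) ≤ 2 * K := by linarith
          _ = (2 * K) ^ 1 := (pow_one _).symm
          _ ≤ _ := pow_le_pow_right₀ (by linarith) (by omega)
      have h5 := mul_le_mul_of_nonneg_right h4 (ha i)
      have h6 := mul_le_mul_of_nonneg_left ih (show 0 ≤ 2 * K by linarith)
      rw [mul_add, pow_succ (2 * K) (I.card + 1)]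
      rw [pow_succ (2 * K) (I.card + 1)] at h5
      linarith
  have := claim Finset.univ
  simpa using this

end Product

section Chain

variable {Ω Ω' : Type*} [Fintype Ω] [Fintype Ω']

theorem avg_prod (w : Ω → ℝ) (w' : Ω → Ω' → ℝ) (g : Ω × Ω' → ℝ) :
    avg (fun p : Ω × Ω' => w p.1 * w' p.1 p.2) g =
      avg w fun a => avg (w' a) fun c => g (a, c) := by
  simp only [avg, Fintype.sum_prod_type, Finset.mul_sum, mul_assoc]

end Chain

section

/-! ### Recursive configurations and tree-indexed Markov weights -/

/-- Spin configurations on a complete `b`-ary tree with `n` levels. -/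
inductive Conf (b : ℕ) : ℕ → Type
  | nil : Conf b 0
  | node {n : ℕ} (s : Bool) (sub : Fin b → Conf b n) : Conf b (n + 1)

variable {b : ℕ}

namespace Conf

def equivSucc (b n : ℕ) : Bool × (Fin b → Conf b n) ≃ Conf b (n + 1) where
  toFun p := .node p.1 p.2
  invFun σ := match σ with | .node s sub => (s, sub)
  left_inv _ := rfl
  right_inv σ := by cases σ; rfl

instance fintype (b : ℕ) : (n : ℕ) → Fintype (Conf b n)
  | 0 => ⟨{.nil}, fun σ => by cases σ; simp⟩
  | n + 1 =>
    have := fintype b n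
    Fintype.ofEquiv _ (equivSucc b n)

theorem sum_zero (f : Conf b 0 → ℝ) : ∑ σ, f σ = f .nil := by
  rw [Fintype.sum_eq_single .nil]
  intro σ h; cases σ; exact absurd rfl h

theorem sum_succ {n : ℕ} (f : Conf b (n + 1) → ℝ) :
    ∑ σ, f σ = ∑ p : Bool × (Fin b → Conf b n), f (.node p.1 p.2) :=
  (Equiv.sum_comp (equivSucc b n) f).symm

/-- Flip the spin at the root. -/
def flipRoot : {n : ℕ} → Conf b n → Conf b n
  | 0, σ => σ
  | _ + 1, .node s sub => .node (!s) sub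

end Conf

/-- The law of a spin in the field `a`. -/
def pr (a : ℝ) (s : Bool) : ℝ := Real.exp (a * spin s) / (2 * Real.cosh a)

theorem pr_pos (a : ℝ) (s : Bool) : 0 < pr a s := by
  have := Real.cosh_pos a
  have := Real.exp_pos (a * spin s)
  unfold pr; positivity

theorem isProb_pr (a : ℝ) : IsProb (pr a) := by
  refine ⟨fun s => (pr_pos a s).le, ?_⟩
  have := Real.cosh_pos a
  simp only [Fintype.sum_bool, pr, spin, if_true, Bool.false_eq_true, if_false, ← add_div]
  rw [Real.cosh_eq]
  rw [Real.cosh_eq] at this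
  rw [mul_one, mul_neg, mul_one, mul_div_cancel₀ _ (two_ne_zero)]
  exact div_self (by positivity)

section Weights

variable (β : ℝ) (α : Vertex b → ℝ)

/-- The law of the spins in the `n` levels below (and including) the vertex `x`, when the parent
of `x` contributes the field `c` and the vertices `y` have effective fields `α y`. -/
def treeW : (n : ℕ) → Vertex b → ℝ → Conf b n → ℝ
  | 0, _, _, _ => 1
  | n + 1, x, c, .node s sub =>
    pr (α x + c) s * ∏ i, treeW n (i :: x) (β * spin s) (sub i)

/-- The law of the subtrees of the children of `x` given the spin `s` at `x`. -/
def subW (n : ℕ) (x : Vertex b) (s : Bool) : (Fin b → Conf b n) → ℝ :=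
  piW fun i => treeW β α n (i :: x) (β * spin s)

@[simp] theorem treeW_zero (x : Vertex b) (c : ℝ) (σ : Conf b 0) : treeW β α 0 x c σ = 1 := by
  cases σ; rfl

theorem avg_treeW_succ (n : ℕ) (x : Vertex b) (c : ℝ) (f : Conf b (n + 1) → ℝ) :
    avg (treeW β α (n + 1) x c) f =
      avg (pr (α x + c)) fun s => avg (subW β α n x s) fun sub => f (.node s sub) := by
  refine Eq.trans ?_ (avg_prod (pr (α x + c)) (subW β α n x) fun p => f (.node p.1 p.2))
  exact Conf.sum_succ _

/-- The chain rule: entropy of the root marginal plus mean conditional entropy given the root. -/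
theorem entropy_treeW_succ (n : ℕ) (x : Vertex b) (c : ℝ) (f : Conf b (n + 1) → ℝ) :
    entropy (treeW β α (n + 1) x c) f =
      entropy (pr (α x + c)) (fun s => avg (subW β α n x s) fun sub => f (.node s sub)) +
        avg (pr (α x + c)) fun s => entropy (subW β α n x s) fun sub => f (.node s sub) := by
  simp only [entropy, avg_treeW_succ, avg_sub]
  ring

theorem treeW_pos : ∀ (n : ℕ) (x : Vertex b) (c : ℝ) (σ : Conf b n), 0 < treeW β α n x c σ
  | 0, _, _, _ => by simp
  | n + 1, x, c, .node s sub =>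
    mul_pos (pr_pos _ _) (Finset.prod_pos fun i _ => treeW_pos n _ _ _)

theorem isProb_treeW : ∀ (n : ℕ) (x : Vertex b) (c : ℝ), IsProb (treeW β α n x c)
  | 0, x, c => ⟨fun σ => (treeW_pos β α 0 x c σ).le, by rw [Conf.sum_zero]; simp⟩
  | n + 1, x, c => by
    refine ⟨fun σ => (treeW_pos β α _ x c σ).le, ?_⟩
    have h := avg_treeW_succ β α n x c fun _ => 1
    have h2 : ∀ s, avg (subW β α n x s) (fun _ => 1) = 1 := fun s =>
      avg_const (isProb_piW fun i => isProb_treeW n _ _) 1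
    simp only [h2, avg_const (isProb_pr _)] at h
    simpa [avg] using h

theorem isProb_subW (n : ℕ) (x : Vertex b) (s : Bool) : IsProb (subW β α n x s) :=
  isProb_piW fun _ => isProb_treeW β α n _ _

/-! ### Functionals of observables on subtrees -/

/-- A functional of observables on the subtrees, given the field of the parent. -/
abbrev Functional (b : ℕ) : Type := (n : ℕ) → Vertex b → ℝ → (Conf b n → ℝ) → ℝ

/-- The expected sum of a functional over the subtrees of the children. -/
def childSum (Φ : Functional b) : Functional b
  | 0, _, _, _ => 0
  | n + 1, x, c, f => avg (pr (α x + c)) fun s => ∑ i, avg (subW β α n x s) fun sub =>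
      Φ n (i :: x) (β * spin s) fun t => f (.node s (Function.update sub i t))

/-- The expected sum of a functional over all subtrees. -/
def totalSum (Φ : Functional b) : Functional b
  | 0, _, _, _ => 0
  | n + 1, x, c, f => Φ (n + 1) x c f + avg (pr (α x + c)) fun s => ∑ i,
      avg (subW β α n x s) fun sub =>
        totalSum Φ n (i :: x) (β * spin s) fun t => f (.node s (Function.update sub i t))

/-- The expected sum of a functional over the subtrees rooted in the first `k` levels. -/
def topSum (Φ : Functional b) : ℕ → Functional b
  | 0 => fun _ _ _ _ => 0
  | k + 1 => fun n x c f => Φ n x c f + childSum β α (topSum Φ k) n x c f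

theorem totalSum_succ (Φ : Functional b) (n : ℕ) (x : Vertex b) (c : ℝ)
    (f : Conf b (n + 1) → ℝ) : totalSum β α Φ (n + 1) x c f =
      Φ (n + 1) x c f + childSum β α (totalSum β α Φ) (n + 1) x c f := rfl

theorem totalSum_eq {Φ : Functional b} (hΦ : ∀ x c f, Φ 0 x c f = 0) (n : ℕ) (x : Vertex b) (c : ℝ)
    (f : Conf b n → ℝ) : totalSum β α Φ n x c f =
      Φ n x c f + childSum β α (totalSum β α Φ) n x c f := by
  cases n with
  | zero => simp [totalSum, childSum, hΦ]
  | succ n => rfl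

theorem childSum_const_mul (a : ℝ) (Φ : Functional b) (n : ℕ) (x : Vertex b) (c : ℝ)
    (f : Conf b n → ℝ) : childSum β α (fun n x c f => a * Φ n x c f) n x c f =
      a * childSum β α Φ n x c f := by
  cases n with
  | zero => simp [childSum]
  | succ n => simp only [childSum, avg_const_mul, ← Finset.mul_sum]

/-- `Φ ≤ Ψ` on nonnegative observables of subtrees reaching down to level `N`, with a field at
most `|β|` from the parent. -/
def FLe (β : ℝ) (N : ℕ) (Φ Ψ : Functional b) : Prop :=
  ∀ n (x : Vertex b) c f, x.length + n = N → |c| ≤ |β| → (∀ σ, 0 ≤ f σ) → Φ n x c f ≤ Ψ n x c f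

theorem abs_mul_spin (s : Bool) : |β * spin s| ≤ |β| := by
  cases s <;> simp [spin]

variable {β α} in
theorem FLe.childSum {N : ℕ} {Φ Ψ : Functional b} (h : FLe β N Φ Ψ) :
    FLe β N (childSum β α Φ) (childSum β α Ψ) := by
  intro n x c f hn hc hf
  cases n with
  | zero => exact le_rfl
  | succ n =>
    refine avg_mono (isProb_pr _).1 fun s => Finset.sum_le_sum fun i _ =>
      avg_mono (isProb_subW β α n x s).1 fun sub => h _ _ _ _ ?_ (abs_mul_spin β s) fun t => hf _
    simp only [List.length_cons]; omega

variable {β α} in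
theorem FLe.totalSum {N : ℕ} {Φ Ψ : Functional b} (h : FLe β N Φ Ψ) :
    FLe β N (totalSum β α Φ) (totalSum β α Ψ) := by
  intro n
  induction n with
  | zero => intro x c f _ _ _; exact le_rfl
  | succ n ih =>
    intro x c f hn hc hf
    refine add_le_add (h _ _ _ _ hn hc hf) (avg_mono (isProb_pr _).1 fun s =>
      Finset.sum_le_sum fun i _ => avg_mono (isProb_subW β α n x s).1 fun sub =>
      ih _ _ _ ?_ (abs_mul_spin β s) fun t => hf _)
    simp only [List.length_cons]; omega

theorem childSum_zero (n : ℕ) (x : Vertex b) (c : ℝ) (f : Conf b n → ℝ) :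
    childSum β α (fun _ _ _ _ => 0) n x c f = 0 := by
  cases n <;> simp [childSum, avg]

theorem totalSum_zero (n : ℕ) (x : Vertex b) (c : ℝ) (f : Conf b n → ℝ) :
    totalSum β α (fun _ _ _ _ => 0) n x c f = 0 := by
  induction n generalizing x c with
  | zero => rfl
  | succ n ih => simp [totalSum, ih, avg]

theorem totalSum_add (Φ Ψ : Functional b) (n : ℕ) (x : Vertex b) (c : ℝ) (f : Conf b n → ℝ) :
    totalSum β α (fun n x c f => Φ n x c f + Ψ n x c f) n x c f =
      totalSum β α Φ n x c f + totalSum β α Ψ n x c f := by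
  induction n generalizing x c with
  | zero => simp [totalSum]
  | succ n ih =>
    simp only [totalSum, ih, avg_add, Finset.sum_add_distrib]; ring

theorem totalSum_const_mul (a : ℝ) (Φ : Functional b) (n : ℕ) (x : Vertex b) (c : ℝ)
    (f : Conf b n → ℝ) : totalSum β α (fun n x c f => a * Φ n x c f) n x c f =
      a * totalSum β α Φ n x c f := by
  induction n generalizing x c with
  | zero => simp [totalSum]
  | succ n ih =>
    simp only [totalSum, ih, avg_const_mul, ← Finset.mul_sum]; ring

/-- Both sides collect `Φ` once at every vertex except the root. `Φ 0 = 0` is needed because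
`totalSum` ignores subtrees without levels while `childSum` evaluates `Φ` on them. -/
theorem totalSum_childSum {Φ : Functional b} (hΦ : ∀ x c f, Φ 0 x c f = 0) (n : ℕ) (x : Vertex b)
    (c : ℝ) (f : Conf b n → ℝ) :
    totalSum β α (childSum β α Φ) n x c f = childSum β α (totalSum β α Φ) n x c f := by
  induction n generalizing x c with
  | zero => rfl
  | succ n ih =>
    rw [totalSum_succ]
    simp only [childSum]
    rw [← avg_add]
    refine congrArg _ (funext fun s => ?_)
    rw [← Finset.sum_add_distrib]
    refine Finset.sum_congr rfl fun i _ => ?_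
    rw [← avg_add]
    refine congrArg _ (funext fun sub => ?_)
    rw [ih]
    exact (totalSum_eq β α hΦ _ _ _ _).symm

theorem topSum_zero_level {Φ : Functional b} (hΦ : ∀ x c f, Φ 0 x c f = 0) (k : ℕ)
    (x : Vertex b) (c : ℝ) (f : Conf b 0 → ℝ) : topSum β α Φ k 0 x c f = 0 := by
  cases k <;> simp [topSum, childSum, hΦ]

/-- Every vertex has at most `k` ancestors within distance less than `k`. -/
theorem totalSum_topSum_le {N : ℕ} {Φ : Functional b} (hΦ : ∀ x c f, Φ 0 x c f = 0)
    (hpos : FLe β N (fun _ _ _ _ => 0) Φ) (k : ℕ) :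
    FLe β N (totalSum β α (topSum β α Φ k)) (fun n x c f => k * totalSum β α Φ n x c f) := by
  have hpos' : FLe β N (fun _ _ _ _ => 0) (totalSum β α Φ) := by
    intro n x c f hn hc hf
    have := hpos.totalSum (α := α) n x c f hn hc hf
    rwa [totalSum_zero] at this
  induction k with
  | zero => intro n x c f _ _ _; simp [topSum, totalSum_zero]
  | succ k ih =>
    intro n x c f hn hc hf
    have e : topSum β α Φ (k + 1) = fun n x c f => Φ n x c f +
      childSum β α (topSum β α Φ k) n x c f := rfl
    rw [e, totalSum_add, totalSum_childSum β α (topSum_zero_level β α hΦ k)]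
    have h1 := ih.childSum (α := α) n x c f hn hc hf
    rw [childSum_const_mul] at h1
    have h2 : childSum β α (totalSum β α Φ) n x c f ≤ totalSum β α Φ n x c f := by
      rw [totalSum_eq β α hΦ n]
      have := hpos n x c f hn hc hf
      linarith
    have h3 : (k : ℝ) * childSum β α (totalSum β α Φ) n x c f ≤ k * totalSum β α Φ n x c f := by
      gcongr
    push_cast
    have h4 := hpos' n x c f hn hc hf
    linarith

/-- The entropy of the spin at the root, all spins below being averaged out. -/
def rootEntropy : Functional b
  | 0, _, _, _ => 0
  | n + 1, x, c, f => entropy (pr (α x + c)) fun s =>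
      avg (subW β α n x s) fun sub => f (.node s sub)

/-- The expected squared change of `√f` when the root is flipped. -/
def rootEnergy : Functional b := fun n x c f =>
  avg (treeW β α n x c) fun σ => (√(f σ) - √(f σ.flipRoot)) ^ 2

theorem rootEntropy_nonneg (N : ℕ) : FLe β N (fun _ _ _ _ => 0) (rootEntropy β α) := by
  intro n x c f _ _ hf
  cases n with
  | zero => exact le_rfl
  | succ n =>
    exact entropy_nonneg (isProb_pr _) fun s =>
      avg_nonneg (isProb_subW β α n x s).1 fun sub => hf _

theorem rootEnergy_nonneg (N : ℕ) : FLe β N (fun _ _ _ _ => 0) (rootEnergy β α) :=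
  fun n x c _ _ _ _ => avg_nonneg (isProb_treeW β α n x c).1 fun _ => sq_nonneg _

theorem rootEnergy_zero (x : Vertex b) (c : ℝ) (f : Conf b 0 → ℝ) :
    rootEnergy β α 0 x c f = 0 := by
  simp [rootEnergy, Conf.flipRoot, avg]

/-- The chain rule at the root, then tensorization over the subtrees of the children, which are
independent given the root, and induction. -/
theorem entropy_le_totalSum (N : ℕ) :
    FLe β N (fun n x c f => entropy (treeW β α n x c) f) (totalSum β α (rootEntropy β α)) := by
  intro n
  induction n with
  | zero =>
    intro x c f _ _ _
    have : f = fun _ => f .nil := by funext σ; cases σ; rfl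
    simp only
    rw [this, entropy_const (isProb_treeW β α 0 x c)]; exact le_rfl
  | succ n ih =>
    intro x c f hn hc hf
    simp only
    rw [entropy_treeW_succ]
    refine add_le_add le_rfl (avg_mono (isProb_pr _).1 fun s => ?_)
    refine (entropy_piW_le (fun i => isProb_treeW β α n _ _) fun sub => hf _).trans ?_
    refine Finset.sum_le_sum fun i _ => avg_mono (isProb_subW β α n x s).1 fun sub => ?_
    exact ih (i :: x) _ _ (by simp only [List.length_cons]; omega) (abs_mul_spin β s) fun t => hf _

/-! ### Conditioning on the top levels -/

/-- The conditional law of the `n` levels given the top `k` of them. -/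
def extW : (k n : ℕ) → Vertex b → ℝ → Conf b k → Conf b n → ℝ
  | 0, n, x, c, _, σ => treeW β α n x c σ
  | _ + 1, 0, _, _, _, _ => 1
  | k + 1, n + 1, x, _, .node s ζ, .node s' σ =>
    if s' = s then ∏ i, extW k n (i :: x) (β * spin s) (ζ i) (σ i) else 0

@[simp] theorem extW_zero (n : ℕ) (x : Vertex b) (c : ℝ) (ζ : Conf b 0) :
    extW β α 0 n x c ζ = treeW β α n x c := by
  cases ζ; rfl

@[simp] theorem extW_succ_zero (k : ℕ) (x : Vertex b) (c : ℝ) (ζ : Conf b (k + 1))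
    (σ : Conf b 0) : extW β α (k + 1) 0 x c ζ σ = 1 := by
  cases ζ; cases σ; rfl

theorem avg_extW_succ (k n : ℕ) (x : Vertex b) (c : ℝ) (s : Bool) (ζ : Fin b → Conf b k)
    (f : Conf b (n + 1) → ℝ) :
    avg (extW β α (k + 1) (n + 1) x c (.node s ζ)) f =
      avg (piW fun i => extW β α k n (i :: x) (β * spin s) (ζ i)) fun sub => f (.node s sub) := by
  rw [avg, Conf.sum_succ, Fintype.sum_prod_type, Fintype.sum_eq_single s]
  · simp [extW, avg, piW]
  · intro s' h
    simp [extW, h]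

theorem isProb_extW (k : ℕ) : ∀ (n : ℕ) (x : Vertex b) (c : ℝ) (ζ : Conf b k),
    IsProb (extW β α k n x c ζ) := by
  induction k with
  | zero => intro n x c ζ; rw [extW_zero]; exact isProb_treeW β α n x c
  | succ k ih =>
    intro n x c ζ
    cases n with
    | zero => exact ⟨fun σ => by simp, by rw [Conf.sum_zero]; simp⟩
    | succ n =>
      cases ζ with
      | node s ζ =>
        constructor
        · rintro ⟨s', σ⟩
          simp only [extW]
          split_ifs
          · exact Finset.prod_nonneg fun i _ => (ih n _ _ _).1 _
          · exact le_rfl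
        · have h := avg_extW_succ β α k n x c s ζ fun _ => 1
          rw [avg_const (isProb_piW fun i => ih n _ _ _)] at h
          simpa [avg] using h

/-- The tower property: draw the top `k` levels, then the rest given them. -/
theorem avg_treeW_extW {k : ℕ} : ∀ {n : ℕ}, k ≤ n → ∀ (x : Vertex b) (c : ℝ)
    (f : Conf b n → ℝ), avg (treeW β α k x c) (fun ζ => avg (extW β α k n x c ζ) f) =
      avg (treeW β α n x c) f := by
  induction k with
  | zero =>
    intro n _ x c f
    simp only [extW_zero]
    exact avg_const (isProb_treeW β α 0 x c) _
  | succ k ih =>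
    intro n hkn x c f
    obtain ⟨n, rfl⟩ : ∃ n', n = n' + 1 := ⟨n - 1, by omega⟩
    rw [avg_treeW_succ, avg_treeW_succ]
    refine congrArg _ (funext fun s => ?_)
    simp only [avg_extW_succ]
    exact avg_piW_comp _ _ _ (fun i g => ih (by omega) _ _ g) _

/-- Chain rule and tensorization again, stopped after `k` levels. For one child's subtree, `f` is
still averaged over the other subtrees; convexity moves the entropy inside that average. -/
theorem entropy_extW_le {k : ℕ} : ∀ {n : ℕ}, k ≤ n → ∀ (x : Vertex b) (c : ℝ)
    {f : Conf b n → ℝ}, (∀ σ, 0 ≤ f σ) →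
    entropy (treeW β α k x c) (fun ζ => avg (extW β α k n x c ζ) f) ≤
      topSum β α (rootEntropy β α) k n x c f := by
  induction k with
  | zero =>
    intro n _ x c f _
    simp only [extW_zero]
    rw [entropy_const (isProb_treeW β α 0 x c)]; exact le_rfl
  | succ k ih =>
    intro n hkn x c f hf
    obtain ⟨n, rfl⟩ : ∃ n', n = n' + 1 := ⟨n - 1, by omega⟩
    rw [entropy_treeW_succ]
    simp only [avg_extW_succ]
    have hcomp : ∀ s (g : (Fin b → Conf b n) → ℝ), avg (subW β α k x s) (fun ζ =>
        avg (piW fun i => extW β α k n (i :: x) (β * spin s) (ζ i)) g) =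
        avg (subW β α n x s) g := fun s g =>
      avg_piW_comp _ _ _ (fun i g => avg_treeW_extW β α (by omega) _ _ g) g
    refine add_le_add (le_of_eq ?_) (avg_mono (isProb_pr _).1 fun s => ?_)
    · simp only [hcomp]; rfl
    · refine (entropy_piW_le (fun i => isProb_treeW β α k _ _) fun ζ =>
        avg_nonneg (isProb_piW fun i => isProb_extW β α k n _ _ _).1 fun sub => hf _).trans ?_
      refine Finset.sum_le_sum fun i _ => ?_
      rw [← hcomp]
      refine avg_mono (isProb_subW β α k x s).1 fun ζ => ?_
      have hP := isProb_piW fun j => isProb_extW β α k n (j :: x) (β * spin s) (ζ j)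
      have h1 : ∀ t, avg (piW fun j => extW β α k n (j :: x) (β * spin s)
            (Function.update ζ i t j)) (fun sub => f (.node s sub)) =
          avg (piW fun j => extW β α k n (j :: x) (β * spin s) (ζ j)) fun sub =>
            avg (extW β α k n (i :: x) (β * spin s) t) fun τ =>
              f (.node s (Function.update sub i τ)) := by
        intro t
        refine Eq.trans ?_ (avg_piW_update (fun j => extW β α k n (j :: x) (β * spin s) (ζ j)) i
          (isProb_extW β α k n _ _ _).2 (extW β α k n (i :: x) (β * spin s) t)
          fun sub => f (.node s sub))
        congr 2
        funext j
        by_cases hj : j = i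
        · subst hj; simp
        · simp [hj]
      simp only [h1]
      refine (entropy_sum_le (isProb_treeW β α k _ _).1 hP.1 fun sub t =>
        avg_nonneg (isProb_extW β α k n _ _ _).1 fun τ => hf _).trans ?_
      exact avg_mono hP.1 fun sub => ih (by omega) _ _ fun τ => hf _

end Weights

end

section

variable {b : ℕ}

/-! ### Flipping spins in the top levels -/

/-- Flip those spins in the top `k` levels that are marked by `ζ`. -/
def flipTop : (k n : ℕ) → Conf b k → Conf b n → Conf b n
  | 0, _, _, σ => σ
  | _ + 1, 0, _, σ => σ
  | k + 1, n + 1, .node t ζ, .node s σ => .node (xor t s) fun i => flipTop k n (ζ i) (σ i)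

@[simp] theorem flipTop_zero (n : ℕ) (ζ : Conf b 0) (σ : Conf b n) : flipTop 0 n ζ σ = σ := by
  cases ζ; cases n <;> cases σ <;> rfl

@[simp] theorem flipTop_succ_zero (k : ℕ) (ζ : Conf b (k + 1)) (σ : Conf b 0) :
    flipTop (k + 1) 0 ζ σ = σ := by
  cases ζ; cases σ; rfl

/-- Marks add modulo 2, so flips act as an abelian 2-group. The orbits are the sets of
configurations that agree below the top `k` levels, which makes `condTop` a conditional expectation.
-/
theorem flipTop_flipTop (k : ℕ) : ∀ (n : ℕ) (ζ ζ' : Conf b k) (σ : Conf b n),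
    flipTop k n ζ (flipTop k n ζ' σ) = flipTop k n (flipTop k k ζ' ζ) σ := by
  induction k with
  | zero => intro n ζ ζ' σ; simp
  | succ k ih =>
    intro n ζ ζ' σ
    cases n with
    | zero => simp
    | succ n =>
      cases ζ with | node t ζ =>
      cases ζ' with | node t' ζ' =>
      cases σ with | node s σ =>
      simp only [flipTop, ih]
      congr 1
      cases t <;> cases t' <;> cases s <;> rfl

theorem flipTop_involutive (k : ℕ) : ∀ (n : ℕ) (ζ : Conf b k),
    Function.Involutive (flipTop k n ζ) := by
  induction k with
  | zero => intro n ζ σ; simp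
  | succ k ih =>
    intro n ζ σ
    cases n with
    | zero => simp
    | succ n =>
      cases ζ with | node t ζ =>
      cases σ with | node s σ =>
      simp only [flipTop, (ih n _ _)]
      congr 1
      cases t <;> cases s <;> rfl

theorem flipTop_comm : ∀ (n : ℕ) (ζ σ : Conf b n), flipTop n n ζ σ = flipTop n n σ ζ
  | 0, ζ, σ => by cases ζ; cases σ; rfl
  | n + 1, .node t ζ, .node s σ => by
    simp only [flipTop, flipTop_comm n]
    congr 1
    cases t <;> cases s <;> rfl

def flipTopEquiv (k n : ℕ) (ζ : Conf b k) : Conf b n ≃ Conf b n :=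
  (flipTop_involutive k n ζ).toPerm

theorem sum_flipTop (k n : ℕ) (ζ : Conf b k) (f : Conf b n → ℝ) :
    ∑ σ, f (flipTop k n ζ σ) = ∑ σ, f σ :=
  Equiv.sum_comp (flipTopEquiv k n ζ) f

/-! ### Conditional expectations and a Poincaré inequality for a block of top levels -/

section Block

variable (β : ℝ) (α : Vertex b → ℝ)

/-- The conditional expectation of `φ` given the spins below the top `k` levels. -/
def condTop (k n : ℕ) (x : Vertex b) (c : ℝ) (φ : Conf b n → ℝ) (σ : Conf b n) : ℝ :=
  (∑ ζ : Conf b k, treeW β α n x c (flipTop k n ζ σ) * φ (flipTop k n ζ σ)) /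
    ∑ ζ : Conf b k, treeW β α n x c (flipTop k n ζ σ)

theorem sum_flipTop_flipTop (k n : ℕ) (ζ' : Conf b k) (f : Conf b n → ℝ) (σ : Conf b n) :
    ∑ ζ : Conf b k, f (flipTop k n ζ (flipTop k n ζ' σ)) = ∑ ζ : Conf b k, f (flipTop k n ζ σ) := by
  simp only [flipTop_flipTop]
  exact sum_flipTop k k ζ' fun ζ => f (flipTop k n ζ σ)

instance (n : ℕ) : Nonempty (Conf b n) := by
  induction n with
  | zero => exact ⟨.nil⟩
  | succ n ih => exact ⟨.node true fun _ => ih.some⟩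

theorem sum_treeW_flipTop_pos (k n : ℕ) (x : Vertex b) (c : ℝ) (σ : Conf b n) :
    0 < ∑ ζ : Conf b k, treeW β α n x c (flipTop k n ζ σ) :=
  Finset.sum_pos (fun _ _ => treeW_pos β α _ _ _ _) Finset.univ_nonempty

/-- If the block is the whole tree, nothing remains to condition on. -/
theorem condTop_self (n : ℕ) (x : Vertex b) (c : ℝ) (φ : Conf b n → ℝ) (σ : Conf b n) :
    condTop β α n n x c φ σ = avg (treeW β α n x c) φ := by
  have h : ∀ f : Conf b n → ℝ, ∑ ζ : Conf b n, f (flipTop n n ζ σ) = ∑ ζ, f ζ := by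
    intro f
    simp only [flipTop_comm n _ σ]
    exact sum_flipTop n n σ f
  rw [condTop, h (fun σ => treeW β α n x c σ * φ σ), h (treeW β α n x c),
    (isProb_treeW β α n x c).2, div_one, avg]

/-- Both expectations are sums over flips `ζ` weighted by conditional probabilities. The change of
variables `σ ↦ flipTop k n ζ σ` moves the flip from `φ` to `f`, so the difference contains only `f -
f ∘ flip`; the conditional probabilities and `φ` are then bounded by `1`. -/
theorem abs_avg_sub_condTop_le (k n : ℕ) (x : Vertex b) (c : ℝ) (f : Conf b n → ℝ)
    {φ : Conf b n → ℝ} (h0 : ∀ σ, 0 ≤ φ σ) (h1 : ∀ σ, φ σ ≤ 1) :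
    |avg (treeW β α n x c) (fun σ => f σ * (φ σ - condTop β α k n x c φ σ))| ≤
      ∑ ζ : Conf b k, avg (treeW β α n x c) fun σ => |f σ - f (flipTop k n ζ σ)| := by
  set w := treeW β α n x c with hw
  have hwp : ∀ σ, 0 < w σ := treeW_pos β α n x c
  set Z : Conf b n → ℝ := fun σ => ∑ ζ : Conf b k, w (flipTop k n ζ σ) with hZ
  have hZp : ∀ σ, 0 < Z σ := sum_treeW_flipTop_pos β α k n x c
  have hZi : ∀ ζ σ, Z (flipTop k n ζ σ) = Z σ := fun ζ σ => sum_flipTop_flipTop k n ζ w σ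
  have e1 : avg w (fun σ => f σ * φ σ) =
      ∑ ζ : Conf b k, ∑ σ, w σ * (w (flipTop k n ζ σ) / Z σ * φ σ * f σ) := by
    rw [Finset.sum_comm]
    refine Finset.sum_congr rfl fun σ _ => ?_
    simp only [div_eq_mul_inv]
    have : ∀ ζ : Conf b k, w σ * (w (flipTop k n ζ σ) * (Z σ)⁻¹ * φ σ * f σ) =
        w (flipTop k n ζ σ) * ((Z σ)⁻¹ * (w σ * (f σ * φ σ))) := fun ζ => by ring
    simp only [this]
    rw [← Finset.sum_mul]
    change _ = Z σ * ((Z σ)⁻¹ * _)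
    rw [← mul_assoc (Z σ), mul_inv_cancel₀ (hZp σ).ne', one_mul]
  have e2 : avg w (fun σ => f σ * condTop β α k n x c φ σ) =
      ∑ ζ : Conf b k, ∑ σ, w σ * (w (flipTop k n ζ σ) / Z σ * φ σ * f (flipTop k n ζ σ)) := by
    have : ∀ ζ : Conf b k, ∑ σ, w σ * (w (flipTop k n ζ σ) / Z σ * φ σ * f (flipTop k n ζ σ)) =
        ∑ σ, w σ * (f σ * (w (flipTop k n ζ σ) * φ (flipTop k n ζ σ) / Z σ)) := by
      intro ζ
      rw [← sum_flipTop k n ζ]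
      refine Finset.sum_congr rfl fun σ _ => ?_
      rw [hZi, flipTop_involutive k n ζ σ]
      ring
    simp only [this]
    rw [Finset.sum_comm]
    refine Finset.sum_congr rfl fun σ _ => ?_
    rw [← Finset.mul_sum, ← Finset.mul_sum, ← Finset.sum_div]
    rfl
  simp only [mul_sub]
  rw [avg_sub, e1, e2, ← Finset.sum_sub_distrib]
  refine (Finset.abs_sum_le_sum_abs _ _).trans (Finset.sum_le_sum fun ζ _ => ?_)
  rw [← Finset.sum_sub_distrib]
  refine (Finset.abs_sum_le_sum_abs _ _).trans (Finset.sum_le_sum fun σ _ => ?_)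
  have h3 : w (flipTop k n ζ σ) / Z σ ≤ 1 := by
    rw [div_le_one (hZp σ)]
    exact Finset.single_le_sum (f := fun ζ => w (flipTop k n ζ σ)) (fun _ _ => (hwp _).le)
      (Finset.mem_univ ζ)
  have h4 : 0 ≤ w (flipTop k n ζ σ) / Z σ := div_nonneg (hwp _).le (hZp σ).le
  rw [← mul_sub, ← mul_sub, abs_mul, abs_mul, abs_of_pos (hwp σ),
    abs_of_nonneg (mul_nonneg h4 (h0 σ))]
  refine mul_le_mul_of_nonneg_left ?_ (hwp σ).le
  exact mul_le_of_le_one_left (abs_nonneg _) (mul_le_one₀ h3 (h0 σ) (h1 σ))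

/-- For flip-invariant `f` the bound of `abs_avg_sub_condTop_le` is zero: the defining property of a
conditional expectation. -/
theorem avg_mul_condTop (k n : ℕ) (x : Vertex b) (c : ℝ) {f : Conf b n → ℝ}
    (hf : ∀ (ζ : Conf b k) σ, f (flipTop k n ζ σ) = f σ)
    {φ : Conf b n → ℝ} (h0 : ∀ σ, 0 ≤ φ σ) (h1 : ∀ σ, φ σ ≤ 1) :
    avg (treeW β α n x c) (fun σ => f σ * condTop β α k n x c φ σ) =
      avg (treeW β α n x c) (fun σ => f σ * φ σ) := by
  have := abs_avg_sub_condTop_le β α k n x c f h0 h1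
  simp only [hf, sub_self, abs_zero] at this
  simp only [mul_sub, avg_sub] at this
  have h2 : (∑ _ζ : Conf b k, avg (treeW β α n x c) fun _ => (0 : ℝ)) = 0 := by simp [avg]
  rw [h2] at this
  linarith [abs_nonpos_iff.1 this]

/-- A bound on the change of the weight when spins in the top `k` levels are flipped. -/
def weightRatio (b : ℕ) (q : ℝ) : ℕ → ℝ
  | 0 => 1 / q
  | k + 1 => weightRatio b q k ^ b / q

theorem one_le_weightRatio {q : ℝ} (hq0 : 0 < q) (hq1 : q ≤ 1) : ∀ k, 1 ≤ weightRatio b q k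
  | 0 => by rw [weightRatio, le_div_iff₀ hq0]; linarith
  | k + 1 => by
    rw [weightRatio, le_div_iff₀ hq0]
    have := one_le_pow₀ (one_le_weightRatio hq0 hq1 k) (n := b)
    linarith

variable {β α} {q : ℝ} (hq0 : 0 < q)
  (hq : ∀ (x : Vertex b) (c : ℝ) (s : Bool), |c| ≤ |β| → q ≤ pr (α x + c) s)

theorem pr_le_one (a : ℝ) (s : Bool) : pr a s ≤ 1 := by
  have h := (isProb_pr a).2
  rw [Fintype.sum_bool] at h
  cases s
  · linarith [pr_pos a true]
  · linarith [pr_pos a false]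

include hq0 hq in
-- Flips in the top `k` levels affect only the conditional probabilities there and one level below,
-- and each of these lies between `q` and `1`. Two parent fields `c` and `c'` are allowed because
-- flipping a vertex changes the field at its children; this is why `weightRatio` starts from `1 /
-- q` rather than `1`.
theorem treeW_flipTop_le (k : ℕ) : ∀ (n : ℕ) (x : Vertex b) (c c' : ℝ) (_ : |c| ≤ |β|)
    (_ : |c'| ≤ |β|) (ζ : Conf b k) (σ : Conf b n),
    treeW β α n x c (flipTop k n ζ σ) ≤ weightRatio b q k * treeW β α n x c' σ := by
  have hq1 : q ≤ 1 := (hq [] 0 true (by simp)).trans (pr_le_one _ _)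
  have hpr : ∀ (x : Vertex b) c' (_ : |c'| ≤ |β|) s, 1 ≤ 1 / q * pr (α x + c') s := by
    intro x c' hc' s
    rw [one_div, ← div_eq_inv_mul, le_div_iff₀ hq0]
    simpa using hq x c' s hc'
  induction k with
  | zero =>
    intro n x c c' hc hc' ζ σ
    cases n with
    | zero => simpa [weightRatio] using (one_le_weightRatio (b := b) hq0 hq1 0)
    | succ n =>
      cases σ with | node s σ =>
      simp only [flipTop_zero, treeW, weightRatio]
      rw [← mul_assoc]
      refine mul_le_mul_of_nonneg_right ?_
        (Finset.prod_nonneg fun i _ => (treeW_pos β α _ _ _ _).le)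
      exact (pr_le_one _ _).trans (hpr x c' hc' s)
  | succ k ih =>
    intro n x c c' hc hc' ζ σ
    cases n with
    | zero => simpa using (one_le_weightRatio (b := b) hq0 hq1 (k + 1))
    | succ n =>
      cases ζ with | node t ζ =>
      cases σ with | node s σ =>
      simp only [flipTop, treeW, weightRatio]
      have h1 : ∏ i, treeW β α n (i :: x) (β * spin (xor t s)) (flipTop k n (ζ i) (σ i)) ≤
          weightRatio b q k ^ b * ∏ i, treeW β α n (i :: x) (β * spin s) (σ i) := by
        refine (Finset.prod_le_prod (fun i _ => (treeW_pos β α _ _ _ _).le) fun i _ =>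
          ih n (i :: x) _ _ (abs_mul_spin β _) (abs_mul_spin β s) (ζ i) (σ i)).trans ?_
        rw [Finset.prod_mul_distrib]; simp
      have h2 := mul_le_mul ((pr_le_one (α x + c) (xor t s)).trans (hpr x c' hc' s)) h1
        (Finset.prod_nonneg fun i _ => (treeW_pos β α _ _ _ _).le)
        (mul_nonneg (by positivity) (pr_pos _ _).le)
      refine h2.trans (le_of_eq ?_)
      ring

include hq0 hq in
theorem avg_flipTop_le (k n : ℕ) (x : Vertex b) (c : ℝ) (hc : |c| ≤ |β|) (ζ : Conf b k)
    {Ψ : Conf b n → ℝ} (hΨ : ∀ σ, 0 ≤ Ψ σ) :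
    avg (treeW β α n x c) (fun σ => Ψ (flipTop k n ζ σ)) ≤
      weightRatio b q k * avg (treeW β α n x c) Ψ := by
  simp only [avg, Finset.mul_sum]
  rw [← sum_flipTop k n ζ]
  refine Finset.sum_le_sum fun σ _ => ?_
  rw [flipTop_involutive k n ζ σ, ← mul_assoc]
  exact mul_le_mul_of_nonneg_right (treeW_flipTop_le hq0 hq k n x c c hc hc ζ σ) (hΨ σ)

/-- The constant in `avg_sub_flipTop_sq_le`. -/
def blockConst (b : ℕ) (q : ℝ) : ℕ → ℝ
  | 0 => 0
  | k + 1 => 2 + 2 * weightRatio b q 1 * ((2 * weightRatio b q k) ^ (b + 1) * blockConst b q k)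

theorem blockConst_nonneg (hq0 : 0 < q) (hq1 : q ≤ 1) : ∀ k, 0 ≤ blockConst b q k
  | 0 => le_rfl
  | k + 1 => by
    have h1 := one_le_weightRatio (b := b) hq0 hq1 1
    have h2 := one_le_weightRatio (b := b) hq0 hq1 k
    have h3 := blockConst_nonneg hq0 hq1 k
    rw [blockConst]; positivity

theorem topSum_rootEnergy_nonneg (k : ℕ) : ∀ (n : ℕ) (x : Vertex b) (c : ℝ) (f : Conf b n → ℝ),
    0 ≤ topSum β α (rootEnergy β α) k n x c f := by
  induction k with
  | zero => intro n x c f; exact le_rfl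
  | succ k ih =>
    intro n x c f
    refine add_nonneg (avg_nonneg (isProb_treeW β α n x c).1 fun _ => sq_nonneg _) ?_
    cases n with
    | zero => exact le_rfl
    | succ n =>
      exact avg_nonneg (isProb_pr _).1 fun s => Finset.sum_nonneg fun i _ =>
        avg_nonneg (isProb_subW β α n x s).1 fun sub => ih _ _ _ _

include hq0 hq in
/-- The Poincaré inequality for the top `k` levels. -/
theorem avg_sub_flipTop_sq_le (k : ℕ) : ∀ (n : ℕ) (x : Vertex b) (c : ℝ) (_ : |c| ≤ |β|)
    (ζ : Conf b k) (f : Conf b n → ℝ),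
    avg (treeW β α n x c) (fun σ => (√(f σ) - √(f (flipTop k n ζ σ))) ^ 2) ≤
      blockConst b q k * topSum β α (rootEnergy β α) k n x c f := by
  have hq1 : q ≤ 1 := (hq [] 0 true (by simp)).trans (pr_le_one _ _)
  induction k with
  | zero => intro n x c hc ζ f; simp [blockConst, avg]
  | succ k ih =>
    intro n x c hc ζ f
    have hK1 := one_le_weightRatio (b := b) hq0 hq1 1
    have hKk := one_le_weightRatio (b := b) hq0 hq1 k
    have hB := blockConst_nonneg (b := b) hq0 hq1 k
    cases n with
    | zero =>
      simp only [flipTop_succ_zero, sub_self]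
      have := blockConst_nonneg (b := b) hq0 hq1 (k + 1)
      have h2 := topSum_rootEnergy_nonneg (β := β) (α := α) (k + 1) 0 x c f
      simpa [avg] using mul_nonneg this h2
    | succ n =>
      cases ζ with | node t ζ =>
      set w := treeW β α (n + 1) x c with hw
      have hwp := (isProb_treeW β α (n + 1) x c).1
      -- The flip is split into the flip of the root alone, which costs the root energy, and the
      -- flips in the subtrees. The latter are estimated after the root flip has been moved onto the
      -- weight, at the price of `weightRatio b q 1`.
      let one : Conf b 1 := .node t fun _ => .nil
      have hone : ∀ s (sub : Fin b → Conf b n), flipTop 1 (n + 1) one (.node s sub) =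
          .node (xor t s) sub := by
        intro s sub; simp [one, flipTop]
      let Ψ : Conf b (n + 1) → ℝ := fun σ => match σ with
        | .node s sub => (√(f (.node s sub)) -
            √(f (.node s fun i => flipTop k n (ζ i) (sub i)))) ^ 2
      have h1 : ∀ σ, (√(f σ) - √(f (flipTop (k + 1) (n + 1) (.node t ζ) σ))) ^ 2 ≤
          2 * (√(f σ) - √(f σ.flipRoot)) ^ 2 + 2 * Ψ (flipTop 1 (n + 1) one σ) := by
        intro σ
        cases σ with | node s sub =>
        rw [hone]
        simp only [Ψ, flipTop, Conf.flipRoot]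
        have key : ∀ p q r : ℝ, (p - r) ^ 2 ≤ 2 * (p - q) ^ 2 + 2 * (q - r) ^ 2 := fun p q r => by
          nlinarith [sq_nonneg ((p - q) - (q - r))]
        cases t
        · simp only [Bool.false_xor]
          nlinarith [sq_nonneg (√(f (.node s sub)) - √(f (.node (!s) sub))),
            sq_nonneg (√(f (.node s sub)) - √(f (.node s fun i => flipTop k n (ζ i) (sub i))))]
        · simp only [Bool.true_xor]
          exact key _ _ _
      have h2 := avg_mono hwp h1
      rw [avg_add, avg_const_mul, avg_const_mul] at h2
      have h3 : avg w (fun σ => Ψ (flipTop 1 (n + 1) one σ)) ≤ weightRatio b q 1 * avg w Ψ :=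
        avg_flipTop_le hq0 hq 1 (n + 1) x c hc one fun σ => by cases σ; exact sq_nonneg _
      have h4 : avg w Ψ ≤ (2 * weightRatio b q k) ^ (b + 1) * (blockConst b q k *
          childSum β α (topSum β α (rootEnergy β α) k) (n + 1) x c f) := by
        rw [hw, avg_treeW_succ, childSum, ← mul_assoc, ← avg_const_mul]
        refine avg_mono (isProb_pr _).1 fun s => ?_
        have h5 := avg_piW_sub_sq_le (w := fun i => treeW β α n (i :: x) (β * spin s))
          (fun i σ => (treeW_pos β α _ _ _ _).le) (fun i => flipTopEquiv k n (ζ i)) hKk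
          (fun i σ => treeW_flipTop_le hq0 hq k n _ _ _ (abs_mul_spin β s) (abs_mul_spin β s) _ _)
          (fun i σ => flipTop_involutive k n (ζ i) σ) fun sub => √(f (.node s sub))
        rw [Fintype.card_fin] at h5
        refine h5.trans ?_
        rw [mul_assoc]
        refine mul_le_mul_of_nonneg_left ?_ (by positivity)
        rw [Finset.mul_sum]
        refine Finset.sum_le_sum fun i _ => ?_
        rw [← avg_piW_resample i (isProb_treeW β α n _ _).2, ← avg_const_mul]
        refine avg_mono (isProb_subW β α n x s).1 fun sub => ?_
        simp only [Function.update_self, Function.update_idem]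
        exact ih n (i :: x) _ (abs_mul_spin β s) (ζ i) fun t => f (.node s (Function.update sub i t))
      have h6 : 0 ≤ childSum β α (topSum β α (rootEnergy β α) k) (n + 1) x c f :=
        avg_nonneg (isProb_pr _).1 fun s => Finset.sum_nonneg fun i _ =>
          avg_nonneg (isProb_subW β α n x s).1 fun sub => topSum_rootEnergy_nonneg _ _ _ _ _
      have h7 : 0 ≤ rootEnergy β α (n + 1) x c f := avg_nonneg hwp fun _ => sq_nonneg _
      refine h2.trans ?_
      change 2 * rootEnergy β α (n + 1) x c f + _ ≤ _
      rw [blockConst, topSum]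
      have h8 := h3.trans (mul_le_mul_of_nonneg_left h4 (by positivity))
      have h9 : 0 ≤ weightRatio b q 1 * ((2 * weightRatio b q k) ^ (b + 1) * blockConst b q k) := by
        positivity
      have h10 := mul_nonneg h9 h7
      nlinarith

include hq0 hq in
/-- Resampling the top `k` levels. -/
theorem avg_mul_sub_condTop_sq_le (k n : ℕ) (x : Vertex b) (c : ℝ) (hc : |c| ≤ |β|)
    {f : Conf b n → ℝ} (hf : ∀ σ, 0 ≤ f σ) {φ : Conf b n → ℝ} (h0 : ∀ σ, 0 ≤ φ σ)
    (h1 : ∀ σ, φ σ ≤ 1) :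
    avg (treeW β α n x c) (fun σ => f σ * (φ σ - condTop β α k n x c φ σ)) ^ 2 ≤
      (Fintype.card (Conf b k) ^ 2 * (2 * (1 + weightRatio b q k)) * blockConst b q k) *
        avg (treeW β α n x c) f * topSum β α (rootEnergy β α) k n x c f := by
  have hq1 : q ≤ 1 := (hq [] 0 true (by simp)).trans (pr_le_one _ _)
  set w := treeW β α n x c
  have hwp := (isProb_treeW β α n x c).1
  set T := topSum β α (rootEnergy β α) k n x c f
  have hKk := one_le_weightRatio (b := b) hq0 hq1 k
  have hB := blockConst_nonneg (b := b) hq0 hq1 k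
  have hT : 0 ≤ T := topSum_rootEnergy_nonneg k n x c f
  have hF := avg_nonneg hwp hf
  have main : ∀ ζ : Conf b k, avg w (fun σ => |f σ - f (flipTop k n ζ σ)|) ^ 2 ≤
      (2 * (1 + weightRatio b q k)) * blockConst b q k * avg w f * T := by
    intro ζ
    -- The factorization `f - f' = (√f - √f') (√f + √f')` lets Cauchy–Schwarz separate the energy of
    -- `√f` from the mean of `f`.
    have e : ∀ σ, |f σ - f (flipTop k n ζ σ)| = |√(f σ) - √(f (flipTop k n ζ σ))| *
        (√(f σ) + √(f (flipTop k n ζ σ))) := by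
      intro σ
      rw [← abs_of_nonneg (add_nonneg (Real.sqrt_nonneg (f σ))
        (Real.sqrt_nonneg (f (flipTop k n ζ σ)))), ← abs_mul]
      congr 1
      nlinarith [Real.mul_self_sqrt (hf σ), Real.mul_self_sqrt (hf (flipTop k n ζ σ))]
    simp only [e]
    refine (avg_mul_sq_le hwp _ _).trans ?_
    simp only [sq_abs]
    have h2 := avg_sub_flipTop_sq_le hq0 hq k n x c hc ζ f
    have h3 : avg w (fun σ => (√(f σ) + √(f (flipTop k n ζ σ))) ^ 2) ≤
        2 * (1 + weightRatio b q k) * avg w f := by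
      have h4 : ∀ σ, (√(f σ) + √(f (flipTop k n ζ σ))) ^ 2 ≤
          2 * f σ + 2 * f (flipTop k n ζ σ) := by
        intro σ
        nlinarith [Real.mul_self_sqrt (hf σ), Real.mul_self_sqrt (hf (flipTop k n ζ σ)),
          sq_nonneg (√(f σ) - √(f (flipTop k n ζ σ)))]
      refine (avg_mono hwp h4).trans ?_
      rw [avg_add, avg_const_mul, avg_const_mul]
      have := avg_flipTop_le hq0 hq k n x c hc ζ hf
      nlinarith
    calc _ ≤ (blockConst b q k * T) * (2 * (1 + weightRatio b q k) * avg w f) := by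
          refine mul_le_mul h2 h3 (avg_nonneg hwp fun _ => sq_nonneg _) (by positivity)
      _ = _ := by ring
  have h5 := abs_avg_sub_condTop_le β α k n x c f h0 h1
  rw [← sq_abs]
  calc _ ≤ (∑ ζ : Conf b k, avg w fun σ => |f σ - f (flipTop k n ζ σ)|) ^ 2 := by
        gcongr
    _ ≤ Fintype.card (Conf b k) *
          ∑ ζ : Conf b k, (avg w fun σ => |f σ - f (flipTop k n ζ σ)|) ^ 2 := by
        simpa using sq_sum_le_card_mul_sum_sq (s := Finset.univ)
          (f := fun ζ : Conf b k => avg w fun σ => |f σ - f (flipTop k n ζ σ)|)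
    _ ≤ Fintype.card (Conf b k) * ∑ _ζ : Conf b k,
          ((2 * (1 + weightRatio b q k)) * blockConst b q k * avg w f * T) := by
        gcongr with ζ; exact main ζ
    _ = _ := by
        rw [Finset.sum_const, Finset.card_univ, nsmul_eq_mul]; ring

end Block

end

section

variable {b : ℕ}

/-! ### The message function -/

/-- The field that a vertex in the effective field `a` sends to its parent. -/
def msgFun (β a : ℝ) : ℝ := 1 / 2 * Real.log (Real.cosh (a + β) / Real.cosh (a - β))

/-- The influence of the parent on a vertex in the effective field `a`. -/
def influence (β a : ℝ) : ℝ := pr (a + β) true - pr (a - β) true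

theorem pr_true (a : ℝ) : pr a true = Real.exp a / (2 * Real.cosh a) := by simp [pr, spin]

theorem pr_false (a : ℝ) : pr a false = 1 - pr a true := by
  have h := (isProb_pr a).2
  rw [Fintype.sum_bool] at h
  linarith

theorem pr_true_sub (a a' : ℝ) :
    pr a true - pr a' true = Real.sinh (a - a') / (2 * Real.cosh a * Real.cosh a') := by
  have h1 := Real.cosh_pos a
  have h2 := Real.cosh_pos a'
  rw [pr_true, pr_true, Real.sinh_sub, ← Real.cosh_add_sinh a, ← Real.cosh_add_sinh a']
  field_simp
  ring

theorem cosh_add_mul_cosh_sub (a β : ℝ) :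
    2 * Real.cosh (a + β) * Real.cosh (a - β) = Real.cosh (2 * a) + Real.cosh (2 * β) := by
  rw [Real.cosh_add, Real.cosh_sub, Real.cosh_two_mul, Real.cosh_two_mul]
  have h1 := Real.cosh_sq a
  have h2 := Real.cosh_sq β
  linear_combination (2 * Real.cosh β ^ 2 - 1) * h1 + (2 * Real.sinh a ^ 2 + 1) * h2

theorem influence_eq (β a : ℝ) :
    influence β a = Real.sinh (2 * β) / (Real.cosh (2 * a) + Real.cosh (2 * β)) := by
  rw [influence, pr_true_sub, cosh_add_mul_cosh_sub]
  congr 2; ring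

theorem influence_nonneg {β : ℝ} (hβ : 0 ≤ β) (a : ℝ) : 0 ≤ influence β a := by
  rw [influence_eq]
  have h1 := Real.cosh_pos (2 * a)
  have h2 := Real.cosh_pos (2 * β)
  have := Real.sinh_nonneg_iff.2 (show 0 ≤ 2 * β by linarith)
  positivity

/-- The influence is largest at `a = 0`, where it equals `sinh (2β) / (1 + cosh (2β)) = tanh β`. -/
theorem influence_le_tanh {β : ℝ} (hβ : 0 ≤ β) (a : ℝ) : influence β a ≤ Real.tanh β := by
  rw [influence_eq, Real.tanh_eq_sinh_div_cosh]
  have h0 := Real.sinh_nonneg_iff.2 hβ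
  have hc := Real.cosh_pos β
  have h1 := Real.one_le_cosh (2 * a)
  have h2 : Real.cosh (2 * β) = 2 * Real.cosh β ^ 2 - 1 := by
    rw [Real.cosh_two_mul]; have := Real.cosh_sq β; linarith
  rw [Real.sinh_two_mul, h2, div_le_div_iff₀ (by nlinarith) hc]
  have h3 : 0 ≤ Real.sinh β * (Real.cosh (2 * a) - 1) := mul_nonneg h0 (by linarith)
  nlinarith

theorem tanh_nonneg' {β : ℝ} (hβ : 0 ≤ β) : 0 ≤ Real.tanh β :=
  (influence_nonneg hβ 0).trans (influence_le_tanh hβ 0)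

theorem influence_le_one {β : ℝ} (hβ : 0 ≤ β) (a : ℝ) : influence β a ≤ 1 :=
  (influence_le_tanh hβ a).trans (Real.tanh_lt_one β).le

theorem hasDerivAt_pr_true (a : ℝ) :
    HasDerivAt (fun a => pr a true) (1 / (2 * Real.cosh a ^ 2)) a := by
  have hc := Real.cosh_pos a
  have h := (Real.hasDerivAt_exp a).div ((Real.hasDerivAt_cosh a).const_mul 2) (by positivity)
  have e : (fun a => pr a true) = (fun x => Real.exp x) / fun y => 2 * Real.cosh y := by
    funext x; exact pr_true x
  rw [e]
  refine h.congr_deriv ?_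
  rw [← Real.cosh_add_sinh a]
  have h2 := Real.cosh_sq a
  field_simp
  linear_combination h2

/-- Both the derivative and the influence equal `(tanh (a + β) - tanh (a - β)) / 2`. Hence the
linearized field recursion and the probabilistic influence of a parent are governed by the same
quantity. -/
theorem hasDerivAt_msgFun (β a : ℝ) : HasDerivAt (msgFun β) (influence β a) a := by
  have h1 := Real.cosh_pos (a + β)
  have h2 := Real.cosh_pos (a - β)
  have e : msgFun β = fun a => 1 / 2 * (Real.log (Real.cosh (a + β)) -
      Real.log (Real.cosh (a - β))) := by
    funext a
    rw [msgFun, Real.log_div (Real.cosh_pos _).ne' (Real.cosh_pos _).ne']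
  rw [e]
  have d1 := ((hasDerivAt_id a).add_const β).cosh.log h1.ne'
  have d2 := ((hasDerivAt_id a).sub_const β).cosh.log h2.ne'
  refine ((d1.sub d2).const_mul (1 / 2)).congr_deriv ?_
  rw [influence, pr_true_sub]
  rw [Real.sinh_sub (a + β) (a - β)]
  simp only [id]
  field_simp

theorem msgFun_mono {β : ℝ} (hβ : 0 ≤ β) : Monotone (msgFun β) :=
  monotone_of_deriv_nonneg (fun a => (hasDerivAt_msgFun β a).differentiableAt) fun a => by
    rw [(hasDerivAt_msgFun β a).deriv]; exact influence_nonneg hβ a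

/-- The Lipschitz bound for `msgFun` in monotone form, so that it survives averaging under two
stochastically ordered laws. -/
theorem tanh_mul_sub_msgFun_mono {β : ℝ} (hβ : 0 ≤ β) :
    Monotone fun a => Real.tanh β * a - msgFun β a := by
  have hd : ∀ a, HasDerivAt (fun a => Real.tanh β * a - msgFun β a)
      (Real.tanh β * 1 - influence β a) a := fun a =>
    ((hasDerivAt_id a).const_mul _).sub (hasDerivAt_msgFun β a)
  refine monotone_of_deriv_nonneg (fun a => (hd a).differentiableAt) fun a => ?_
  rw [(hd a).deriv]
  linarith [influence_le_tanh hβ a]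

theorem abs_msgFun_sub_le {β : ℝ} (hβ : 0 ≤ β) (a a' : ℝ) :
    |msgFun β a - msgFun β a'| ≤ Real.tanh β * |a - a'| := by
  rcases le_total a a' with h | h
  · have h1 := msgFun_mono hβ h
    have h2 := tanh_mul_sub_msgFun_mono hβ h
    simp only at h2
    rw [abs_of_nonpos (by linarith), abs_of_nonpos (by linarith)]
    linarith
  · have h1 := msgFun_mono hβ h
    have h2 := tanh_mul_sub_msgFun_mono hβ h
    simp only at h2
    rw [abs_of_nonneg (by linarith), abs_of_nonneg (by linarith)]
    linarith

theorem pr_true_mono : Monotone fun a => pr a true :=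
  monotone_of_deriv_nonneg (fun a => (hasDerivAt_pr_true a).differentiableAt) fun a => by
    rw [(hasDerivAt_pr_true a).deriv]; have := Real.cosh_pos a; positivity

theorem sub_pr_true_mono : Monotone fun a => a - pr a true := by
  have hd : ∀ a, HasDerivAt (fun a => a - pr a true) (1 - 1 / (2 * Real.cosh a ^ 2)) a := fun a =>
    (hasDerivAt_id a).sub (hasDerivAt_pr_true a)
  refine monotone_of_deriv_nonneg (fun a => (hd a).differentiableAt) fun a => ?_
  rw [(hd a).deriv, sub_nonneg, div_le_one (by have := Real.cosh_pos a; positivity)]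
  nlinarith [Real.one_le_cosh a]

theorem abs_pr_true_sub_le (a a' : ℝ) : |pr a true - pr a' true| ≤ |a - a'| := by
  rcases le_total a a' with h | h
  · have h1 := pr_true_mono h
    have h2 := sub_pr_true_mono h
    simp only at h1 h2
    rw [abs_of_nonpos (by linarith), abs_of_nonpos (by linarith)]
    linarith
  · have h1 := pr_true_mono h
    have h2 := sub_pr_true_mono h
    simp only at h1 h2
    rw [abs_of_nonneg (by linarith), abs_of_nonneg (by linarith)]
    linarith

/-- In the formula of `pr_true_sub` the numerator satisfies `|sinh u| ≥ |u|`, and the denominator is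
bounded for bounded fields. It converts concentration of the posterior into concentration of the
field. -/
theorem abs_sub_le_pr_true {M a a' : ℝ} (ha : |a| ≤ M) (ha' : |a'| ≤ M) :
    |a - a'| ≤ 2 * Real.cosh M ^ 2 * |pr a true - pr a' true| := by
  have hM : 0 ≤ M := (abs_nonneg a).trans ha
  have h1 := Real.cosh_pos a
  have h2 := Real.cosh_pos a'
  have c1 : Real.cosh a ≤ Real.cosh M := Real.cosh_le_cosh.2 (by rwa [abs_of_nonneg hM])
  have c2 : Real.cosh a' ≤ Real.cosh M := Real.cosh_le_cosh.2 (by rwa [abs_of_nonneg hM])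
  have h3 : |a - a'| ≤ |Real.sinh (a - a')| := by
    rcases le_total 0 (a - a') with h | h
    · rw [abs_of_nonneg h, abs_of_nonneg (Real.sinh_nonneg_iff.2 h)]
      exact Real.self_le_sinh_iff.2 h
    · rw [abs_of_nonpos h, abs_of_nonpos (Real.sinh_nonpos_iff.2 h)]
      exact neg_le_neg (Real.sinh_le_self_iff.2 h)
  rw [pr_true_sub, abs_div, abs_of_pos (show 0 < 2 * Real.cosh a * Real.cosh a' by positivity),
    mul_div_assoc', le_div_iff₀ (by positivity)]
  calc |a - a'| * (2 * Real.cosh a * Real.cosh a')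
      ≤ |Real.sinh (a - a')| * (2 * Real.cosh M * Real.cosh M) := by gcongr
    _ = _ := by ring

/-- Every positive function of one spin `s` has the form `B * exp (s * m)`. Here `m` is the message:
a vertex that has been summed out acts on its parent as the field `msgFun β a`. -/
theorem cosh_add_mul_spin (β a : ℝ) : ∃ B : ℝ, 0 < B ∧ ∀ s : Bool,
    Real.cosh (a + β * spin s) = B * Real.exp (spin s * msgFun β a) := by
  have h1 := Real.cosh_pos (a + β)
  have h2 := Real.cosh_pos (a - β)
  refine ⟨Real.exp (1 / 2 * (Real.log (Real.cosh (a + β)) + Real.log (Real.cosh (a - β)))),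
    Real.exp_pos _, fun s => ?_⟩
  rw [← Real.exp_add, msgFun, Real.log_div h1.ne' h2.ne']
  cases s
  · simp only [spin, Bool.false_eq_true, if_false, mul_neg, mul_one]
    rw [← sub_eq_add_neg, eq_comm, ← Real.exp_log h2]
    congr 1
    rw [Real.exp_log h2]; ring
  · simp only [spin, if_true, mul_one]
    rw [eq_comm, ← Real.exp_log h1]
    congr 1
    rw [Real.exp_log h1]; ring

theorem abs_msgFun_le {β : ℝ} (hβ : 0 ≤ β) (a : ℝ) : |msgFun β a| ≤ β := by
  have key : ∀ x, Real.cosh (x + 2 * β) ≤ Real.exp (2 * β) * Real.cosh x := by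
    intro x
    rw [Real.cosh_eq, Real.cosh_eq, mul_div_assoc', mul_add, ← Real.exp_add, ← Real.exp_add]
    rw [add_comm (2 * β) x]
    gcongr
    linarith
  have h1 := Real.cosh_pos (a + β)
  have h2 := Real.cosh_pos (a - β)
  have k1 := key (a - β)
  have k2 := key (-a - β)
  rw [show a - β + 2 * β = a + β by ring] at k1
  rw [show -a - β + 2 * β = -(a - β) by ring, show -a - β = -(a + β) by ring, Real.cosh_neg,
    Real.cosh_neg] at k2
  have l1 := Real.log_le_log h1 k1
  have l2 := Real.log_le_log h2 k2
  rw [Real.log_mul (Real.exp_pos _).ne' h2.ne', Real.log_exp] at l1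
  rw [Real.log_mul (Real.exp_pos _).ne' h1.ne', Real.log_exp] at l2
  rw [msgFun, Real.log_div h1.ne' h2.ne', abs_le]
  constructor <;> linarith

/-! ### Messages from a level of the tree -/

/-- The message sent by the root to its parent when the spins at distance `l` from the root are
given. -/
def msg (β g : ℝ) : (l : ℕ) → {n : ℕ} → Conf b n → ℝ
  | _, 0, _ => 0
  | 0, _ + 1, .node s _ => β * spin s
  | l + 1, _ + 1, .node _ sub => msgFun β (g + ∑ i, msg β g l (sub i))

/-- The effective field at the root when the spins at distance `l + 1` are given. -/
def topField (β g : ℝ) (l : ℕ) {n : ℕ} (sub : Fin b → Conf b n) : ℝ := g + ∑ i, msg β g l (sub i)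

theorem msg_succ (β g : ℝ) (l n : ℕ) (s : Bool) (sub : Fin b → Conf b n) :
    msg β g (l + 1) (.node s sub) = msgFun β (topField β g l sub) := rfl

theorem abs_msg_le {β : ℝ} (hβ : 0 ≤ β) (g : ℝ) (l : ℕ) {n : ℕ} (σ : Conf b n) :
    |msg β g l σ| ≤ β := by
  cases n with
  | zero => cases σ; cases l <;> simpa [msg] using hβ
  | succ n =>
    cases σ with | node s sub =>
    cases l with
    | zero => rw [msg]; exact (abs_mul_spin β s).trans (abs_of_nonneg hβ).le
    | succ l => exact abs_msgFun_le hβ _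

theorem abs_topField_le {β : ℝ} (hβ : 0 ≤ β) (g : ℝ) (l : ℕ) {n : ℕ} (sub : Fin b → Conf b n) :
    |topField β g l sub| ≤ |g| + b * β := by
  refine (abs_add_le _ _).trans (add_le_add le_rfl ?_)
  refine (Finset.abs_sum_le_sum_abs _ _).trans ?_
  refine (Finset.sum_le_sum fun i _ => abs_msg_le hβ g l (sub i)).trans ?_
  simp

theorem msg_flipTop (β g : ℝ) (l : ℕ) : ∀ (n : ℕ) (ζ : Conf b l) (σ : Conf b n),
    msg β g l (flipTop l n ζ σ) = msg β g l σ := by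
  induction l with
  | zero => intro n ζ σ; simp
  | succ l ih =>
    intro n ζ σ
    cases n with
    | zero => simp
    | succ n =>
      cases ζ with | node t ζ =>
      cases σ with | node s σ =>
      simp only [flipTop, msg, ih]

/-- The conditional law given the top `k` levels is supported on configurations with these levels,
and the message reads only the level at distance `l < k`. -/
theorem msg_extW (β : ℝ) (α : Vertex b → ℝ) (g : ℝ) (l : ℕ) : ∀ (k n : ℕ) (_ : l + 1 ≤ k)
    (_ : k ≤ n) (x : Vertex b) (c : ℝ) (ζ : Conf b k) (σ : Conf b n),
    extW β α k n x c ζ σ ≠ 0 → msg β g l σ = msg β g l ζ := by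
  induction l with
  | zero =>
    intro k n hk hn x c ζ σ h
    obtain ⟨k, rfl⟩ : ∃ k', k = k' + 1 := ⟨k - 1, by omega⟩
    obtain ⟨n, rfl⟩ : ∃ n', n = n' + 1 := ⟨n - 1, by omega⟩
    cases ζ with | node t ζ =>
    cases σ with | node s σ =>
    simp only [extW] at h
    split_ifs at h with hs
    · rw [msg, msg, hs]
    · exact absurd rfl h
  | succ l ih =>
    intro k n hk hn x c ζ σ h
    obtain ⟨k, rfl⟩ : ∃ k', k = k' + 1 := ⟨k - 1, by omega⟩
    obtain ⟨n, rfl⟩ : ∃ n', n = n' + 1 := ⟨n - 1, by omega⟩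
    cases ζ with | node t ζ =>
    cases σ with | node s σ =>
    simp only [extW] at h
    split_ifs at h with hs
    · rw [Finset.prod_ne_zero_iff] at h
      rw [msg, msg]
      congr 2
      exact Finset.sum_congr rfl fun i _ => ih k n (by omega) (by omega) _ _ _ _
        (h i (Finset.mem_univ i))
    · exact absurd rfl h

/-! ### The posterior of the root -/

section Posterior

variable (β g : ℝ) (α : Vertex b → ℝ) {m : ℕ}
  (hrec : ∀ y : Vertex b, y.length < m → α y = g + ∑ i, msgFun β (α (i :: y)))

theorem pr_add (a c : ℝ) (s : Bool) :
    pr (a + c) s = Real.exp (spin s * (a + c)) / (2 * Real.cosh (a + c)) := by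
  rw [pr, mul_comm (a + c)]

theorem sum_conf_one_succ {k : ℕ} (f : Conf b (k + 1) → ℝ) :
    ∑ ζ, f ζ = ∑ t : Bool, ∑ ζ : Fin b → Conf b k, f (.node t ζ) := by
  rw [Conf.sum_succ, Fintype.sum_prod_type]

/-- The indicator of the spin `s` at the root. -/
def rootIs (s : Bool) {n : ℕ} : Conf b n → ℝ
  | .nil => 0
  | .node s' _ => if s' = s then 1 else 0

theorem rootIs_nonneg (s : Bool) {n : ℕ} (σ : Conf b n) : 0 ≤ rootIs s σ := by
  cases σ with
  | nil => exact le_rfl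
  | node s' sub => simp only [rootIs]; split_ifs <;> norm_num

theorem rootIs_le_one (s : Bool) {n : ℕ} (σ : Conf b n) : rootIs s σ ≤ 1 := by
  cases σ with
  | nil => exact zero_le_one
  | node s' sub => simp only [rootIs]; split_ifs <;> norm_num

/-- With the root fixed to `s`, the sum over the block factorizes over the children. Each child
trades its a priori message for the observed one, and the recursion for `α x` assembles the result
into `topField`. The constant does not depend on `c` or `s`. -/
theorem sum_treeW_rootIs {l n : ℕ} (x : Vertex b) (hx : α x = g + ∑ i, msgFun β (α (i :: x)))
    (s₀ : Bool) (sub : Fin b → Conf b n) (h : ∀ i, ∃ B : ℝ, 0 < B ∧ ∀ s : Bool,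
      ∑ ζ : Conf b l, treeW β α n (i :: x) (β * spin s) (flipTop l n ζ (sub i)) =
        B * Real.exp (spin s * (msg β g l (sub i) - msgFun β (α (i :: x))))) :
    ∃ B : ℝ, 0 < B ∧ ∀ c s, ∑ ζ : Conf b (l + 1),
      treeW β α (n + 1) x c (flipTop (l + 1) (n + 1) ζ (.node s₀ sub)) *
        rootIs s (flipTop (l + 1) (n + 1) ζ (.node s₀ sub)) =
      B * Real.exp (spin s * (topField β g l sub + c)) / (2 * Real.cosh (α x + c)) := by
  choose B hB hBs using h
  refine ⟨∏ i, B i, Finset.prod_pos fun i _ => hB i, fun c s => ?_⟩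
  rw [sum_conf_one_succ, Fintype.sum_eq_single (xor s s₀)]
  · have e1 : xor (xor s s₀) s₀ = s := by cases s <;> cases s₀ <;> rfl
    simp only [flipTop, rootIs, treeW, e1, if_true, mul_one]
    rw [← Finset.mul_sum]
    have e2 : ∑ ζ : Fin b → Conf b l, ∏ i, treeW β α n (i :: x) (β * spin s)
        (flipTop l n (ζ i) (sub i)) = ∏ i, ∑ ζ : Conf b l, treeW β α n (i :: x) (β * spin s)
        (flipTop l n ζ (sub i)) := by
      rw [Finset.prod_univ_sum, Fintype.piFinset_univ]
    rw [e2, Finset.prod_congr rfl fun i _ => hBs i s, Finset.prod_mul_distrib, ← Real.exp_sum,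
      pr_add, ← Finset.mul_sum, Finset.sum_sub_distrib]
    have e3 : spin s * (topField β g l sub + c) = spin s * (α x + c) +
        spin s * (∑ i, msg β g l (sub i) - ∑ i, msgFun β (α (i :: x))) := by
      rw [topField, hx]; ring
    rw [e3, Real.exp_add]
    ring
  · intro t ht
    refine Finset.sum_eq_zero fun ζ _ => ?_
    have : xor t s₀ ≠ s := by
      revert ht; cases t <;> cases s <;> cases s₀ <;> decide
    simp [flipTop, rootIs, this]

theorem sum_rootIs {n : ℕ} (σ : Conf b (n + 1)) : rootIs true σ + rootIs false σ = 1 := by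
  cases σ with | node s sub => cases s <;> simp [rootIs]

theorem exp_add_exp_neg_spin (a : ℝ) :
    Real.exp (spin true * a) + Real.exp (spin false * a) = 2 * Real.cosh a := by
  simp only [spin, if_true, Bool.false_eq_true, if_false, one_mul, neg_mul]
  rw [Real.cosh_eq]; ring

include hrec in
-- As a function of the parent's spin, the likelihood of the spins below the top `l` levels is an
-- exponential; its field is the observed message minus the one already accounted for in the
-- normalizations of `treeW`.
theorem sum_treeW_msg (l : ℕ) : ∀ (n : ℕ) (x : Vertex b), l + 1 ≤ n → x.length + l ≤ m →
    ∀ σ : Conf b n, ∃ B : ℝ, 0 < B ∧ ∀ s : Bool,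
      ∑ ζ : Conf b l, treeW β α n x (β * spin s) (flipTop l n ζ σ) =
        B * Real.exp (spin s * (msg β g l σ - msgFun β (α x))) := by
  induction l with
  | zero =>
    intro n x hn hx σ
    obtain ⟨n, rfl⟩ : ∃ n', n = n' + 1 := ⟨n - 1, by omega⟩
    cases σ with | node s₀ sub =>
    obtain ⟨B, hB, h⟩ := cosh_add_mul_spin β (α x)
    refine ⟨Real.exp (spin s₀ * α x) / (2 * B) *
      ∏ i, treeW β α n (i :: x) (β * spin s₀) (sub i), mul_pos (by positivity)
        (Finset.prod_pos fun i _ => treeW_pos β α _ _ _ _), fun s => ?_⟩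
    rw [Conf.sum_zero]
    simp only [flipTop_zero, treeW, msg]
    rw [pr_add, h s]
    have : spin s₀ * (α x + β * spin s) = spin s₀ * α x + spin s * (β * spin s₀) := by ring
    rw [this, Real.exp_add, mul_sub, Real.exp_sub]
    field_simp
  | succ l ih =>
    intro n x hn hx σ
    obtain ⟨n, rfl⟩ : ∃ n', n = n' + 1 := ⟨n - 1, by omega⟩
    cases σ with | node s₀ sub =>
    obtain ⟨B, hB, h⟩ := sum_treeW_rootIs β g α x (hrec x (by omega)) s₀ sub fun i =>
      ih n (i :: x) (by omega) (by simp only [List.length_cons]; omega) (sub i)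
    obtain ⟨B₁, hB₁, h₁⟩ := cosh_add_mul_spin β (α x)
    obtain ⟨B₂, hB₂, h₂⟩ := cosh_add_mul_spin β (topField β g l sub)
    refine ⟨B * B₂ / B₁, by positivity, fun s => ?_⟩
    have e : ∑ ζ : Conf b (l + 1), treeW β α (n + 1) x (β * spin s)
        (flipTop (l + 1) (n + 1) ζ (.node s₀ sub)) =
        ∑ s', B * Real.exp (spin s' * (topField β g l sub + β * spin s)) /
          (2 * Real.cosh (α x + β * spin s)) := by
      simp only [← h]
      rw [Fintype.sum_bool, ← Finset.sum_add_distrib]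
      refine Finset.sum_congr rfl fun ζ _ => ?_
      rw [← mul_add, sum_rootIs, mul_one]
    rw [e, Fintype.sum_bool, ← add_div, ← mul_add, exp_add_exp_neg_spin, h₁, h₂, msg_succ, mul_sub,
      Real.exp_sub]
    field_simp

include hrec in
/-- The posterior of the root given the spins at distance `l + 1`. -/
theorem condTop_rootIs {l n : ℕ} (x : Vertex b) (hn : l + 1 ≤ n) (hx : x.length + l + 1 ≤ m)
    (c : ℝ) (s s₀ : Bool) (sub : Fin b → Conf b n) :
    condTop β α (l + 1) (n + 1) x c (rootIs s) (.node s₀ sub) = pr (topField β g l sub + c) s := by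
  obtain ⟨B, hB, h⟩ := sum_treeW_rootIs β g α x (hrec x (by omega)) s₀ sub fun i =>
      sum_treeW_msg β g α hrec l n (i :: x) hn (by simp only [List.length_cons]; omega) (sub i)
  have e : ∑ ζ : Conf b (l + 1), treeW β α (n + 1) x c
      (flipTop (l + 1) (n + 1) ζ (.node s₀ sub)) =
      ∑ s', B * Real.exp (spin s' * (topField β g l sub + c)) / (2 * Real.cosh (α x + c)) := by
    simp only [← h]
    rw [Fintype.sum_bool, ← Finset.sum_add_distrib]
    refine Finset.sum_congr rfl fun ζ _ => ?_
    rw [← mul_add, sum_rootIs, mul_one]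
  rw [condTop, h, e, Fintype.sum_bool, ← add_div, ← mul_add, exp_add_exp_neg_spin, pr_add]
  have h1 := Real.cosh_pos (α x + c)
  have h2 := Real.cosh_pos (topField β g l sub + c)
  field_simp

end Posterior

end

/-! ### Concentration of the posterior field at the root -/

section

variable {b : ℕ}

/-- Chebyshev's association inequality. -/
theorem avg_mul_avg_le {Ω : Type*} [Fintype Ω] {w : Ω → ℝ} (hw : IsProb w) {f g : Ω → ℝ}
    (h : ∀ σ σ', 0 ≤ (f σ - f σ') * (g σ - g σ')) :
    avg w f * avg w g ≤ avg w fun σ => f σ * g σ := by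
  have h1 : 0 ≤ avg w fun σ => avg w fun σ' => (f σ - f σ') * (g σ - g σ') :=
    avg_nonneg hw.1 fun σ => avg_nonneg hw.1 fun σ' => h σ σ'
  have e : ∀ σ, (avg w fun σ' => (f σ - f σ') * (g σ - g σ')) =
      f σ * g σ - f σ * avg w g - avg w f * g σ + avg w fun σ => f σ * g σ := by
    intro σ
    have : (fun σ' => (f σ - f σ') * (g σ - g σ')) = fun σ' =>
        ((f σ * g σ - f σ * g σ') - f σ' * g σ) + f σ' * g σ' := by funext σ'; ring
    rw [this, avg_add, avg_sub, avg_sub, avg_const hw, avg_const_mul, avg_mul_const]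
  simp only [e] at h1
  rw [avg_add, avg_sub, avg_sub, avg_const hw, avg_mul_const, avg_const_mul] at h1
  linarith

/-- A lower bound for the conditional probability of a spin. -/
def minProb (b : ℕ) (β g : ℝ) : ℝ :=
  Real.exp (-(|g| + b * β + β)) / (2 * Real.cosh (|g| + b * β + β))

theorem minProb_pos (b : ℕ) (β g : ℝ) : 0 < minProb b β g :=
  div_pos (Real.exp_pos _) (mul_pos two_pos (Real.cosh_pos _))

/-- The effective fields `α` of a tree of depth `m`: they satisfy the tree recursion, are bounded,
and the influence through a vertex is small except in the last `J` levels. -/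
structure FieldBounds (b : ℕ) (β g : ℝ) (m J : ℕ) (ρ : ℝ) (α : Vertex b → ℝ) : Prop where
  recursion : ∀ y : Vertex b, y.length < m → α y = g + ∑ i, msgFun β (α (i :: y))
  abs_le : ∀ y, |α y| ≤ |g| + b * β
  decay : ∀ y : Vertex b, y.length + J ≤ m → b * Real.tanh β * influence β (α y) ≤ ρ

theorem FieldBounds.minProb_le {β g ρ : ℝ} {m J : ℕ} {α : Vertex b → ℝ} (hβ : 0 ≤ β)
    (hα : FieldBounds b β g m J ρ α) (x : Vertex b) (c : ℝ) (s : Bool) (hc : |c| ≤ |β|) :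
    minProb b β g ≤ pr (α x + c) s := by
  have h1 : |α x + c| ≤ |g| + b * β + β :=
    (abs_add_le _ _).trans (add_le_add (hα.abs_le x) (hc.trans (abs_of_nonneg hβ).le))
  have hM : 0 ≤ |g| + b * β + β := by positivity
  have := Real.cosh_pos (α x + c)
  rw [minProb, pr]
  refine div_le_div₀ (Real.exp_pos _).le (Real.exp_le_exp.2 ?_) (by positivity) ?_
  · have h2 := _root_.abs_le.1 h1
    cases s <;> simp only [spin, if_true, Bool.false_eq_true, if_false] <;> linarith
  · have := Real.cosh_le_cosh.2 (show |α x + c| ≤ |(|g| + b * β + β)| by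
      rwa [abs_of_nonneg hM])
    linarith

/-- The configurations of the subtrees of the children. -/
def Conf.sub {n : ℕ} : Conf b (n + 1) → Fin b → Conf b n
  | .node _ sub => sub

section Posterior

variable {β g ρ : ℝ} {m J : ℕ} {α : Vertex b → ℝ}

theorem avg_mul_rootIs {n : ℕ} (x : Vertex b) (c : ℝ) (s : Bool) (F : (Fin b → Conf b n) → ℝ) :
    avg (treeW β α (n + 1) x c) (fun σ => F σ.sub * rootIs s σ) =
      pr (α x + c) s * avg (subW β α n x s) F := by
  rw [avg_treeW_succ]
  cases s <;> simp [avg, rootIs, Conf.sub]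

variable (hα : FieldBounds b β g m J ρ α)

include hα in
-- Bayes' rule: the joint expectation of `φ` of the field and the indicator that the root is `s`,
-- computed once by conditioning on the spins below and once by conditioning on the root.
theorem avg_mul_pr_topField {l n : ℕ} {x : Vertex b} (hn : l + 1 ≤ n) (hx : x.length + l + 1 ≤ m)
    (c : ℝ) (s : Bool) (φ : ℝ → ℝ) :
    avg (treeW β α (n + 1) x c)
      (fun σ => φ (topField β g l σ.sub) * pr (topField β g l σ.sub + c) s) =
      pr (α x + c) s * avg (subW β α n x s) fun sub => φ (topField β g l sub) := by
  rw [← avg_mul_rootIs x c s, ← avg_mul_condTop β α (l + 1) (n + 1) x c _ (rootIs_nonneg s)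
    (rootIs_le_one s)]
  · refine congrArg _ (funext fun σ => ?_)
    cases σ with | node s₀ sub =>
    rw [condTop_rootIs β g α hα.recursion x hn hx]; rfl
  · intro ζ σ
    cases ζ with | node t ζ =>
    cases σ with | node s₀ sub =>
    simp only [flipTop, Conf.sub, topField, msg_flipTop]

include hα in
-- The posterior probability of a plus at the root increases with the observed field, so Chebyshev's
-- inequality shows that a plus at the root can only raise the mean of an increasing function of the
-- field.
theorem avg_subW_mono {l n : ℕ} {x : Vertex b} (hn : l + 1 ≤ n) (hx : x.length + l + 1 ≤ m)
    {φ : ℝ → ℝ} (hφ : Monotone φ) :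
    avg (subW β α n x false) (fun sub => φ (topField β g l sub)) ≤
      avg (subW β α n x true) (fun sub => φ (topField β g l sub)) := by
  have hw := isProb_treeW β α (n + 1) x 0
  have ht := avg_mul_pr_topField hα hn hx 0 true φ
  have hf := avg_mul_pr_topField hα hn hx 0 false φ
  have h1 := avg_mul_pr_topField hα hn hx 0 true fun _ => 1
  simp only [pr_false, mul_sub, mul_one, one_mul, avg_sub] at ht hf h1
  rw [avg_const (isProb_subW β α n x true), mul_one] at h1
  have hc := avg_mul_avg_le hw (f := fun σ => φ (topField β g l σ.sub))
    (g := fun σ => pr (topField β g l σ.sub + 0) true) (by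
      intro σ σ'
      rcases le_total (topField β g l σ.sub) (topField β g l σ'.sub) with h | h
      · exact mul_nonneg_of_nonpos_of_nonpos (sub_nonpos.2 (hφ h))
          (sub_nonpos.2 (pr_true_mono (by simpa using h)))
      · exact mul_nonneg (sub_nonneg.2 (hφ h)) (sub_nonneg.2 (pr_true_mono (by simpa using h))))
  rw [h1, ht] at hc
  rw [ht] at hf
  set p := pr (α x + 0) true
  have hp : 0 < p := pr_pos _ _
  have hp1 : 0 < 1 - p := by have := pr_pos (α x + 0) false; rwa [pr_false] at this
  set a := avg (subW β α n x true) fun sub => φ (topField β g l sub)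
  set a' := avg (subW β α n x false) fun sub => φ (topField β g l sub)
  have h2 : avg (treeW β α (n + 1) x 0) (fun σ => φ (topField β g l σ.sub)) =
      p * a + (1 - p) * a' := by linarith
  rw [h2] at hc
  have h3 : 0 ≤ (p * (1 - p)) * (a - a') := by nlinarith
  have := (mul_nonneg_iff_of_pos_left (mul_pos hp hp1)).1 h3
  linarith

/-- The bound on the dependence of a message on the spin of its sender. -/
def msgGap (b : ℕ) (β ρ : ℝ) (J l : ℕ) : ℝ := 2 * β * (ρ ^ l * (b / ρ) ^ min l J)

variable (hβ : 0 ≤ β) (hρ : 0 < ρ) (hρb : ρ ≤ b)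

include hβ hρ in
theorem msgGap_nonneg (l : ℕ) : 0 ≤ msgGap b β ρ J l := by unfold msgGap; positivity

include hρ hρb hβ in
theorem msgGap_le (l : ℕ) : msgGap b β ρ J l ≤ 2 * β * (b / ρ) ^ J * ρ ^ l := by
  have : (b / ρ : ℝ) ^ min l J ≤ (b / ρ) ^ J :=
    pow_le_pow_right₀ ((one_le_div hρ).2 hρb) (min_le_right _ _)
  rw [msgGap]
  calc _ ≤ 2 * β * (ρ ^ l * (b / ρ) ^ J) := by gcongr
    _ = _ := by ring

/-- The mean field at the root given the spin `s` there. -/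
def meanField (β g : ℝ) (α : Vertex b → ℝ) (l n : ℕ) (x : Vertex b) (s : Bool) : ℝ :=
  avg (subW β α n x s) fun sub => topField β g l sub

/-- The Markov property: the parent's spin affects the message only through the spin at `y`, whose
law it shifts by the influence. -/
theorem avg_msg_sub (l n : ℕ) (y : Vertex b) :
    avg (treeW β α (n + 1) y (β * spin true)) (msg β g l) -
      avg (treeW β α (n + 1) y (β * spin false)) (msg β g l) =
    influence β (α y) * (avg (subW β α n y true) (fun sub => msg β g l (.node true sub)) -
      avg (subW β α n y false) (fun sub => msg β g l (.node false sub))) := by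
  rw [avg_treeW_succ, avg_treeW_succ]
  have e : ∀ c (F : Bool → ℝ), avg (pr c) F = pr c true * F true + (1 - pr c true) * F false := by
    intro c F
    rw [avg, Fintype.sum_bool, pr_false]
  rw [e, e, influence]
  simp only [spin, if_true, Bool.false_eq_true, if_false, mul_one, mul_neg, ← sub_eq_add_neg]
  ring

theorem meanField_sub (l n : ℕ) (x : Vertex b) :
    meanField β g α l (n + 1) x true - meanField β g α l (n + 1) x false =
      ∑ i : Fin b, influence β (α (i :: x)) *
        (avg (subW β α n (i :: x) true) (fun sub => msg β g l (.node true sub)) -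
        avg (subW β α n (i :: x) false) (fun sub => msg β g l (.node false sub))) := by
  have h : ∀ s, meanField β g α l (n + 1) x s =
      g + ∑ i : Fin b, avg (treeW β α (n + 1) (i :: x) (β * spin s)) (msg β g l) := by
    intro s
    simp only [meanField, topField]
    rw [avg_add, avg_const (isProb_subW β α _ x s), avg_sum]
    congr 1
    refine Finset.sum_congr rfl fun i _ => ?_
    rw [subW, ← avg_piW_resample i (isProb_treeW β α _ _ _).2]
    simp only [Function.update_self]
    exact avg_const (isProb_piW fun j => isProb_treeW β α _ _ _) _
  rw [h, h, add_sub_add_left_eq_sub, ← Finset.sum_sub_distrib]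
  exact Finset.sum_congr rfl fun i _ => avg_msg_sub l n (i :: x)

include hα hβ hρ hρb in
-- One more level multiplies the gap by the sum over the children of `tanh β * influence`: the
-- contraction of `msgFun` contributes `tanh β`, and passing the spin down to the child contributes
-- the influence. By `decay` this sum is at most `ρ`.
theorem avg_msg_node_sub_le (l : ℕ) : ∀ (n : ℕ) (x : Vertex b), l ≤ n → x.length + l ≤ m →
    avg (subW β α n x true) (fun sub => msg β g l (.node true sub)) -
      avg (subW β α n x false) (fun sub => msg β g l (.node false sub)) ≤ msgGap b β ρ J l := by
  induction l with
  | zero =>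
    intro n x _ _
    simp only [msg]
    rw [avg_const (isProb_subW β α _ x _), avg_const (isProb_subW β α _ x _)]
    simp only [spin, if_true, Bool.false_eq_true, if_false, msgGap]
    simp
    linarith
  | succ l ih =>
    intro n x hn hx
    simp only [msg_succ]
    have hθ := tanh_nonneg' hβ
    have h1 := avg_subW_mono hα hn (by omega) (tanh_mul_sub_msgFun_mono hβ)
    simp only [avg_sub, avg_const_mul] at h1
    have h2 : avg (subW β α n x true) (fun sub => msgFun β (topField β g l sub)) -
        avg (subW β α n x false) (fun sub => msgFun β (topField β g l sub)) ≤
        Real.tanh β * (meanField β g α l n x true - meanField β g α l n x false) := by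
      simp only [meanField]; linarith
    refine h2.trans ?_
    obtain ⟨n, rfl⟩ : ∃ n', n = n' + 1 := ⟨n - 1, by omega⟩
    rw [meanField_sub, Finset.mul_sum]
    have hb0 : (0 : ℝ) < b := hρ.trans_le hρb
    have h3 : ∀ i : Fin b, Real.tanh β * (influence β (α (i :: x)) *
        (avg (subW β α n (i :: x) true) (fun sub => msg β g l (.node true sub)) -
        avg (subW β α n (i :: x) false) (fun sub => msg β g l (.node false sub)))) ≤
        msgGap b β ρ J (l + 1) / b := by
      intro i
      have h4 := ih n (i :: x) (by omega) (by simp only [List.length_cons]; omega)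
      have h5 := mul_nonneg hθ (influence_nonneg hβ (α (i :: x)))
      rw [← mul_assoc, le_div_iff₀ hb0]
      have h6 := mul_le_mul_of_nonneg_left h4 h5
      have h7 := msgGap_nonneg (b := b) (J := J) hβ hρ l
      -- The observed level is `l` levels below the child `i :: x` and no deeper than level `m`; so
      -- for `J ≤ l` the child is outside the last `J` levels. Otherwise the trivial factor `b` is
      -- used, at most `J` times in all.
      by_cases hl : J ≤ l
      · have h8 := hα.decay (i :: x) (by simp only [List.length_cons]; omega)
        have e : msgGap b β ρ J (l + 1) = ρ * msgGap b β ρ J l := by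
          rw [msgGap, msgGap, min_eq_right hl, min_eq_right (by omega), pow_succ]; ring
        rw [e]
        calc _ ≤ Real.tanh β * influence β (α (i :: x)) * msgGap b β ρ J l * b := by gcongr
          _ = (b * Real.tanh β * influence β (α (i :: x))) * msgGap b β ρ J l := by ring
          _ ≤ _ := by gcongr
      · have e : msgGap b β ρ J (l + 1) = b * msgGap b β ρ J l := by
          rw [msgGap, msgGap, min_eq_left (by omega), min_eq_left (by omega), pow_succ, pow_succ]
          field_simp
        have h9 : Real.tanh β * influence β (α (i :: x)) ≤ 1 :=
          mul_le_one₀ (Real.tanh_lt_one β).le (influence_nonneg hβ _) (influence_le_one hβ _)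
        rw [e]
        calc _ ≤ Real.tanh β * influence β (α (i :: x)) * msgGap b β ρ J l * b := by gcongr
          _ ≤ 1 * msgGap b β ρ J l * b := by gcongr
          _ = _ := by ring
    refine (Finset.sum_le_sum fun i _ => h3 i).trans (le_of_eq ?_)
    simp only [Finset.sum_const, Finset.card_univ, Fintype.card_fin, nsmul_eq_mul]
    field_simp

include hα hβ hρ hρb in
theorem meanField_sub_le {l n : ℕ} {x : Vertex b} (hn : l + 1 ≤ n) (hx : x.length + l + 1 ≤ m) :
    meanField β g α l n x true - meanField β g α l n x false ≤ b * msgGap b β ρ J l := by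
  obtain ⟨n, rfl⟩ : ∃ n', n = n' + 1 := ⟨n - 1, by omega⟩
  rw [meanField_sub]
  have h3 : ∀ i : Fin b, influence β (α (i :: x)) *
      (avg (subW β α n (i :: x) true) (fun sub => msg β g l (.node true sub)) -
      avg (subW β α n (i :: x) false) (fun sub => msg β g l (.node false sub))) ≤
      msgGap b β ρ J l := by
    intro i
    have h4 := avg_msg_node_sub_le hα hβ hρ hρb l n (i :: x) (by omega)
      (by simp only [List.length_cons]; omega)
    have h5 := influence_nonneg hβ (α (i :: x))
    have h7 := msgGap_nonneg (b := b) (J := J) hβ hρ l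
    calc _ ≤ influence β (α (i :: x)) * msgGap b β ρ J l := by gcongr
      _ ≤ 1 * msgGap b β ρ J l := by gcongr; exact influence_le_one hβ _
      _ = _ := one_mul _
  refine (Finset.sum_le_sum fun i _ => h3 i).trans (le_of_eq ?_)
  simp

/-- The constant in `avg_abs_topField_sub_le`. -/
def fluctConst (b : ℕ) (β g ρ : ℝ) (J : ℕ) : ℝ :=
  2 * Real.cosh (|g| + b * β) ^ 2 / minProb b β g * √(b * (2 * β * (b / ρ) ^ J))

include hα hβ hρ hρb in
/-- The field at the root given the spins at distance `l + 1` concentrates in mean. -/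
theorem avg_abs_topField_sub_le {l n : ℕ} {x : Vertex b} (hn : l + 1 ≤ n)
    (hx : x.length + l + 1 ≤ m) (s : Bool) :
    avg (subW β α n x s) (fun sub => |topField β g l sub - α x|) ≤
      fluctConst b β g ρ J * √(ρ ^ l) := by
  have hw := isProb_treeW β α (n + 1) x 0
  set T : ℝ → ℝ := fun a => pr a true with hT
  set E : Bool → (ℝ → ℝ) → ℝ := fun s φ => avg (subW β α n x s) fun sub => φ (topField β g l sub)
    with hE
  set p := pr (α x) true with hp
  have hp0 : 0 < p := pr_pos _ _
  have hp1 : 0 < 1 - p := by have := pr_pos (α x) false; rwa [pr_false] at this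
  have P : ∀ φ : ℝ → ℝ, avg (treeW β α (n + 1) x 0) (fun σ => φ (topField β g l σ.sub) *
      T (topField β g l σ.sub)) = p * E true φ := fun φ => by
    simpa using avg_mul_pr_topField hα hn hx 0 true φ
  have P' : ∀ φ : ℝ → ℝ, avg (treeW β α (n + 1) x 0) (fun σ => φ (topField β g l σ.sub)) =
      p * E true φ + (1 - p) * E false φ := fun φ => by
    have h1 := P φ
    have h2 := avg_mul_pr_topField hα hn hx 0 false φ
    simp only [pr_false, mul_sub, mul_one, avg_sub, add_zero] at h2
    simp only [hT] at h1
    rw [h1] at h2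
    linarith
  have hEc : E true (fun _ => 1) = 1 := avg_const (isProb_subW β α n x true) 1
  have hmean : avg (treeW β α (n + 1) x 0) (fun σ => T (topField β g l σ.sub)) = p := by
    have := P fun _ => 1
    rw [hEc] at this
    simpa using this
  -- The posterior has mean `p`, and by Bayes its variance is `p (1 - p)` times the gap between its
  -- means under the two root spins. Since `a - pr a true` is increasing, this gap is at most that
  -- of the mean fields, which decays like `ρ ^ l`.
  have hvar : avg (treeW β α (n + 1) x 0) (fun σ => (T (topField β g l σ.sub) - p) ^ 2) ≤
      b * msgGap b β ρ J l := by
    have e : ∀ σ : Conf b (n + 1), (T (topField β g l σ.sub) - p) ^ 2 =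
        T (topField β g l σ.sub) * T (topField β g l σ.sub) -
          2 * p * T (topField β g l σ.sub) + p ^ 2 := fun σ => by ring
    simp only [e]
    rw [avg_add, avg_sub, avg_const hw, avg_const_mul, hmean, P T]
    have h1 := P' T
    rw [hmean] at h1
    have h2 : E false T ≤ E true T := avg_subW_mono hα hn hx pr_true_mono
    have h3 := avg_subW_mono hα hn hx sub_pr_true_mono
    simp only [avg_sub] at h3
    have h4 : E true T - E false T ≤ b * msgGap b β ρ J l := by
      refine le_trans ?_ (meanField_sub_le hα hβ hρ hρb hn hx)
      simp only [meanField, hE, hT]; linarith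
    have h5 : p * E true T - 2 * p * p + p ^ 2 = p * (1 - p) * (E true T - E false T) := by
      linear_combination (-p) * h1
    rw [h5]
    refine le_trans ?_ h4
    refine mul_le_of_le_one_left (by linarith) ?_
    nlinarith
  have hq := minProb_pos b β g
  have hqp : minProb b β g ≤ pr (α x) s := by
    simpa using hα.minProb_le hβ x 0 s (by simp)
  -- Conditioning on the root spin costs a factor `1 / minProb b β g`; the `L¹` norm is bounded by
  -- the root of the variance.
  have h6 : minProb b β g * E s (fun a => |T a - p|) ≤ √(b * msgGap b β ρ J l) := by
    have hEs : ∀ s, 0 ≤ E s fun a => |T a - p| := fun s =>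
      avg_nonneg (isProb_subW β α n x s).1 fun _ => abs_nonneg _
    have h7 : pr (α x) s * E s (fun a => |T a - p|) ≤
        avg (treeW β α (n + 1) x 0) (fun σ => |T (topField β g l σ.sub) - p|) := by
      rw [P' fun a => |T a - p|]
      cases s
      · rw [pr_false]
        have := mul_nonneg hp0.le (hEs true)
        linarith
      · have := mul_nonneg hp1.le (hEs false)
        linarith
    refine (mul_le_mul_of_nonneg_right hqp (hEs s)).trans (h7.trans ?_)
    refine Real.le_sqrt_of_sq_le ?_
    refine (avg_sq_le hw _).trans ?_
    simpa only [sq_abs] using hvar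
  have h8 : E s (fun a => |a - α x|) ≤
      2 * Real.cosh (|g| + b * β) ^ 2 * E s (fun a => |T a - p|) := by
    simp only [hE]
    rw [← avg_const_mul]
    exact avg_mono (isProb_subW β α n x s).1 fun sub =>
      abs_sub_le_pr_true (abs_topField_le hβ g l sub) (hα.abs_le x)
  have h9 : E s (fun a => |T a - p|) ≤ √(b * msgGap b β ρ J l) / minProb b β g := by
    rw [le_div_iff₀ hq]; linarith
  have h10 : √(b * msgGap b β ρ J l) ≤ √(b * (2 * β * (b / ρ) ^ J)) * √(ρ ^ l) := by
    rw [← Real.sqrt_mul (by positivity)]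
    refine Real.sqrt_le_sqrt ?_
    rw [mul_assoc]
    exact mul_le_mul_of_nonneg_left (msgGap_le hβ hρ hρb l) (by positivity)
  calc _ ≤ 2 * Real.cosh (|g| + b * β) ^ 2 * E s (fun a => |T a - p|) := h8
    _ ≤ 2 * Real.cosh (|g| + b * β) ^ 2 * ((√(b * (2 * β * (b / ρ) ^ J)) * √(ρ ^ l)) /
        minProb b β g) := by
        gcongr
        exact h9.trans (by gcongr)
    _ = _ := by rw [fluctConst]; ring

include hα hβ hρ hρb in
/-- Exponential moments of the field at the root given the spins at distance `k + j + 1`. -/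
theorem avg_exp_topField_sub_le {θ : ℝ} (hθ : Real.tanh β ≤ θ) (k j : ℕ) :
    ∀ (n : ℕ) (x : Vertex b) (_ : k + j + 1 ≤ n) (_ : x.length + (k + j) + 1 ≤ m) (s : Bool)
      (t : ℝ) (_ : 0 ≤ t) (_ : t * θ ^ j ≤ 1),
    avg (subW β α n x s) (fun sub => Real.exp (t * |topField β g (k + j) sub - α x|)) ≤
      Real.exp (b ^ j * (Real.exp (2 * (|g| + b * β)) * (fluctConst b β g ρ J * √(ρ ^ k)))) := by
  set ε := Real.exp (2 * (|g| + b * β)) * (fluctConst b β g ρ J * √(ρ ^ k)) with hε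
  have hθ0 : 0 ≤ θ := (tanh_nonneg' hβ).trans hθ
  induction j with
  | zero =>
    intro n x hn hx s t ht htθ
    rw [pow_zero, mul_one] at htθ
    rw [pow_zero, one_mul]
    -- For `t ≤ 1` the bounded deviation `y` satisfies `exp (t * y) ≤ 1 + y * exp (2 * (|g| + b *
    -- β))`, so the estimate in mean suffices.
    have h1 : ∀ sub : Fin b → Conf b n, Real.exp (t * |topField β g (k + 0) sub - α x|) ≤
        1 + Real.exp (2 * (|g| + b * β)) * |topField β g k sub - α x| := by
      intro sub
      rw [add_zero]
      set y := |topField β g k sub - α x|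
      have hy0 : 0 ≤ y := abs_nonneg _
      have hy : y ≤ 2 * (|g| + b * β) := by
        have h2 := abs_topField_le hβ g k sub
        have h3 := hα.abs_le x
        have := abs_sub (topField β g k sub) (α x)
        linarith
      have h4 : Real.exp (t * y) ≤ Real.exp y :=
        Real.exp_le_exp.2 (mul_le_of_le_one_left hy0 htθ)
      have h5 : Real.exp y - 1 ≤ y * Real.exp y := by
        have := mul_le_mul_of_nonneg_right (Real.add_one_le_exp (-y)) (Real.exp_pos y).le
        rw [← Real.exp_add, neg_add_cancel, Real.exp_zero] at this
        linarith
      have h6 : y * Real.exp y ≤ y * Real.exp (2 * (|g| + b * β)) := by gcongr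
      linarith
    refine (avg_mono (isProb_subW β α n x s).1 h1).trans ?_
    rw [avg_add, avg_const (isProb_subW β α n x s), avg_const_mul]
    have h2 := avg_abs_topField_sub_le hα hβ hρ hρb (by omega : k + 1 ≤ n) (by omega) s
    have h3 : Real.exp (2 * (|g| + b * β)) *
        avg (subW β α n x s) (fun sub => |topField β g k sub - α x|) ≤ ε := by
      rw [hε]; gcongr
    linarith [Real.add_one_le_exp ε]
  | succ j ih =>
    intro n x hn hx s t ht htθ
    obtain ⟨n, rfl⟩ : ∃ n', n = n' + 1 := ⟨n - 1, by omega⟩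
    set φ : Fin b → Conf b (n + 1) → ℝ := fun i σ =>
      Real.exp (t * θ * |topField β g (k + j) σ.sub - α (i :: x)|) with hφ
    -- The deviation at the root is at most `θ` times the sum of those at the children, which are
    -- independent given the root spin. The parameter drops from `t` to `t * θ`, and the moment
    -- bound is raised to the power `b`.
    have h1 : ∀ sub : Fin b → Conf b (n + 1),
        Real.exp (t * |topField β g (k + (j + 1)) sub - α x|) ≤ ∏ i, φ i (sub i) := by
      intro sub
      rw [hφ, ← Real.exp_sum, ← Finset.mul_sum, mul_assoc]
      refine Real.exp_le_exp.2 (mul_le_mul_of_nonneg_left ?_ ht)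
      rw [hα.recursion x (by omega), topField, add_sub_add_left_eq_sub, ← Finset.sum_sub_distrib,
        Finset.mul_sum]
      refine (Finset.abs_sum_le_sum_abs _ _).trans (Finset.sum_le_sum fun i _ => ?_)
      cases hs : sub i with | node s₀ sub' =>
      rw [← add_assoc, msg_succ]
      refine (abs_msgFun_sub_le hβ _ _).trans ?_
      exact mul_le_mul_of_nonneg_right hθ (abs_nonneg _)
    refine (avg_mono (isProb_subW β α _ x s).1 h1).trans ?_
    rw [subW, avg_piW_prod]
    have h2 : ∀ i, avg (treeW β α (n + 1) (i :: x) (β * spin s)) (φ i) ≤ Real.exp (b ^ j * ε) := by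
      intro i
      rw [avg_treeW_succ]
      refine (avg_mono (isProb_pr _).1 fun s' => ih n (i :: x) (by omega)
        (by simp only [List.length_cons]; omega) s' (t * θ) (by positivity) ?_).trans_eq
        (avg_const (isProb_pr _) _)
      rw [mul_assoc, ← pow_succ']; exact htθ
    refine (Finset.prod_le_prod (fun i _ => avg_nonneg (isProb_treeW β α _ _ _).1
      fun σ => (Real.exp_pos _).le) fun i _ => h2 i).trans (le_of_eq ?_)
    rw [Finset.prod_const, Finset.card_univ, Fintype.card_fin, ← Real.exp_nat_mul, ← mul_assoc,
      ← pow_succ']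

end Posterior

end

/-! ### From concentration to the entropy–energy inequality -/

section

variable {b : ℕ}

section LogSobolev

variable {β g ρ : ℝ} {m J : ℕ} {α : Vertex b → ℝ}

/-- The spins at distance `l + 1` are in the top `l + 2` levels, so a function of the field they
determine comes out of the conditional expectation given those levels. -/
theorem avg_extW_mul_topField (β : ℝ) (α : Vertex b → ℝ) (g : ℝ) {l n : ℕ} (hn : l + 1 ≤ n)
    (x : Vertex b) (c : ℝ) (f : Conf b (n + 1) → ℝ) (φ : ℝ → ℝ) (ζ : Conf b (l + 2)) :
    avg (extW β α (l + 2) (n + 1) x c ζ) (fun σ => f σ * φ (topField β g l σ.sub)) =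
      avg (extW β α (l + 2) (n + 1) x c ζ) f * φ (topField β g l ζ.sub) := by
  cases ζ with | node s ζ =>
  rw [avg_extW_succ, avg_extW_succ, ← avg_mul_const]
  refine Finset.sum_congr rfl fun sub _ => ?_
  by_cases h : piW (fun i => extW β α (l + 1) n (i :: x) (β * spin s) (ζ i)) sub = 0
  · rw [h]; simp
  · rw [piW, ← ne_eq, Finset.prod_ne_zero_iff] at h
    have : topField β g l (Conf.node s sub).sub = topField β g l (Conf.node s ζ).sub := by
      simp only [topField, Conf.sub]
      congr 1
      exact Finset.sum_congr rfl fun i _ =>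
        msg_extW β α g l (l + 1) n le_rfl hn _ _ _ _ (h i (Finset.mem_univ i))
    beta_reduce
    rw [this]

/-- Entropy times mean is at most the variance. For a function of a single spin, `p (1 - p)` times
the variance is the squared covariance with the indicator of plus. -/
theorem rootEntropy_mul_le {n : ℕ} (x : Vertex b) (c : ℝ) {f : Conf b (n + 1) → ℝ}
    (hf : ∀ σ, 0 ≤ f σ) :
    pr (α x + c) true * pr (α x + c) false * (avg (treeW β α (n + 1) x c) f *
      rootEntropy β α (n + 1) x c f) ≤
    avg (treeW β α (n + 1) x c) (fun σ => f σ * (rootIs true σ - pr (α x + c) true)) ^ 2 := by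
  have h1 := entropy_mul_avg_le (isProb_pr (α x + c)) (f := fun s =>
    avg (subW β α n x s) fun sub => f (.node s sub)) fun s =>
      avg_nonneg (isProb_subW β α n x s).1 fun _ => hf _
  have e : ∀ F : Bool → ℝ, avg (pr (α x + c)) F = pr (α x + c) true * F true +
      (1 - pr (α x + c) true) * F false := by
    intro F
    rw [avg, Fintype.sum_bool, pr_false]
  have h2 : avg (treeW β α (n + 1) x c) (fun σ => f σ * (rootIs true σ - pr (α x + c) true)) =
      pr (α x + c) true * (1 - pr (α x + c) true) *
        (avg (subW β α n x true) (fun sub => f (.node true sub)) -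
          avg (subW β α n x false) fun sub => f (.node false sub)) := by
    rw [avg_treeW_succ, e]
    simp only [rootIs, if_true, Bool.false_eq_true, if_false, avg_mul_const]
    ring
  rw [h2, avg_treeW_succ, pr_false]
  change _ * (_ * entropy _ _) ≤ _
  rw [← avg_mul_const] at h1
  rw [avg_mul_const, e, e] at h1
  rw [e]
  have hp := pr_pos (α x + c) true
  have hp1 : 0 < 1 - pr (α x + c) true := by
    have := pr_pos (α x + c) false; rwa [pr_false] at this
  refine (mul_le_mul_of_nonneg_left h1 (mul_pos hp hp1).le).trans (le_of_eq ?_)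
  ring

/-- The constant in the estimate for resampling the top `k` levels. -/
def resampleConst (b : ℕ) (q : ℝ) (k : ℕ) : ℝ :=
  Fintype.card (Conf b k) ^ 2 * (2 * (1 + weightRatio b q k)) * blockConst b q k

theorem resampleConst_nonneg {q : ℝ} (hq0 : 0 < q) (hq1 : q ≤ 1) (k : ℕ) :
    0 ≤ resampleConst b q k := by
  have h2 := one_le_weightRatio (b := b) hq0 hq1 k
  have h3 := blockConst_nonneg (b := b) hq0 hq1 k
  rw [resampleConst]; positivity

theorem topSum_rootEnergy_mono {k k' : ℕ} (h : k ≤ k') : ∀ (n : ℕ) (x : Vertex b) (c : ℝ)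
    (f : Conf b n → ℝ), topSum β α (rootEnergy β α) k n x c f ≤
      topSum β α (rootEnergy β α) k' n x c f := by
  induction k generalizing k' with
  | zero => intro n x c f; exact topSum_rootEnergy_nonneg k' n x c f
  | succ k ih =>
    intro n x c f
    obtain ⟨k', rfl⟩ : ∃ l, k' = l + 1 := ⟨k' - 1, by omega⟩
    refine add_le_add le_rfl ?_
    cases n with
    | zero => exact le_rfl
    | succ n =>
      exact avg_mono (isProb_pr _).1 fun s => Finset.sum_le_sum fun i _ =>
        avg_mono (isProb_subW β α n x s).1 fun sub => ih (by omega) _ _ _ _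

variable (hα : FieldBounds b β g m J ρ α) (hβ : 0 ≤ β) (hρ : 0 < ρ) (hρb : ρ ≤ b)

include hα hβ hρ hρb in
-- The covariance of `f` with the root spin is split at the conditional expectation given the spins
-- below the top `k + j + 1` levels. The deviation is paid for by block energy; the posterior, small
-- by concentration, by `θ ^ j` times the entropy in the top `k + j + 2` levels. If the tree ends
-- within the block, the conditional expectation is constant and only the first term occurs.
theorem rootEntropy_le {θ : ℝ} (hθ : Real.tanh β ≤ θ) (hθ0 : 0 < θ) (hθ1 : θ ≤ 1) {k j : ℕ}
    (hkj : b ^ j * (Real.exp (2 * (|g| + b * β)) * (fluctConst b β g ρ J * √(ρ ^ k))) ≤ 1) :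
    FLe β (m + 1) (rootEntropy β α) (fun n x c f =>
      2 / minProb b β g ^ 2 *
        (∑ i ∈ Finset.range (k + j + 2), resampleConst b (minProb b β g) i) *
          topSum β α (rootEnergy β α) (k + j + 1) n x c f +
      2 / minProb b β g ^ 2 * (36 * Real.exp 1 ^ 2 * θ ^ j) *
          topSum β α (rootEntropy β α) (k + j + 2) n x c f) := by
  intro n x c f hn hc hf
  set q := minProb b β g with hq
  have hq0 : 0 < q := minProb_pos b β g
  have hqle : ∀ (x : Vertex b) (c : ℝ) (s : Bool), |c| ≤ |β| → q ≤ pr (α x + c) s :=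
    hα.minProb_le hβ
  have hq1 : q ≤ 1 := (hqle [] 0 true (by simp)).trans (pr_le_one _ _)
  have hR : ∀ i, 0 ≤ resampleConst b q i := resampleConst_nonneg hq0 hq1
  -- The block has `k + j + 1` levels, or fewer near the boundary; the sum dominates the constant in
  -- every case.
  set RR := ∑ i ∈ Finset.range (k + j + 2), resampleConst b q i with hRR
  have hRR0 : 0 ≤ RR := Finset.sum_nonneg fun i _ => hR i
  have hRi : ∀ i, i ≤ k + j + 1 → resampleConst b q i ≤ RR := fun i hi =>
    Finset.single_le_sum (fun i _ => hR i) (Finset.mem_range.2 (by omega))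
  have hTn : ∀ i, 0 ≤ topSum β α (rootEnergy β α) i n x c f := fun i =>
    topSum_rootEnergy_nonneg i n x c f
  set D := topSum β α (rootEnergy β α) (k + j + 1) n x c f with hD
  have hD0 : 0 ≤ D := hTn _
  set S := topSum β α (rootEntropy β α) (k + j + 2) n x c f with hS
  have hS0 : 0 ≤ S := by
    have : ∀ i n (x : Vertex b) c (f : Conf b n → ℝ), x.length + n = m + 1 → |c| ≤ |β| →
        (∀ σ, 0 ≤ f σ) → 0 ≤ topSum β α (rootEntropy β α) i n x c f := by
      intro i
      induction i with
      | zero => intro n x c f _ _ _; exact le_rfl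
      | succ i ih =>
        intro n x c f hn hc hf
        refine add_nonneg (rootEntropy_nonneg β α (m + 1) n x c f hn hc hf) ?_
        have := (show FLe β (m + 1) (fun _ _ _ _ => 0) (topSum β α (rootEntropy β α) i) from
          ih).childSum (α := α) n x c f hn hc hf
        rwa [childSum_zero] at this
    exact this _ n x c f hn hc hf
  cases n with
  | zero =>
    change (0 : ℝ) ≤ _
    positivity
  | succ n =>
    have hw := isProb_treeW β α (n + 1) x c
    set F := avg (treeW β α (n + 1) x c) f with hF
    have hF0 : 0 ≤ F := avg_nonneg hw.1 hf
    have hH0 := rootEntropy_nonneg β α (m + 1) (n + 1) x c f hn hc hf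
    set H := rootEntropy β α (n + 1) x c f
    set p := pr (α x + c) true with hp
    have hpos : 0 ≤ 2 / q ^ 2 * RR * D + 2 / q ^ 2 * (36 * Real.exp 1 ^ 2 * θ ^ j) * S := by
      have := hTn (k + j + 1)
      positivity
    rcases hF0.eq_or_lt with h0 | hFpos
    · -- the observable vanishes
      have hf0 : f = fun _ => 0 := by
        funext σ
        have := avg_eq_zero_of_nonneg hw.1 hf h0.symm σ
        exact (mul_eq_zero.1 this).resolve_left (treeW_pos β α _ _ _ _).ne'
      have : H = 0 := by
        simp only [H, rootEntropy, hf0]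
        rw [show (fun s => avg (subW β α n x s) fun _ => (0 : ℝ)) = fun _ => 0 from
          funext fun s => avg_const (isProb_subW β α n x s) 0]
        exact entropy_const (isProb_pr _) 0
      rw [this]; exact hpos
    have hmain := rootEntropy_mul_le (β := β) (α := α) x c hf
    have hqq : q ^ 2 * (F * H) ≤ p * pr (α x + c) false * (F * H) := by
      rw [sq]
      gcongr
      · exact (pr_pos _ _).le
      · exact hqle x c true hc
      · exact hqle x c false hc
    suffices h : avg (treeW β α (n + 1) x c) (fun σ => f σ * (rootIs true σ - p)) ^ 2 ≤
        F * (2 * RR * D + 2 * (36 * Real.exp 1 ^ 2 * θ ^ j) * S) by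
      have h2 := (hqq.trans hmain).trans h
      have h3 : q ^ 2 * H ≤ 2 * RR * D + 2 * (36 * Real.exp 1 ^ 2 * θ ^ j) * S := by
        refine le_of_mul_le_mul_left (le_trans (le_of_eq ?_) h2) hFpos
        ring
      have h4 : H ≤ (2 * RR * D + 2 * (36 * Real.exp 1 ^ 2 * θ ^ j) * S) / q ^ 2 := by
        rw [le_div_iff₀ (by positivity)]; linarith
      refine h4.trans (le_of_eq ?_)
      ring
    by_cases hcase : n ≤ k + j
    · -- the block reaches the boundary
      have h1 := avg_mul_sub_condTop_sq_le hq0 hqle (n + 1) (n + 1) x c hc hf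
        (rootIs_nonneg true) (rootIs_le_one true)
      have hmean : avg (treeW β α (n + 1) x c) (rootIs true) = p := by
        have := avg_mul_rootIs (β := β) (α := α) x c true (fun _ : Fin b → Conf b n => (1 : ℝ))
        rw [avg_const (isProb_subW β α n x true)] at this
        simpa using this
      simp only [condTop_self, hmean] at h1
      refine h1.trans ?_
      have h2 : topSum β α (rootEnergy β α) (n + 1) (n + 1) x c f ≤ D :=
        topSum_rootEnergy_mono (by omega) _ _ _ _
      have h3 := hRi (n + 1) (by omega)
      calc _ ≤ RR * F * D := by
            refine mul_le_mul (mul_le_mul_of_nonneg_right h3 hF0) h2 (hTn _) (by positivity)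
        _ ≤ _ := by
            have := hTn (k + j + 1)
            have h5 : 0 ≤ F * (RR * D) := by positivity
            have h6 : 0 ≤ F * (2 * (36 * Real.exp 1 ^ 2 * θ ^ j) * S) := by positivity
            nlinarith
    · push Not at hcase
      set l := k + j with hl
      have hln : l + 1 ≤ n := hcase
      have hlx : x.length + l + 1 ≤ m := by omega
      set X : Conf b (n + 1) → ℝ := fun σ => pr (topField β g l σ.sub + c) true - p with hX
      -- resampling the top block
      have h1 := avg_mul_sub_condTop_sq_le hq0 hqle (l + 1) (n + 1) x c hc hf
        (rootIs_nonneg true) (rootIs_le_one true)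
      have hpost : ∀ σ : Conf b (n + 1), condTop β α (l + 1) (n + 1) x c (rootIs true) σ =
          X σ + p := by
        intro σ
        cases σ with | node s sub =>
        rw [condTop_rootIs β g α hα.recursion x hln hlx]
        simp [hX, Conf.sub]
      have hsplit : avg (treeW β α (n + 1) x c) (fun σ => f σ * (rootIs true σ - p)) =
          avg (treeW β α (n + 1) x c) (fun σ => f σ * (rootIs true σ -
            condTop β α (l + 1) (n + 1) x c (rootIs true) σ)) +
          avg (treeW β α (n + 1) x c) (fun σ => f σ * X σ) := by
        rw [← avg_add]
        congr 1; funext σ; rw [hpost]; ring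
      -- the covariance with the posterior
      set F' : Conf b (l + 2) → ℝ := fun ζ => avg (extW β α (l + 2) (n + 1) x c ζ) f with hF'
      set Y : Conf b (l + 2) → ℝ := fun ζ => pr (topField β g l ζ.sub + c) true - p with hY
      have hF'0 : ∀ ζ, 0 ≤ F' ζ := fun ζ => avg_nonneg (isProb_extW β α _ _ _ _ ζ).1 hf
      have hcov : avg (treeW β α (n + 1) x c) (fun σ => f σ * X σ) =
          avg (treeW β α (l + 2) x c) (fun ζ => F' ζ * Y ζ) := by
        rw [← avg_treeW_extW β α (k := l + 2) (by omega)]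
        congr 1; funext ζ
        exact avg_extW_mul_topField β α g hln x c f (fun a => pr (a + c) true - p) ζ
      have hmeanF : avg (treeW β α (l + 2) x c) F' = F :=
        avg_treeW_extW β α (by omega) x c f
      have hentF : entropy (treeW β α (l + 2) x c) F' ≤ S :=
        entropy_extW_le β α (by omega) x c hf
      have hY1 : ∀ ζ, |Y ζ| ≤ 1 := by
        intro ζ
        rw [abs_le]
        have a1 := pr_pos (topField β g l ζ.sub + c) true
        have a2 := pr_le_one (topField β g l ζ.sub + c) true
        have a3 := pr_pos (α x + c) true
        have a4 := pr_le_one (α x + c) true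
        constructor <;> simp only [hY, hp] <;> linarith
      have hY0 : avg (treeW β α (l + 2) x c) Y = 0 := by
        have := avg_mul_pr_topField hα (l := l) (n := l + 1) le_rfl hlx c true fun _ => 1
        simp only [one_mul] at this
        rw [avg_const (isProb_subW β α (l + 1) x true), mul_one] at this
        rw [hY, avg_sub, avg_const (isProb_treeW β α (l + 2) x c)]
        rw [this]; simp [hp]
      -- `pr · true` is 1-Lipschitz, so the field estimate applies, with the largest parameter it
      -- admits, `t = 1 / θ ^ j`; `hkj` bounds the moment by `exp 1`.
      have hYexp : avg (treeW β α (l + 2) x c) (fun ζ => Real.exp (|Y ζ| / θ ^ j)) ≤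
          Real.exp 1 := by
        have hYle : ∀ ζ, Real.exp (|Y ζ| / θ ^ j) ≤
            Real.exp ((1 / θ ^ j) * |topField β g l ζ.sub - α x|) := by
          intro ζ
          refine Real.exp_le_exp.2 ?_
          rw [div_eq_mul_inv, one_div, mul_comm]
          refine mul_le_mul_of_nonneg_left ?_ (by positivity)
          have := abs_pr_true_sub_le (topField β g l ζ.sub + c) (α x + c)
          rwa [add_sub_add_right_eq_sub] at this
        refine (avg_mono (isProb_treeW β α (l + 2) x c).1 hYle).trans ?_
        rw [avg_treeW_succ]
        refine (avg_mono (isProb_pr _).1 fun s => ?_).trans_eq (avg_const (isProb_pr _) _)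
        have := avg_exp_topField_sub_le hα hβ hρ hρb hθ k j (l + 1) x (by omega) (by omega) s
          (1 / θ ^ j) (by positivity) (by rw [one_div, inv_mul_cancel₀ (by positivity)])
        exact this.trans (Real.exp_le_exp.2 hkj)
      have h2 := avg_mul_sq_le_entropy (isProb_treeW β α (l + 2) x c) hF'0 hY1 hY0
        (show 0 < θ ^ j by positivity) (pow_le_one₀ hθ0.le hθ1)
        (Real.one_le_exp zero_le_one) hYexp
      rw [hmeanF, ← hcov] at h2
      have h3 : avg (treeW β α (n + 1) x c) (fun σ => f σ * X σ) ^ 2 ≤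
          36 * Real.exp 1 ^ 2 * θ ^ j * F * S :=
        h2.trans (mul_le_mul_of_nonneg_left hentF (by positivity))
      have h4 : avg (treeW β α (n + 1) x c) (fun σ => f σ * (rootIs true σ -
            condTop β α (l + 1) (n + 1) x c (rootIs true) σ)) ^ 2 ≤ RR * F * D := by
        refine h1.trans ?_
        refine mul_le_mul_of_nonneg_right (mul_le_mul_of_nonneg_right (hRi (l + 1) (by omega)) hF0)
          (hTn _)
      rw [hsplit]
      set A := avg (treeW β α (n + 1) x c) (fun σ => f σ * (rootIs true σ -
            condTop β α (l + 1) (n + 1) x c (rootIs true) σ))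
      set B := avg (treeW β α (n + 1) x c) (fun σ => f σ * X σ)
      -- Here `(A + B)² ≤ 2A² + 2B²`, the origin of the factors `2`.
      nlinarith [sq_nonneg (A - B)]

include hρ in
/-- The choice of the block size. -/
theorem exists_block_size (hb : 2 ≤ b) (hρ1 : ρ < 1) {θ : ℝ} (hθ0 : 0 < θ) (hθ1 : θ < 1)
    {A A' : ℝ} (hA : 0 ≤ A) :
    ∃ k j : ℕ, b ^ j * (A * √(ρ ^ k)) ≤ 1 ∧ A' * θ ^ j * ((k + j + 2 : ℕ) : ℝ) ≤ 1 / 2 := by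
  have hr0 : 0 ≤ √ρ := Real.sqrt_nonneg _
  have hr1 : √ρ < 1 := by rw [Real.sqrt_lt' one_pos]; simpa using hρ1
  have hb0 : (0 : ℝ) < b := by positivity
  -- Taking `k = N * j` with `b * √ρ ^ N ≤ 1 / 2` makes the mean deviation beat `b ^ j`, while `k +
  -- j + 2` stays linear in `j` and so loses against `θ ^ j`.
  obtain ⟨N, hN⟩ := exists_pow_lt_of_lt_one (show (0 : ℝ) < 1 / (2 * b) by positivity) hr1
  have hbN : b * √ρ ^ N ≤ 1 / 2 := by
    have : b * √ρ ^ N ≤ b * (1 / (2 * b)) := by gcongr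
    refine this.trans (le_of_eq ?_)
    field_simp
  have t1 : Filter.Tendsto (fun j : ℕ => A * (1 / 2 : ℝ) ^ j) Filter.atTop (nhds (A * 0)) :=
    (tendsto_pow_atTop_nhds_zero_of_lt_one (by norm_num) (by norm_num)).const_mul A
  have t2 : Filter.Tendsto (fun j : ℕ => A' * ((N + 1) * (j * θ ^ j) + 2 * θ ^ j)) Filter.atTop
      (nhds (A' * ((N + 1) * 0 + 2 * 0))) :=
    (((tendsto_self_mul_const_pow_of_lt_one hθ0.le hθ1).const_mul _).add
      ((tendsto_pow_atTop_nhds_zero_of_lt_one hθ0.le hθ1).const_mul 2)).const_mul A'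
  simp only [mul_zero, add_zero] at t1 t2
  obtain ⟨j, h1, h2⟩ := ((t1.eventually (gt_mem_nhds (show (0 : ℝ) < 1 by norm_num))).and
    (t2.eventually (gt_mem_nhds (show (0 : ℝ) < 1 / 2 by norm_num)))).exists
  refine ⟨N * j, j, ?_, ?_⟩
  · have e : √(ρ ^ (N * j)) = (√ρ ^ N) ^ j := by
      have : (√ρ ^ (N * j)) ^ 2 = ρ ^ (N * j) := by
        rw [← pow_mul, mul_comm _ 2, pow_mul, Real.sq_sqrt hρ.le]
      rw [← this, Real.sqrt_sq (by positivity), pow_mul]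
    calc (b : ℝ) ^ j * (A * √(ρ ^ (N * j))) = A * (b * √ρ ^ N) ^ j := by rw [e, mul_pow]; ring
      _ ≤ A * (1 / 2) ^ j := by gcongr
      _ ≤ 1 := h1.le
  · refine le_trans (le_of_eq ?_) h2.le
    push_cast
    ring

/-- The entropy is bounded by the energy, uniformly in the tree and its effective fields. -/
theorem exists_entropy_le_energy (hb : 2 ≤ b) (hβ : 0 ≤ β) (g : ℝ) (J : ℕ) (hρ : 0 < ρ)
    (hρ1 : ρ < 1) :
    ∃ C : ℝ, 0 < C ∧ ∀ (m : ℕ) (α : Vertex b → ℝ), FieldBounds b β g m J ρ α →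
      ∀ f : Conf b (m + 1) → ℝ, (∀ σ, 0 ≤ f σ) →
        entropy (treeW β α (m + 1) [] 0) f ≤
          C * totalSum β α (rootEnergy β α) (m + 1) [] 0 f := by
  have hρb : ρ ≤ b := by
    have : (2 : ℝ) ≤ b := by exact_mod_cast hb
    linarith
  -- The maximum with `1 / 2` keeps `θ` positive at `β = 0`.
  set θ := max (Real.tanh β) (1 / 2)
  have hθ0 : 0 < θ := lt_max_of_lt_right (by norm_num)
  have hθ1 : θ < 1 := max_lt (Real.tanh_lt_one β) (by norm_num)
  have hθ : Real.tanh β ≤ θ := le_max_left _ _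
  have hfl : 0 ≤ fluctConst b β g ρ J := by
    have := minProb_pos b β g
    rw [fluctConst]; positivity
  obtain ⟨k, j, h1, h2⟩ := exists_block_size hρ hb hρ1 hθ0 hθ1
    (A := Real.exp (2 * (|g| + b * β)) * fluctConst b β g ρ J)
    (A' := 2 / minProb b β g ^ 2 * (36 * Real.exp 1 ^ 2)) (by positivity)
  set C₀ := 2 / minProb b β g ^ 2 *
    ∑ i ∈ Finset.range (k + j + 2), resampleConst b (minProb b β g) i with hC₀
  refine ⟨2 * (max C₀ 1 * (k + j + 1 : ℕ)), by positivity, fun m α hα f hf => ?_⟩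
  have hq1 : minProb b β g ≤ 1 :=
    (hα.minProb_le hβ [] 0 true (by simp)).trans (pr_le_one _ _)
  have hmain := rootEntropy_le hα hβ hρ hρb hθ hθ0 hθ1.le (k := k) (j := j) (by
    refine le_trans (le_of_eq ?_) h1; ring)
  have hE := entropy_le_totalSum β α (m + 1) (m + 1) [] 0 f (by simp) (by simp) hf
  have hT := hmain.totalSum (α := α) (m + 1) [] 0 f (by simp) (by simp) hf
  rw [totalSum_add, totalSum_const_mul, totalSum_const_mul] at hT
  have a1 := totalSum_topSum_le β α (rootEnergy_zero β α) (rootEnergy_nonneg β α (m + 1))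
    (k + j + 1) (m + 1) [] 0 f (by simp) (by simp) hf
  have a2 := totalSum_topSum_le β α (Φ := rootEntropy β α) (fun _ _ _ => rfl)
    (rootEntropy_nonneg β α (m + 1)) (k + j + 2) (m + 1) [] 0 f (by simp) (by simp) hf
  have p1 := (rootEnergy_nonneg β α (m + 1)).totalSum (α := α) (m + 1) [] 0 f (by simp) (by simp) hf
  have p2 := (rootEntropy_nonneg β α (m + 1)).totalSum (α := α) (m + 1) [] 0 f (by simp)
    (by simp) hf
  rw [totalSum_zero] at p1 p2
  set D := totalSum β α (rootEnergy β α) (m + 1) [] 0 f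
  set H := totalSum β α (rootEntropy β α) (m + 1) [] 0 f
  have hC₀0 : 0 ≤ C₀ := mul_nonneg (by positivity) (Finset.sum_nonneg fun i _ =>
    resampleConst_nonneg (minProb_pos b β g) hq1 i)
  have b1 := mul_le_mul_of_nonneg_left a1 hC₀0
  have b2 := mul_le_mul_of_nonneg_left a2 (show 0 ≤ 2 / minProb b β g ^ 2 *
    (36 * Real.exp 1 ^ 2 * θ ^ j) by positivity)
  have b3 := mul_le_mul_of_nonneg_right h2 p2
  have b4 : C₀ * (((k + j + 1 : ℕ) : ℝ) * D) ≤ max C₀ 1 * (((k + j + 1 : ℕ) : ℝ) * D) := by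
    gcongr; exact le_max_left _ _
  -- At most `H / 2` is left on the right side and is absorbed, which doubles the constant in front
  -- of the energy.
  have b5 : 2 / minProb b β g ^ 2 * (36 * Real.exp 1 ^ 2 * θ ^ j) *
      (((k + j + 2 : ℕ) : ℝ) * H) ≤ 1 / 2 * H := by
    refine le_trans (le_of_eq ?_) b3; ring
  simp only [entropy] at hE ⊢
  linarith

end LogSobolev

end

section

variable {b : ℕ}

/-! ### Reading recursive configurations from configurations on the tree -/

/-- The configuration that `η` induces on the `n` levels below (and including) `x`. -/
def readConf (η : Vertex b → Bool) : (n : ℕ) → Vertex b → Conf b n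
  | 0, _ => .nil
  | n + 1, x => .node (η x) fun i => readConf η n (i :: x)

theorem readConf_congr {η η' : Vertex b → Bool} : ∀ {n : ℕ} {x : Vertex b},
    (∀ w : Vertex b, w.length < n → η (w ++ x) = η' (w ++ x)) → readConf η n x = readConf η' n x
  | 0, _, _ => rfl
  | n + 1, x, h => by
    simp only [readConf]
    congr 1
    · exact h [] (by simp)
    · funext i
      refine readConf_congr fun w hw => ?_
      simpa using h (w ++ [i]) (by simpa using hw)

theorem eq_of_readConf_eq {η η' : Vertex b → Bool} : ∀ {n : ℕ} {x : Vertex b},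
    readConf η n x = readConf η' n x → ∀ w : Vertex b, w.length < n → η (w ++ x) = η' (w ++ x)
  | 0, _, _, w, hw => absurd hw (by simp)
  | n + 1, x, h, w, hw => by
    simp only [readConf, Conf.node.injEq] at h
    rcases List.eq_nil_or_concat w with rfl | ⟨w, i, rfl⟩
    · exact h.1
    · have := eq_of_readConf_eq (congrFun h.2 i) w (by simpa using hw)
      simpa using this

theorem exists_readConf_eq : ∀ {n : ℕ} (x : Vertex b) (ζ : Conf b n), ∃ η, readConf η n x = ζ
  | 0, _, .nil => ⟨fun _ => true, rfl⟩
  | n + 1, x, .node s sub => by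
    choose η hη using fun i => exists_readConf_eq (i :: x) (sub i)
    classical
    refine ⟨fun y => if y = x then s else if h : ∃ i, (i :: x) <:+ y then η h.choose y else true, ?_⟩
    simp only [readConf, if_true]
    congr 1
    funext i
    rw [← hη i]
    refine readConf_congr fun w _ => ?_
    have h1 : w ++ i :: x ≠ x := fun h => by
      have := congrArg List.length h
      simp at this
      omega
    have h2 : ∃ i', (i' :: x) <:+ w ++ i :: x := ⟨i, List.suffix_append _ _⟩
    have h3 : h2.choose = i := by
      obtain ⟨w', hw'⟩ := h2.choose_spec
      have := (List.append_inj' hw' (by simp)).2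
      simpa using this
    rw [if_neg h1, dif_pos h2, h3]

theorem glue_of_mem {A : Finset (Vertex b)} {η : Vertex b → Bool} {ζ : A → Bool} {x : Vertex b}
    (hx : x ∈ A) : glue A η ζ x = ζ ⟨x, hx⟩ := by simp [glue, hx]

theorem glue_of_notMem {A : Finset (Vertex b)} {η : Vertex b → Bool} {ζ : A → Bool} {x : Vertex b}
    (hx : x ∉ A) : glue A η ζ x = η x := by simp [glue, hx]

/-- Configurations on the tree of depth `m` as recursive configurations. -/
def configEquiv (m : ℕ) (τ : Vertex b → Bool) : Config b m ≃ Conf b (m + 1) :=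
  Equiv.ofBijective (fun σ => readConf (glue (tree b m) τ σ) (m + 1) []) <| by
    constructor
    · intro σ σ' h
      funext ⟨x, hx⟩
      have := eq_of_readConf_eq h x (by have := (mem_tree m x).1 hx; omega)
      rwa [List.append_nil, glue_of_mem hx, glue_of_mem hx] at this
    · intro ζ
      obtain ⟨η, hη⟩ := exists_readConf_eq [] ζ
      refine ⟨fun x => η x, ?_⟩
      rw [← hη]
      refine readConf_congr fun w hw => ?_
      rw [List.append_nil, glue_of_mem ((mem_tree m w).2 (by omega))]

theorem configEquiv_apply (m : ℕ) (τ : Vertex b → Bool) (σ : Config b m) :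
    configEquiv m τ σ = readConf (glue (tree b m) τ σ) (m + 1) [] := rfl

/-! ### Sums over levels -/

theorem sum_children {M : Type*} [AddCommMonoid M] (x : Vertex b) (f : Vertex b → M) :
    ∑ y ∈ children x, f y = ∑ i, f (i :: x) := by
  rw [children, Finset.sum_image]
  intro i _ j _ h
  exact (List.cons.inj h).1

theorem sum_level_succ {M : Type*} [AddCommMonoid M] (k : ℕ) (f : Vertex b → M) :
    ∑ y ∈ level b (k + 1), f y = ∑ x ∈ level b k, ∑ i, f (i :: x) := by
  rw [level, Finset.sum_biUnion]
  · exact Finset.sum_congr rfl fun x _ => sum_children x f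
  · intro x _ y _ hxy
    refine Finset.disjoint_left.2 fun z hz hz' => hxy ?_
    simp only [children, Finset.mem_image] at hz hz'
    obtain ⟨i, -, rfl⟩ := hz
    obtain ⟨j, -, h⟩ := hz'
    exact (List.cons.inj h).2.symm

theorem sum_level_zero {M : Type*} [AddCommMonoid M] (f : Vertex b → M) :
    ∑ y ∈ level b 0, f y = f [] := by simp [level]

/-- Splitting off the first step from the root. -/
theorem sum_level_succ' {M : Type*} [AddCommMonoid M] (k : ℕ) : ∀ f : Vertex b → M,
    ∑ y ∈ level b (k + 1), f y = ∑ i, ∑ x ∈ level b k, f (x ++ [i]) := by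
  induction k with
  | zero => intro f; simp [sum_level_succ, sum_level_zero]
  | succ k ih =>
    intro f
    rw [sum_level_succ, ih]
    simp only [sum_level_succ k, List.cons_append]

theorem sum_tree {M : Type*} [AddCommMonoid M] (m : ℕ) (f : Vertex b → M) :
    ∑ x ∈ tree b m, f x = ∑ k ∈ Finset.range (m + 1), ∑ x ∈ level b k, f x := by
  rw [tree, Finset.sum_biUnion]
  intro k _ l _ hkl
  refine Finset.disjoint_left.2 fun z hz hz' => hkl ?_
  rw [mem_level] at hz hz'
  omega

/-! ### The Gibbs weight as a tree-indexed Markov weight -/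

/-- The field that the parent of `x` contributes. -/
def parentField (β : ℝ) (η : Vertex b → Bool) : Vertex b → ℝ
  | [] => 0
  | _ :: x => β * spin (η x)

/-- The exponent of the Gibbs weight of the `n` levels from `x` on. -/
def treeEnergy (β g : ℝ) (η : Vertex b → Bool) : (n : ℕ) → Vertex b → ℝ → ℝ
  | 0, x, c => c * spin (η x)
  | n + 1, x, c => c * spin (η x) + g * spin (η x) +
      ∑ i, treeEnergy β g η n (i :: x) (β * spin (η x))

theorem edgesMeeting_tree (m : ℕ) :
    edgesMeeting (tree b m) = ((Finset.range (m + 2)).biUnion (level b)).erase [] := by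
  ext x
  simp only [edgesMeeting, Finset.mem_erase, Finset.mem_union, Finset.mem_biUnion, mem_tree,
    children, Finset.mem_image, Finset.mem_range, mem_level, Finset.mem_univ, true_and]
  refine and_congr_right fun hx => ⟨?_, ?_⟩
  · rintro (h | ⟨y, hy, i, rfl⟩)
    · exact ⟨_, by omega, rfl⟩
    · exact ⟨_, by simp only [List.length_cons]; omega, rfl⟩
  · rintro ⟨k, hk, rfl⟩
    cases x with
    | nil => exact absurd rfl hx
    | cons i y =>
      right
      simp only [List.length_cons] at hk
      exact ⟨y, by omega, i, rfl⟩

theorem sum_level_treeEnergy (β g : ℝ) (η : Vertex b → Bool) (n k : ℕ) :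
    ∑ x ∈ level b k, treeEnergy β g η (n + 1) x (parentField β η x) =
      ∑ x ∈ level b k, (parentField β η x * spin (η x) + g * spin (η x)) +
        ∑ x ∈ level b (k + 1), treeEnergy β g η n x (parentField β η x) := by
  rw [sum_level_succ, ← Finset.sum_add_distrib]
  rfl

theorem treeEnergy_eq (β g : ℝ) (η : Vertex b → Bool) (m : ℕ) : ∀ k, k ≤ m →
    treeEnergy β g η (m + 1) [] 0 =
      ∑ j ∈ Finset.range k, ∑ x ∈ level b j,
        (parentField β η x * spin (η x) + g * spin (η x)) +
      ∑ x ∈ level b k, treeEnergy β g η (m + 1 - k) x (parentField β η x) := by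
  intro k
  induction k with
  | zero => intro _; simp [sum_level_zero, parentField]
  | succ k ih =>
    intro hk
    rw [ih (by omega), Finset.sum_range_succ, show m + 1 - k = (m - k) + 1 by omega,
      sum_level_treeEnergy, add_assoc, show m + 1 - (k + 1) = m - k by omega]

theorem weight_tree (β h : ℝ) (m : ℕ) (η : Vertex b → Bool) :
    weight β h (tree b m) η = Real.exp (treeEnergy β (β * h) η (m + 1) [] 0) := by
  rw [weight]
  congr 1
  have h1 := treeEnergy_eq β (β * h) η m m le_rfl
  rw [show m + 1 - m = 0 + 1 by omega, sum_level_treeEnergy, ← add_assoc,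
    ← Finset.sum_range_succ (fun j => ∑ x ∈ level b j,
      (parentField β η x * spin (η x) + β * h * spin (η x)))] at h1
  rw [h1, edgesMeeting_tree]
  simp only [Finset.sum_add_distrib, treeEnergy]
  have e1 : ∑ c ∈ ((Finset.range (m + 2)).biUnion (level b)).erase [],
      spin (η c) * spin (η c.tail) * β =
      ∑ c ∈ (Finset.range (m + 2)).biUnion (level b), parentField β η c * spin (η c) := by
    rw [← Finset.add_sum_erase _ (fun c => parentField β η c * spin (η c))
      (show [] ∈ (Finset.range (m + 2)).biUnion (level b) by simp [mem_level])]
    rw [parentField, zero_mul, zero_add]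
    refine Finset.sum_congr rfl fun c hc => ?_
    cases c with
    | nil => simp at hc
    | cons i y => simp only [parentField, List.tail_cons]; ring
  have e2 := sum_tree (b := b) (m + 1) (fun c => parentField β η c * spin (η c))
  rw [tree] at e2
  rw [Finset.sum_range_succ] at e2
  rw [mul_add, Finset.mul_sum]
  simp only [mul_comm β]
  rw [e1, e2, ← sum_tree (b := b) m (fun x => h * β * spin (η x)), Finset.mul_sum, Finset.sum_mul]
  have e3 : ∑ x ∈ tree b m, h * spin (η x) * β = ∑ x ∈ tree b m, h * β * spin (η x) :=
    Finset.sum_congr rfl fun x _ => by ring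
  rw [e3]
  ring

/-- The message sent to its parent by a vertex with `n` levels below (and including) it, when the
spins on the boundary are `τ`. -/
def boundaryMsg (β g : ℝ) (τ : Vertex b → Bool) : ℕ → Vertex b → ℝ
  | 0, x => β * spin (τ x)
  | n + 1, x => msgFun β (g + ∑ i, boundaryMsg β g τ n (i :: x))

/-- The effective fields in the tree of depth `m` with boundary condition `τ`. -/
def effField (β g : ℝ) (m : ℕ) (τ : Vertex b → Bool) (x : Vertex b) : ℝ :=
  if x.length ≤ m then g + ∑ i, boundaryMsg β g τ (m - x.length) (i :: x) else 0

theorem msgFun_effField (β g : ℝ) {m : ℕ} (τ : Vertex b → Bool) {x : Vertex b}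
    (hx : x.length ≤ m) :
    msgFun β (effField β g m τ x) = boundaryMsg β g τ (m + 1 - x.length) x := by
  rw [effField, if_pos hx, show m + 1 - x.length = (m - x.length) + 1 by omega]
  rfl

theorem effField_recursion (β g : ℝ) {m : ℕ} (τ : Vertex b → Bool) {x : Vertex b}
    (hx : x.length < m) :
    effField β g m τ x = g + ∑ i, msgFun β (effField β g m τ (i :: x)) := by
  rw [effField, if_pos hx.le]
  congr 1
  refine Finset.sum_congr rfl fun i _ => ?_
  rw [msgFun_effField β g τ (by simpa using hx)]
  congr 1
  simp only [List.length_cons]; omega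

theorem abs_boundaryMsg_le {β : ℝ} (hβ : 0 ≤ β) (g : ℝ) (τ : Vertex b → Bool) (n : ℕ)
    (x : Vertex b) : |boundaryMsg β g τ n x| ≤ β := by
  cases n with
  | zero => exact (abs_mul_spin β _).trans (abs_of_nonneg hβ).le
  | succ n => exact abs_msgFun_le hβ _

theorem abs_effField_le {β : ℝ} (hβ : 0 ≤ β) (g : ℝ) (m : ℕ) (τ : Vertex b → Bool)
    (x : Vertex b) : |effField β g m τ x| ≤ |g| + b * β := by
  rw [effField]
  split_ifs
  · refine (abs_add_le _ _).trans (add_le_add le_rfl ?_)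
    refine (Finset.abs_sum_le_sum_abs _ _).trans ?_
    refine (Finset.sum_le_sum fun i _ => abs_boundaryMsg_le hβ g τ _ (i :: x)).trans ?_
    simp
  · rw [abs_zero]; positivity

/-- The boundary messages of the children add up in the exponent to the effective field at `x`, and
the missing normalization of `pr` is the `cosh` factor. The parent field `c` is arbitrary so that
the root, where `c = 0`, is covered. -/
theorem exp_treeEnergy_succ {β g : ℝ} {m n : ℕ} {τ : Vertex b → Bool} {x : Vertex b}
    (hx : x.length + n = m)
    (h : ∀ i : Fin b, ∃ B : ℝ, 0 < B ∧ ∀ (s : Bool) (η : Vertex b → Bool),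
      (∀ y, y.length = m + 1 → η y = τ y) →
      Real.exp (treeEnergy β g η n (i :: x) (β * spin s)) =
        B * Real.exp (spin s * boundaryMsg β g τ n (i :: x)) *
          treeW β (effField β g m τ) n (i :: x) (β * spin s) (readConf η n (i :: x))) :
    ∃ B : ℝ, 0 < B ∧ ∀ (c : ℝ) (η : Vertex b → Bool), (∀ y, y.length = m + 1 → η y = τ y) →
      Real.exp (treeEnergy β g η (n + 1) x c) =
        B * (2 * Real.cosh (effField β g m τ x + c)) *
          treeW β (effField β g m τ) (n + 1) x c (readConf η (n + 1) x) := by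
  choose B hB h using h
  refine ⟨∏ i, B i, Finset.prod_pos fun i _ => hB i, fun c η hη => ?_⟩
  simp only [treeEnergy, readConf, treeW]
  rw [Real.exp_add, Real.exp_sum, Finset.prod_congr rfl fun i _ => h i _ η hη,
    Finset.prod_mul_distrib, Finset.prod_mul_distrib, ← Real.exp_sum, ← Finset.mul_sum, pr_add]
  have hc := Real.cosh_pos (effField β g m τ x + c)
  have e : effField β g m τ x = g + ∑ i, boundaryMsg β g τ n (i :: x) := by
    rw [effField, if_pos (by omega), show m - x.length = n by omega]
  have e2 : spin (η x) * (effField β g m τ x + c) =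
      (c * spin (η x) + g * spin (η x)) + spin (η x) * ∑ i, boundaryMsg β g τ n (i :: x) := by
    rw [e]; ring
  rw [e2, Real.exp_add (_ + _) (spin (η x) * _), mul_assoc (∏ i, B i), mul_assoc (∏ i, B i),
    ← mul_assoc (2 * Real.cosh _) (_ / _), mul_div_cancel₀ _ (by positivity)]
  ring

/-- By `cosh_add_mul_spin`, the `cosh` factor is, as a function of the parent's spin, the
exponential of the message that `x` sends. -/
theorem exp_treeEnergy {β g : ℝ} {m : ℕ} {τ : Vertex b → Bool} (n : ℕ) : ∀ (x : Vertex b),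
    x.length + n = m + 1 → ∃ B : ℝ, 0 < B ∧ ∀ (s : Bool) (η : Vertex b → Bool),
      (∀ y, y.length = m + 1 → η y = τ y) →
      Real.exp (treeEnergy β g η n x (β * spin s)) =
        B * Real.exp (spin s * boundaryMsg β g τ n x) *
          treeW β (effField β g m τ) n x (β * spin s) (readConf η n x) := by
  induction n with
  | zero =>
    intro x hx
    refine ⟨1, one_pos, fun s η hη => ?_⟩
    simp only [treeEnergy, boundaryMsg, readConf, treeW_zero, hη x (by omega)]
    rw [one_mul, mul_one]
    congr 1; ring
  | succ n ih =>
    intro x hx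
    obtain ⟨B, hB, h⟩ := exp_treeEnergy_succ (show x.length + n = m by omega) fun i =>
      ih (i :: x) (by simp only [List.length_cons]; omega)
    obtain ⟨B', hB', h'⟩ := cosh_add_mul_spin β (effField β g m τ x)
    refine ⟨B * (2 * B'), by positivity, fun s η hη => ?_⟩
    rw [h _ η hη, h' s, msgFun_effField β g τ (by omega), show m + 1 - x.length = n + 1 by omega]
    ring

theorem glue_tree_eq (m : ℕ) (τ : Vertex b → Bool) (σ : Config b m) (y : Vertex b)
    (hy : y.length = m + 1) : glue (tree b m) τ σ y = τ y :=
  glue_of_notMem fun h => by have := (mem_tree m y).1 h; omega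

/-- At the root the `cosh` factor does not depend on the configuration, so it cancels in the
normalization. -/
theorem mu_eq_treeW (β h : ℝ) (m : ℕ) (τ : Vertex b → Bool) (σ : Config b m) :
    mu β h m τ σ = treeW β (effField β (β * h) m τ) (m + 1) [] 0 (configEquiv m τ σ) := by
  obtain ⟨B, hB, hw⟩ := exp_treeEnergy_succ (β := β) (g := β * h) (τ := τ) (x := []) (n := m)
    (m := m) (by simp) fun i => exp_treeEnergy m [i] (by simp; omega)
  set w := treeW β (effField β (β * h) m τ) (m + 1) [] 0
  set Z := B * (2 * Real.cosh (effField β (β * h) m τ [] + 0))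
  have hZ : 0 < Z := by have := Real.cosh_pos (effField β (β * h) m τ [] + 0); positivity
  have e : ∀ ξ : Config b m, weight β h (tree b m) (glue (tree b m) τ ξ) =
      Z * w (configEquiv m τ ξ) := by
    intro ξ
    rw [weight_tree, hw 0 _ (glue_tree_eq m τ ξ), configEquiv_apply]
  rw [mu, gibbs, e]
  simp only [e]
  rw [← Finset.mul_sum, Equiv.sum_comp (configEquiv m τ) w, (isProb_treeW β _ _ _ _).2, mul_one,
    mul_div_cancel_left₀ _ hZ.ne']

theorem mu_pos (β h : ℝ) (m : ℕ) (τ : Vertex b → Bool) (σ : Config b m) : 0 < mu β h m τ σ := by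
  rw [mu_eq_treeW]; exact treeW_pos _ _ _ _ _ _

theorem avg_mu (β h : ℝ) (m : ℕ) (τ : Vertex b → Bool) (F : Conf b (m + 1) → ℝ) :
    avg (mu β h m τ) (fun σ => F (configEquiv m τ σ)) =
      avg (treeW β (effField β (β * h) m τ) (m + 1) [] 0) F := by
  simp only [avg, mu_eq_treeW]
  exact Equiv.sum_comp (configEquiv m τ)
    fun ζ => treeW β (effField β (β * h) m τ) (m + 1) [] 0 ζ * F ζ

theorem isProb_mu (β h : ℝ) (m : ℕ) (τ : Vertex b → Bool) : IsProb (mu β h m τ) := by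
  refine ⟨fun σ => (mu_pos β h m τ σ).le, ?_⟩
  have := avg_mu β h m τ fun _ => 1
  rw [avg_const (isProb_treeW _ _ _ _ _)] at this
  simpa [avg] using this

theorem ent_eq_entropy (β h : ℝ) (m : ℕ) (τ : Vertex b → Bool) (f : Config b m → ℝ) :
    ent β h m τ f = entropy (mu β h m τ) f := rfl

theorem entropy_mu (β h : ℝ) (m : ℕ) (τ : Vertex b → Bool) (f : Config b m → ℝ) :
    entropy (mu β h m τ) f = entropy (treeW β (effField β (β * h) m τ) (m + 1) [] 0)
      fun ζ => f ((configEquiv m τ).symm ζ) := by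
  simp only [entropy, ← avg_mu, Equiv.symm_apply_apply]

/-! ### The energy as a sum over vertices -/

/-- The sum over the vertices of the squared changes of `√F` when the spin there is flipped. -/
def gradSum : (n : ℕ) → (Conf b n → ℝ) → Conf b n → ℝ
  | 0, _, _ => 0
  | n + 1, F, .node s sub => (√(F (.node s sub)) - √(F (.node (!s) sub))) ^ 2 +
      ∑ i, gradSum n (fun t => F (.node s (Function.update sub i t))) (sub i)

/-- The replacement of the `i`-th subtree in `totalSum` is a resampling from its own law and leaves
averages unchanged. -/
theorem totalSum_rootEnergy (β : ℝ) (α : Vertex b → ℝ) : ∀ (n : ℕ) (x : Vertex b) (c : ℝ)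
    (F : Conf b n → ℝ),
    totalSum β α (rootEnergy β α) n x c F = avg (treeW β α n x c) (gradSum n F)
  | 0, x, c, F => by simp [totalSum, gradSum, avg]
  | n + 1, x, c, F => by
    simp only [totalSum, rootEnergy]
    rw [avg_treeW_succ, avg_treeW_succ, ← avg_add]
    refine congrArg _ (funext fun s => ?_)
    simp only [gradSum, Conf.flipRoot]
    rw [avg_add, avg_sum]
    congr 1
    refine Finset.sum_congr rfl fun i _ => ?_
    rw [subW, ← avg_piW_resample i (isProb_treeW β α n _ _).2
      (fun sub => gradSum n (fun t => F (.node s (Function.update sub i t))) (sub i))]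
    refine congrArg _ (funext fun sub => ?_)
    rw [totalSum_rootEnergy β α n]
    simp only [Function.update_idem, Function.update_self]

theorem readConf_update_append (η : Vertex b → Bool) (n : ℕ) (x w : Vertex b) (i : Fin b)
    (s : Bool) :
    readConf (Function.update η (w ++ i :: x) s) (n + 1) x =
      .node (η x) (Function.update (fun i => readConf η n (i :: x)) i
        (readConf (Function.update η (w ++ i :: x) s) n (i :: x))) := by
  simp only [readConf]
  congr 1
  · rw [Function.update_of_ne]
    intro h
    have := congrArg List.length h
    simp at this
    omega
  · funext j
    by_cases hj : j = i
    · subst hj; simp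
    · rw [Function.update_of_ne hj]
      refine readConf_congr fun w' _ => ?_
      rw [Function.update_of_ne]
      intro h
      have := (List.append_inj' h (by simp)).2
      exact hj (List.cons.inj this).1

theorem gradSum_readConf (η : Vertex b → Bool) : ∀ (n : ℕ) (x : Vertex b) (F : Conf b n → ℝ),
    gradSum n F (readConf η n x) = ∑ k ∈ Finset.range n, ∑ w ∈ level b k,
      (√(F (readConf η n x)) -
        √(F (readConf (Function.update η (w ++ x) (!η (w ++ x))) n x))) ^ 2
  | 0, x, F => by simp [gradSum]
  | n + 1, x, F => by
    rw [Finset.sum_range_succ', sum_level_zero, add_comm (Finset.sum _ _)]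
    simp only [sum_level_succ']
    have e : gradSum (n + 1) F (readConf η (n + 1) x) =
        (√(F (readConf η (n + 1) x)) -
          √(F (.node (!η x) fun i => readConf η n (i :: x)))) ^ 2 +
        ∑ i, gradSum n (fun t => F (.node (η x)
          (Function.update (fun i => readConf η n (i :: x)) i t))) (readConf η n (i :: x)) := rfl
    rw [e]
    congr 1
    · rw [List.nil_append]
      congr 4
      rw [readConf, Function.update_self]
      congr 1
      funext i
      refine readConf_congr fun w _ => ?_
      rw [Function.update_of_ne]
      intro h
      have := congrArg List.length h
      simp at this
      omega
    · rw [Finset.sum_comm]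
      refine Finset.sum_congr rfl fun i _ => ?_
      rw [gradSum_readConf η n]
      simp only [List.append_assoc, List.singleton_append, Function.update_eq_self,
        readConf_update_append]
      rfl

theorem glue_flipAt (m : ℕ) (τ : Vertex b → Bool) (σ : Config b m) (x : tree b m) :
    glue (tree b m) τ (flipAt σ x) =
      Function.update (glue (tree b m) τ σ) x.1 (!glue (tree b m) τ σ x.1) := by
  funext y
  by_cases hy : y = x.1
  · subst hy
    rw [Function.update_self, glue_of_mem x.2, glue_of_mem x.2]
    simp [flipAt]
  · rw [Function.update_of_ne hy]
    by_cases h : y ∈ tree b m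
    · rw [glue_of_mem h, glue_of_mem h, flipAt, Function.update_of_ne]
      intro h'
      exact hy (congrArg Subtype.val h')
    · rw [glue_of_notMem h, glue_of_notMem h]

theorem totalSum_rootEnergy_mu (β h : ℝ) (m : ℕ) (τ : Vertex b → Bool) (f : Config b m → ℝ) :
    totalSum β (effField β (β * h) m τ) (rootEnergy β (effField β (β * h) m τ)) (m + 1) [] 0
      (fun ζ => f ((configEquiv m τ).symm ζ)) =
    ∑ x : tree b m, avg (mu β h m τ) fun σ => (√(f (flipAt σ x)) - √(f σ)) ^ 2 := by
  rw [totalSum_rootEnergy, ← avg_mu, ← avg_sum]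
  refine congrArg _ (funext fun σ => ?_)
  rw [configEquiv_apply, gradSum_readConf]
  simp only [List.append_nil]
  rw [← sum_tree m fun x => (√(f ((configEquiv m τ).symm
    (readConf (glue (tree b m) τ σ) (m + 1) []))) - √(f ((configEquiv m τ).symm (readConf
      (Function.update (glue (tree b m) τ σ) x (!glue (tree b m) τ σ x)) (m + 1) [])))) ^ 2]
  rw [← Finset.sum_coe_sort]
  refine Finset.sum_congr rfl fun x _ => ?_
  rw [← glue_flipAt, ← configEquiv_apply, ← configEquiv_apply, Equiv.symm_apply_apply,
    Equiv.symm_apply_apply]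
  ring

end

section

variable {b : ℕ}

/-! ### Finite-volume Gibbs weights -/

theorem mem_edgesMeeting {A : Finset (Vertex b)} {c : Vertex b} :
    c ∈ edgesMeeting A ↔ c ≠ [] ∧ (c ∈ A ∨ c.tail ∈ A) := by
  simp only [edgesMeeting, Finset.mem_erase, Finset.mem_union, Finset.mem_biUnion, children,
    Finset.mem_image, Finset.mem_univ, true_and]
  refine and_congr_right fun hc => or_congr_right ⟨?_, fun h => ?_⟩
  · rintro ⟨x, hx, i, rfl⟩
    exact hx
  · cases c with
    | nil => exact absurd rfl hc
    | cons i y => exact ⟨y, h, i, rfl⟩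

theorem edgesMeeting_mono {A B : Finset (Vertex b)} (h : A ⊆ B) :
    edgesMeeting A ⊆ edgesMeeting B := fun c hc => by
  rw [mem_edgesMeeting] at hc ⊢
  exact ⟨hc.1, hc.2.imp (fun h' => h h') (fun h' => h h')⟩

theorem card_edgesMeeting_le (A : Finset (Vertex b)) : (edgesMeeting A).card ≤ A.card * (b + 1) := by
  refine (Finset.card_erase_le).trans ((Finset.card_union_le _ _).trans ?_)
  have h : (A.biUnion children).card ≤ A.card * b :=
    Finset.card_biUnion_le_card_mul _ _ _ fun x _ =>
      Finset.card_image_le.trans (by simp)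
  rw [mul_add, mul_one, add_comm]
  exact Nat.add_le_add_right h _

theorem abs_spin (s : Bool) : |spin s| = 1 := by cases s <;> simp [spin]

theorem weight_pos (β h : ℝ) (A : Finset (Vertex b)) (η : Vertex b → Bool) :
    0 < weight β h A η := Real.exp_pos _

/-- The ratio of the weights in two nested volumes does not depend on the spins in the smaller. -/
theorem weight_mul_weight (β h : ℝ) {A B : Finset (Vertex b)} (hAB : A ⊆ B)
    {η η' : Vertex b → Bool} (hη : ∀ x ∉ A, η x = η' x) :
    weight β h B η * weight β h A η' = weight β h B η' * weight β h A η := by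
  have key : ∀ η : Vertex b → Bool, weight β h B η = weight β h A η *
      Real.exp (β * (∑ c ∈ edgesMeeting B \ edgesMeeting A, spin (η c) * spin (η c.tail) +
        h * ∑ x ∈ B \ A, spin (η x))) := by
    intro η
    rw [weight, weight, ← Real.exp_add, ← Finset.sum_sdiff (edgesMeeting_mono hAB),
      ← Finset.sum_sdiff hAB]
    congr 1; ring
  have e : ∑ c ∈ edgesMeeting B \ edgesMeeting A, spin (η c) * spin (η c.tail) =
      ∑ c ∈ edgesMeeting B \ edgesMeeting A, spin (η' c) * spin (η' c.tail) := by
    refine Finset.sum_congr rfl fun c hc => ?_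
    rw [Finset.mem_sdiff, mem_edgesMeeting, mem_edgesMeeting] at hc
    rw [hη c fun h => hc.2 ⟨hc.1.1, Or.inl h⟩, hη c.tail fun h => hc.2 ⟨hc.1.1, Or.inr h⟩]
  have e' : ∑ x ∈ B \ A, spin (η x) = ∑ x ∈ B \ A, spin (η' x) :=
    Finset.sum_congr rfl fun x hx => by rw [hη x (Finset.mem_sdiff.1 hx).2]
  rw [key η, key η', e, e']
  ring

theorem gibbs_nonneg (β h : ℝ) (A : Finset (Vertex b)) (η : Vertex b → Bool) (ζ : A → Bool) :
    0 ≤ gibbs β h A η ζ :=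
  div_nonneg (weight_pos _ _ _ _).le (Finset.sum_nonneg fun _ _ => (weight_pos _ _ _ _).le)

theorem abs_log_weight_le {β : ℝ} (hβ : 0 ≤ β) (h : ℝ) (A : Finset (Vertex b))
    (η : Vertex b → Bool) :
    |β * (∑ c ∈ edgesMeeting A, spin (η c) * spin (η c.tail) + h * ∑ x ∈ A, spin (η x))| ≤
      A.card * (β * (b + 1 + |h|)) := by
  rw [abs_mul, abs_of_nonneg hβ]
  have h1 : |∑ c ∈ edgesMeeting A, spin (η c) * spin (η c.tail)| ≤ A.card * (b + 1) := by
    refine (Finset.abs_sum_le_sum_abs _ _).trans ?_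
    simp only [abs_mul, abs_spin, mul_one, Finset.sum_const, nsmul_eq_mul]
    exact_mod_cast card_edgesMeeting_le A
  have h2 : |∑ x ∈ A, spin (η x)| ≤ A.card := by
    refine (Finset.abs_sum_le_sum_abs _ _).trans ?_
    simp only [abs_spin, Finset.sum_const, nsmul_eq_mul, mul_one, le_refl]
  have h3 : |∑ c ∈ edgesMeeting A, spin (η c) * spin (η c.tail) + h * ∑ x ∈ A, spin (η x)| ≤
      A.card * (b + 1) + |h| * A.card := by
    refine (abs_add_le _ _).trans (add_le_add h1 ?_)
    rw [abs_mul]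
    exact mul_le_mul_of_nonneg_left h2 (abs_nonneg h)
  calc _ ≤ β * (A.card * (b + 1) + |h| * A.card) := mul_le_mul_of_nonneg_left h3 hβ
    _ = _ := by ring

/-- A lower bound for the finite-volume Gibbs probabilities, per vertex. -/
def gibbsFloor (b : ℕ) (β h : ℝ) : ℝ := Real.exp (-(2 * (β * (b + 1 + |h|)))) / 2

theorem gibbsFloor_pos (b : ℕ) (β h : ℝ) : 0 < gibbsFloor b β h := by
  rw [gibbsFloor]; positivity

theorem gibbsFloor_le_half (b : ℕ) {β : ℝ} (hβ : 0 ≤ β) (h : ℝ) : gibbsFloor b β h ≤ 1 / 2 := by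
  rw [gibbsFloor]
  have : Real.exp (-(2 * (β * (b + 1 + |h|)))) ≤ 1 := by
    rw [Real.exp_le_one_iff]
    have : 0 ≤ β * (b + 1 + |h|) := by positivity
    linarith
  linarith

/-- The exponent is at most a constant per vertex, and there are two spins per vertex. Applied to a
single vertex it bounds the rates below; applied to the whole tree it gives the floor `r ^ n` needed
for mixing. -/
theorem gibbsFloor_pow_le {β : ℝ} (hβ : 0 ≤ β) (h : ℝ) (A : Finset (Vertex b))
    (η : Vertex b → Bool) (ζ : A → Bool) : gibbsFloor b β h ^ A.card ≤ gibbs β h A η ζ := by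
  set B := β * (b + 1 + |h|)
  have h1 : ∀ ξ : A → Bool, weight β h A (glue A η ξ) ≤ Real.exp (A.card * B) := fun ξ =>
    Real.exp_le_exp.2 ((abs_le.1 (abs_log_weight_le hβ h A _)).2)
  have h2 : Real.exp (-(A.card * B)) ≤ weight β h A (glue A η ζ) :=
    Real.exp_le_exp.2 ((abs_le.1 (abs_log_weight_le hβ h A _)).1)
  have h3 : ∑ ξ : A → Bool, weight β h A (glue A η ξ) ≤ 2 ^ A.card * Real.exp (A.card * B) := by
    refine (Finset.sum_le_sum fun ξ _ => h1 ξ).trans ?_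
    simp
  have h4 : 0 < ∑ ξ : A → Bool, weight β h A (glue A η ξ) :=
    Finset.sum_pos (fun _ _ => weight_pos _ _ _ _) Finset.univ_nonempty
  calc gibbsFloor b β h ^ A.card
      = Real.exp (-(A.card * B)) / (2 ^ A.card * Real.exp (A.card * B)) := by
        rw [gibbsFloor, div_pow, ← Real.exp_nat_mul, eq_div_iff (by positivity),
          div_mul_eq_mul_div, mul_left_comm, mul_div_cancel_left₀ _ (by positivity),
          ← Real.exp_add]
        congr 1; ring
    _ ≤ _ := div_le_div₀ (weight_pos _ _ _ _).le h2 h4 h3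

/-! ### The rates of the dynamics -/

theorem flipAt_flipAt {m : ℕ} (σ : Config b m) (x : tree b m) : flipAt (flipAt σ x) x = σ := by
  simp [flipAt]

theorem glue_singleton_flipAt {m : ℕ} (τ : Vertex b → Bool) (x : tree b m) (σ : Config b m) :
    glue {x.1} (glue (tree b m) τ σ) (fun _ => !σ x) = glue (tree b m) τ (flipAt σ x) := by
  funext y
  rw [glue_flipAt]
  by_cases hy : y = x.1
  · subst hy
    rw [glue_of_mem (Finset.mem_singleton_self _), Function.update_self, glue_of_mem x.2]
  · rw [glue_of_notMem (by simpa using hy), Function.update_of_ne hy]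

theorem rate_eq (β h : ℝ) (m : ℕ) (τ : Vertex b → Bool) (x : tree b m) (σ : Config b m) :
    rate β h m τ x σ = weight β h {x.1} (glue (tree b m) τ (flipAt σ x)) /
      ∑ ξ : ({x.1} : Finset (Vertex b)) → Bool,
        weight β h {x.1} (glue {x.1} (glue (tree b m) τ σ) ξ) := by
  rw [rate, gibbs, glue_singleton_flipAt]

theorem gibbsFloor_le_rate {β : ℝ} (hβ : 0 ≤ β) (h : ℝ) (m : ℕ) (τ : Vertex b → Bool)
    (x : tree b m) (σ : Config b m) : gibbsFloor b β h ≤ rate β h m τ x σ := by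
  simpa [rate] using gibbsFloor_pow_le hβ h {x.1} (glue (tree b m) τ σ) (fun _ => !σ x)

theorem rate_nonneg (β h : ℝ) (m : ℕ) (τ : Vertex b → Bool)
    (x : tree b m) (σ : Config b m) : 0 ≤ rate β h m τ x σ := gibbs_nonneg _ _ _ _ _

/-- Detailed balance: the normalization of the rate does not see the spin at `x`, and weights in
nested volumes have ratios independent of it. -/
theorem mu_mul_rate (β h : ℝ) (m : ℕ) (τ : Vertex b → Bool) (x : tree b m) (σ : Config b m) :
    mu β h m τ σ * rate β h m τ x σ =
      mu β h m τ (flipAt σ x) * rate β h m τ x (flipAt σ x) := by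
  have hN : ∀ ξ : ({x.1} : Finset (Vertex b)) → Bool,
      glue {x.1} (glue (tree b m) τ (flipAt σ x)) ξ = glue {x.1} (glue (tree b m) τ σ) ξ := by
    intro ξ
    funext y
    by_cases hy : y = x.1
    · subst hy
      rw [glue_of_mem (Finset.mem_singleton_self _), glue_of_mem (Finset.mem_singleton_self _)]
    · have hy' : y ∉ ({x.1} : Finset (Vertex b)) := by simpa using hy
      rw [glue_of_notMem hy', glue_of_notMem hy', glue_flipAt, Function.update_of_ne hy]
  have hw := weight_mul_weight β h (A := {x.1}) (B := tree b m) (by simp)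
    (η := glue (tree b m) τ σ) (η' := glue (tree b m) τ (flipAt σ x)) fun y hy => by
      rw [glue_flipAt, Function.update_of_ne (by simpa using hy)]
  rw [rate_eq, rate_eq, flipAt_flipAt]
  simp only [hN]
  rw [mu, mu, gibbs, gibbs, div_mul_div_comm, div_mul_div_comm, hw]

theorem gibbsFloor_pow_le_mu {β : ℝ} (hβ : 0 ≤ β) (h : ℝ) (m : ℕ) (τ : Vertex b → Bool)
    (σ : Config b m) : gibbsFloor b β h ^ (tree b m).card ≤ mu β h m τ σ :=
  gibbsFloor_pow_le hβ h _ _ _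

/-! ### The logarithmic Sobolev inequality -/

theorem gibbsFloor_mul_le_dirichlet {β : ℝ} (hβ : 0 ≤ β) (h : ℝ) (m : ℕ) (τ : Vertex b → Bool)
    (g : Config b m → ℝ) :
    gibbsFloor b β h / 2 * ∑ x : tree b m, avg (mu β h m τ) (fun σ => (g (flipAt σ x) - g σ) ^ 2) ≤
      dirichlet β h m τ g := by
  rw [dirichlet, div_mul_eq_mul_div, Finset.mul_sum, ← mul_one_div, mul_comm _ (1 / 2 : ℝ)]
  refine mul_le_mul_of_nonneg_left (Finset.sum_le_sum fun x _ => ?_) (by norm_num)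
  rw [avg, Finset.mul_sum]
  refine Finset.sum_le_sum fun σ _ => ?_
  rw [mul_left_comm]
  exact mul_le_mul_of_nonneg_left (mul_le_mul_of_nonneg_right (gibbsFloor_le_rate hβ h m τ x σ)
    (sq_nonneg _)) (mu_pos _ _ _ _ _).le

theorem exists_ent_le_dirichlet (hb : 2 ≤ b) {β : ℝ} (hβ : 0 ≤ β) (h : ℝ) (J : ℕ) {ρ : ℝ}
    (hρ : 0 < ρ) (hρ1 : ρ < 1) :
    ∃ C, 0 < C ∧ ∀ (m : ℕ) (τ : Vertex b → Bool),
      FieldBounds b β (β * h) m J ρ (effField β (β * h) m τ) →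
      ∀ f : Config b m → ℝ, (∀ σ, 0 ≤ f σ) →
        ent β h m τ f ≤ C * dirichlet β h m τ (fun σ => √(f σ)) := by
  obtain ⟨C, hC, H⟩ := exists_entropy_le_energy hb hβ (β * h) J hρ hρ1
  have hr := gibbsFloor_pos b β h
  refine ⟨C * (2 / gibbsFloor b β h), by positivity, fun m τ hF f hf => ?_⟩
  have h1 := H m _ hF (fun ζ => f ((configEquiv m τ).symm ζ)) fun ζ => hf _
  rw [totalSum_rootEnergy_mu, ← entropy_mu, ← ent_eq_entropy] at h1
  have h2 := gibbsFloor_mul_le_dirichlet hβ h m τ fun σ => √(f σ)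
  refine h1.trans ?_
  rw [mul_assoc]
  refine mul_le_mul_of_nonneg_left ?_ hC.le
  rw [div_mul_eq_mul_div, le_div_iff₀ hr]
  linarith

/-- It excludes division by zero in the quotients that define `logSobolev`. -/
theorem ent_pos (β h : ℝ) (m : ℕ) (τ : Vertex b → Bool) {f : Config b m → ℝ}
    (hf : ∀ σ, 0 ≤ f σ) (hne : ∃ σ σ', f σ ≠ f σ') : 0 < ent β h m τ f := by
  have hp := isProb_mu β h m τ
  have hv : avg (mu β h m τ) (fun σ => (√(f σ) - avg (mu β h m τ) fun σ => √(f σ)) ^ 2) =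
      avg (mu β h m τ) f - (avg (mu β h m τ) fun σ => √(f σ)) ^ 2 := by
    set a := avg (mu β h m τ) fun σ => √(f σ)
    have : (fun σ => (√(f σ) - a) ^ 2) = fun σ => (f σ - 2 * a * √(f σ)) + a ^ 2 := by
      funext σ
      rw [sub_sq, Real.sq_sqrt (hf σ)]; ring
    rw [this, avg_add, avg_sub, avg_const hp, avg_const_mul]
    ring
  refine lt_of_lt_of_le ?_ (avg_sub_sq_avg_sqrt_le_entropy hp hf)
  rw [← hv]
  refine lt_of_le_of_ne (avg_nonneg hp.1 fun σ => sq_nonneg _) fun h0 => ?_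
  have h1 := (Finset.sum_eq_zero_iff_of_nonneg fun σ _ =>
    mul_nonneg (hp.1 σ) (sq_nonneg _)).1 h0.symm
  have h2 : ∀ σ, √(f σ) = avg (mu β h m τ) fun σ => √(f σ) := fun σ => by
    have := (mul_eq_zero.1 (h1 σ (Finset.mem_univ _))).resolve_left (mu_pos _ _ _ _ _).ne'
    exact sub_eq_zero.1 (pow_eq_zero_iff two_ne_zero |>.1 this)
  obtain ⟨σ, σ', hne⟩ := hne
  exact hne ((Real.sqrt_inj (hf σ) (hf σ')).1 ((h2 σ).trans (h2 σ').symm))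

theorem le_logSobolev (β h : ℝ) (m : ℕ) (τ : Vertex b → Bool) {C : ℝ} (hC : 0 < C)
    (H : ∀ f : Config b m → ℝ, (∀ σ, 0 ≤ f σ) →
      ent β h m τ f ≤ C * dirichlet β h m τ fun σ => √(f σ)) :
    1 / C ≤ logSobolev β h m τ := by
  refine le_csInf ?_ ?_
  -- The set must be nonempty, since `sInf ∅ = 0` for reals; the indicator of a plus at the root is
  -- not constant.
  · have hx : ([] : Vertex b) ∈ tree b m := (mem_tree m _).2 (by simp)
    exact ⟨_, fun σ => if σ ⟨[], hx⟩ then 1 else 0, fun σ => by positivity,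
      ⟨fun _ => true, fun _ => false, by simp⟩, rfl⟩
  · rintro r ⟨f, hf, hne, rfl⟩
    have := ent_pos β h m τ hf hne
    rw [le_div_iff₀ this, div_mul_eq_mul_div, div_le_iff₀ hC, one_mul, mul_comm]
    exact H f hf

end

section

/-! ### Semigroups of reversible Markov chains on finite sets -/

variable {Ω : Type*} [Fintype Ω]

/-- `L` generates a Markov chain that is reversible with respect to the probability weight `w`. -/
structure IsReversible (L : Matrix Ω Ω ℝ) (w : Ω → ℝ) : Prop where
  pos : ∀ σ, 0 < w σ
  sum_eq_one : ∑ σ, w σ = 1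
  nonneg : ∀ σ η, σ ≠ η → 0 ≤ L σ η
  row_sum : ∀ σ, ∑ η, L σ η = 0
  symm : ∀ σ η, w σ * L σ η = w η * L η σ

/-- The Dirichlet form of a reversible Markov chain. -/
def energyForm (L : Matrix Ω Ω ℝ) (w f g : Ω → ℝ) : ℝ :=
  1 / 2 * ∑ σ, ∑ η, w σ * L σ η * ((f σ - f η) * (g σ - g η))

namespace IsReversible

variable {L : Matrix Ω Ω ℝ} {w : Ω → ℝ} (h : IsReversible L w)
include h

theorem isProb : IsProb w := ⟨fun σ => (h.pos σ).le, h.sum_eq_one⟩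

/-- Zero row sums allow `g η` to be replaced by `g η - g σ`; symmetrizing by detailed balance gives
the form. -/
theorem avg_mul_gen (f g : Ω → ℝ) :
    avg w (fun σ => f σ * ∑ η, L σ η * g η) = -energyForm L w f g := by
  have e1 : ∀ σ, ∑ η, L σ η * g η = ∑ η, L σ η * (g η - g σ) := by
    intro σ
    simp only [mul_sub, Finset.sum_sub_distrib]
    rw [← Finset.sum_mul, h.row_sum, zero_mul, sub_zero]
  have e2 : avg w (fun σ => f σ * ∑ η, L σ η * g η) =
      ∑ σ, ∑ η, w σ * L σ η * (f σ * (g η - g σ)) := by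
    rw [avg]
    refine Finset.sum_congr rfl fun σ _ => ?_
    rw [e1, Finset.mul_sum, Finset.mul_sum]
    exact Finset.sum_congr rfl fun η _ => by ring
  have e3 : ∑ σ, ∑ η, w σ * L σ η * (f σ * (g η - g σ)) =
      ∑ σ, ∑ η, w σ * L σ η * (f η * (g σ - g η)) := by
    rw [Finset.sum_comm]
    exact Finset.sum_congr rfl fun η _ => Finset.sum_congr rfl fun σ _ => by rw [h.symm σ η]
  have e4 : 2 * avg w (fun σ => f σ * ∑ η, L σ η * g η) =
      -∑ σ, ∑ η, w σ * L σ η * ((f σ - f η) * (g σ - g η)) := by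
    rw [two_mul]
    nth_rewrite 2 [e2]
    rw [e3, e2, ← Finset.sum_add_distrib, ← Finset.sum_neg_distrib]
    refine Finset.sum_congr rfl fun σ _ => ?_
    rw [← Finset.sum_add_distrib, ← Finset.sum_neg_distrib]
    exact Finset.sum_congr rfl fun η _ => by ring
  rw [energyForm]
  linarith

end IsReversible

variable [DecidableEq Ω]

/-- The semigroup `e^{tL}`. -/
def heat (L : Matrix Ω Ω ℝ) (t : ℝ) : Matrix Ω Ω ℝ := NormedSpace.exp (t • L)

theorem heat_zero (L : Matrix Ω Ω ℝ) : heat L 0 = 1 := by simp [heat]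

theorem heat_add (L : Matrix Ω Ω ℝ) (s t : ℝ) : heat L (s + t) = heat L s * heat L t := by
  rw [heat, add_smul, Matrix.exp_add_of_commute _ _ ((Commute.refl L).smul_left s |>.smul_right t)]
  rfl

section

attribute [local instance] Matrix.linftyOpNormedRing Matrix.linftyOpNormedAlgebra

theorem hasDerivAt_heat_apply (L : Matrix Ω Ω ℝ) (t : ℝ) (σ η : Ω) :
    HasDerivAt (fun t => heat L t σ η) ((L * heat L t) σ η) t := by
  have h := hasDerivAt_exp_smul_const' (𝕂 := ℝ) L t
  exact ((Matrix.entryLinearMap ℝ ℝ σ η).toContinuousLinearMap.hasFDerivAt.comp_hasDerivAt t h)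

theorem hasDerivAt_heat_apply' (L : Matrix Ω Ω ℝ) (t : ℝ) (σ η : Ω) :
    HasDerivAt (fun t => heat L t σ η) ((heat L t * L) σ η) t := by
  have h := hasDerivAt_exp_smul_const (𝕂 := ℝ) L t
  exact ((Matrix.entryLinearMap ℝ ℝ σ η).toContinuousLinearMap.hasFDerivAt.comp_hasDerivAt t h)

theorem exp_apply_nonneg {A : Matrix Ω Ω ℝ} (hA : ∀ σ η, 0 ≤ A σ η) (σ η : Ω) :
    0 ≤ NormedSpace.exp A σ η := by
  have hpow : ∀ (n : ℕ) σ η, 0 ≤ (A ^ n) σ η := by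
    intro n
    induction n with
    | zero =>
      intro σ η
      rw [pow_zero, Matrix.one_apply]
      split_ifs <;> norm_num
    | succ n ih =>
      intro σ η
      rw [pow_succ, Matrix.mul_apply]
      exact Finset.sum_nonneg fun ξ _ => mul_nonneg (ih _ _) (hA _ _)
  have h := (NormedSpace.exp_series_hasSum_exp' (𝕂 := ℝ) A).mapL
    (Matrix.entryLinearMap ℝ ℝ σ η).toContinuousLinearMap
  refine h.nonneg fun n => ?_
  exact mul_nonneg (by positivity) (hpow n σ η)

end

/-- Adding a multiple of the identity makes all entries of the generator nonnegative and changes the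
exponential only by a positive scalar factor. -/
theorem heat_apply_nonneg {L : Matrix Ω Ω ℝ} (hL : ∀ σ η, σ ≠ η → 0 ≤ L σ η) {t : ℝ} (ht : 0 ≤ t)
    (σ η : Ω) : 0 ≤ heat L t σ η := by
  obtain ⟨c, hc⟩ : ∃ c : ℝ, ∀ σ, -c ≤ L σ σ := by
    obtain ⟨c, hc⟩ := (Set.finite_range fun σ => -L σ σ).bddAbove
    exact ⟨c, fun σ => by linarith [hc ⟨σ, rfl⟩]⟩
  have e : t • L = (-(t * c)) • (1 : Matrix Ω Ω ℝ) + t • (L + c • 1) := by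
    rw [smul_add, smul_smul, neg_smul]; abel
  have hcomm : Commute ((-(t * c)) • (1 : Matrix Ω Ω ℝ)) (t • (L + c • 1)) :=
    (Commute.one_left _).smul_left _
  rw [heat, e, Matrix.exp_add_of_commute _ _ hcomm, Matrix.smul_one_eq_diagonal,
    Matrix.exp_diagonal, Matrix.diagonal_mul]
  refine mul_nonneg ?_ (exp_apply_nonneg (fun σ η => ?_) σ η)
  · rw [Pi.coe_exp]
    rw [← Real.exp_eq_exp_ℝ]
    exact (Real.exp_pos _).le
  · rw [Matrix.smul_apply, smul_eq_mul]
    refine mul_nonneg ht ?_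
    rw [Matrix.add_apply, Matrix.smul_apply, Matrix.one_apply, smul_eq_mul]
    split_ifs with h
    · subst h; linarith [hc σ]
    · rw [mul_zero, add_zero]; exact hL _ _ h

/-- The function `P_t f`. -/
def flow (L : Matrix Ω Ω ℝ) (t : ℝ) (f : Ω → ℝ) (σ : Ω) : ℝ := ∑ η, heat L t σ η * f η

theorem flow_zero (L : Matrix Ω Ω ℝ) (f : Ω → ℝ) : flow L 0 f = f := by
  funext σ
  simp [flow, heat_zero, Matrix.one_apply]

theorem flow_flow (L : Matrix Ω Ω ℝ) (s t : ℝ) (f : Ω → ℝ) :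
    flow L s (flow L t f) = flow L (s + t) f := by
  funext σ
  simp only [flow, heat_add, Matrix.mul_apply, Finset.mul_sum, Finset.sum_mul]
  rw [Finset.sum_comm]
  exact Finset.sum_congr rfl fun η _ => Finset.sum_congr rfl fun ξ _ => by ring

theorem flow_add (L : Matrix Ω Ω ℝ) (t : ℝ) (f g : Ω → ℝ) (σ : Ω) :
    flow L t (fun σ => f σ + g σ) σ = flow L t f σ + flow L t g σ := by
  simp only [flow, mul_add, Finset.sum_add_distrib]

theorem hasDerivAt_flow (L : Matrix Ω Ω ℝ) (f : Ω → ℝ) (t : ℝ) (σ : Ω) :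
    HasDerivAt (fun t => flow L t f σ) (∑ η, L σ η * flow L t f η) t := by
  have h : HasDerivAt (fun t => flow L t f σ) (∑ η, (L * heat L t) σ η * f η) t := by
    simp only [flow]
    exact HasDerivAt.fun_sum fun η _ => (hasDerivAt_heat_apply L t σ η).mul_const _
  convert h using 1
  simp only [flow, Matrix.mul_apply, Finset.mul_sum, Finset.sum_mul]
  rw [Finset.sum_comm]
  exact Finset.sum_congr rfl fun η _ => Finset.sum_congr rfl fun ξ _ => by ring

namespace IsReversible

variable {L : Matrix Ω Ω ℝ} {w : Ω → ℝ} (h : IsReversible L w)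
include h

theorem flow_const (c t : ℝ) (σ : Ω) : flow L t (fun _ => c) σ = c := by
  have hd : ∀ t, HasDerivAt (fun t => flow L t (fun _ => c) σ) 0 t := by
    intro t
    have h1 : HasDerivAt (fun t => flow L t (fun _ => c) σ) (∑ η, (heat L t * L) σ η * c) t := by
      simp only [flow]
      exact HasDerivAt.fun_sum fun η _ => (hasDerivAt_heat_apply' L t σ η).mul_const _
    convert h1 using 1
    rw [← Finset.sum_mul]
    simp only [Matrix.mul_apply]
    rw [Finset.sum_comm]
    simp only [← Finset.mul_sum, h.row_sum, mul_zero, Finset.sum_const_zero, zero_mul]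
  have := is_const_of_deriv_eq_zero (fun t => (hd t).differentiableAt) (fun t => (hd t).deriv) t 0
  rw [this, flow_zero]

theorem flow_le_flow {f g : Ω → ℝ} (hfg : ∀ σ, f σ ≤ g σ) {t : ℝ} (ht : 0 ≤ t) (σ : Ω) :
    flow L t f σ ≤ flow L t g σ :=
  Finset.sum_le_sum fun η _ =>
    mul_le_mul_of_nonneg_left (hfg η) (heat_apply_nonneg h.nonneg ht σ η)

/-- Detailed balance says that conjugation by the diagonal matrix of `w` transposes `L`; the
exponential respects conjugation and transposition. -/
theorem heat_symm (t : ℝ) (σ η : Ω) : w σ * heat L t σ η = w η * heat L t η σ := by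
  set D : Matrix Ω Ω ℝ := Matrix.diagonal w
  have hu : IsUnit D := by
    rw [Matrix.isUnit_diagonal, Pi.isUnit_iff]
    exact fun σ => (h.pos σ).ne'.isUnit
  have hu' : IsUnit D.det := (Matrix.isUnit_iff_isUnit_det _).1 hu
  have hL : D * L = L.transpose * D := by
    ext σ η
    rw [Matrix.diagonal_mul, Matrix.mul_diagonal, Matrix.transpose_apply, h.symm, mul_comm]
  have hc : D * (t • L) * D⁻¹ = (t • L).transpose := by
    rw [Matrix.mul_smul, hL, Matrix.smul_mul, Matrix.mul_assoc, Matrix.mul_nonsing_inv _ hu',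
      Matrix.mul_one, Matrix.transpose_smul]
  have e := Matrix.exp_conj D (t • L) hu
  rw [hc, Matrix.exp_transpose] at e
  have e' : (heat L t).transpose * D = D * heat L t := by
    rw [heat, e, Matrix.mul_assoc, Matrix.nonsing_inv_mul _ hu', Matrix.mul_one]
  have := congrFun (congrFun e' σ) η
  rw [Matrix.diagonal_mul, Matrix.mul_diagonal, Matrix.transpose_apply] at this
  rw [← this, mul_comm]

theorem avg_mul_flow (t : ℝ) (f g : Ω → ℝ) :
    avg w (fun σ => f σ * flow L t g σ) = avg w (fun σ => flow L t f σ * g σ) := by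
  simp only [avg, flow, Finset.mul_sum, Finset.sum_mul]
  rw [Finset.sum_comm]
  refine Finset.sum_congr rfl fun η _ => Finset.sum_congr rfl fun σ _ => ?_
  linear_combination f σ * g η * h.heat_symm t σ η

theorem avg_flow (t : ℝ) (f : Ω → ℝ) : avg w (flow L t f) = avg w f := by
  have := h.avg_mul_flow t (fun _ => 1) f
  simpa only [one_mul, h.flow_const] using this

end IsReversible

end

section

/-! ### Hypercontractivity -/

/-- The Stroock–Varopoulos inequality. -/
theorem rpow_half_sub_sq_le {x y q : ℝ} (hx : 0 < x) (hy : 0 < y) (hq : 1 < q) :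
    4 * (q - 1) / q ^ 2 * (x ^ (q / 2) - y ^ (q / 2)) ^ 2 ≤
      (x ^ (q - 1) - y ^ (q - 1)) * (x - y) := by
  wlog hxy : y ≤ x generalizing x y
  · have := this hy hx (le_of_not_ge hxy)
    calc _ = 4 * (q - 1) / q ^ 2 * (y ^ (q / 2) - x ^ (q / 2)) ^ 2 := by ring
      _ ≤ _ := this
      _ = _ := by ring
  have hq0 : 0 < q := by linarith
  have hq1 : 0 < q - 1 := by linarith
  -- A quadratic in `l` without negative values has nonpositive discriminant, which is the claim. It
  -- is the increment from `y` to `x` of a function with derivative `(l * s ^ (q/2 - 1) - 1) ^ 2`: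
  -- Cauchy–Schwarz without integrals.
  have key : ∀ l : ℝ, 0 ≤ (x ^ (q - 1) - y ^ (q - 1)) / (q - 1) * (l * l) +
      (-(4 / q) * (x ^ (q / 2) - y ^ (q / 2))) * l + (x - y) := by
    intro l
    have hd : ∀ s ∈ Set.Ioi (0 : ℝ), HasDerivAt
        (fun s : ℝ => l ^ 2 / (q - 1) * s ^ (q - 1) - l * (4 / q) * s ^ (q / 2) + s)
        ((l * s ^ (q / 2 - 1) - 1) ^ 2) s := by
      intro s hs
      have hs : (0 : ℝ) < s := hs
      have h1 := (Real.hasDerivAt_rpow_const (x := s) (p := q - 1) (Or.inl hs.ne')).const_mul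
        (l ^ 2 / (q - 1))
      have h2 := (Real.hasDerivAt_rpow_const (x := s) (p := q / 2) (Or.inl hs.ne')).const_mul
        (l * (4 / q))
      have e : s ^ (q - 1 - 1) = (s ^ (q / 2 - 1)) ^ 2 := by
        rw [← Real.rpow_natCast, ← Real.rpow_mul hs.le]
        congr 1; push_cast; ring
      refine ((h1.sub h2).add (hasDerivAt_id s)).congr_deriv ?_
      rw [e]
      field_simp
      ring
    have hm : MonotoneOn
        (fun s : ℝ => l ^ 2 / (q - 1) * s ^ (q - 1) - l * (4 / q) * s ^ (q / 2) + s)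
        (Set.Ioi 0) := by
      refine monotoneOn_of_deriv_nonneg (convex_Ioi 0)
        (fun s hs => (hd s hs).continuousAt.continuousWithinAt)
        (fun s hs => ?_) (fun s hs => ?_)
      · rw [interior_Ioi] at hs
        exact (hd s hs).differentiableAt.differentiableWithinAt
      · rw [interior_Ioi] at hs
        rw [(hd s hs).deriv]
        exact sq_nonneg _
    have := hm hy hx hxy
    simp only at this
    have e : (x ^ (q - 1) - y ^ (q - 1)) / (q - 1) * (l * l) +
      (-(4 / q) * (x ^ (q / 2) - y ^ (q / 2))) * l + (x - y) =
      (l ^ 2 / (q - 1) * x ^ (q - 1) - l * (4 / q) * x ^ (q / 2) + x) -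
      (l ^ 2 / (q - 1) * y ^ (q - 1) - l * (4 / q) * y ^ (q / 2) + y) := by ring
    rw [e]
    linarith
  have hdisc := discrim_le_zero key
  rw [discrim] at hdisc
  have e : 4 * (q - 1) / q ^ 2 * (x ^ (q / 2) - y ^ (q / 2)) ^ 2 =
      (q - 1) / 4 * (-(4 / q) * (x ^ (q / 2) - y ^ (q / 2))) ^ 2 := by
    field_simp
  rw [e]
  calc _ ≤ (q - 1) / 4 * (4 * ((x ^ (q - 1) - y ^ (q - 1)) / (q - 1)) * (x - y)) :=
        mul_le_mul_of_nonneg_left (by linarith) (by positivity)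
    _ = _ := by field_simp

variable {Ω : Type*} [Fintype Ω]

namespace IsReversible

section

variable {L : Matrix Ω Ω ℝ} {w : Ω → ℝ} (h : IsReversible L w)
include h

theorem energyForm_mono {f g f' g' : Ω → ℝ}
    (H : ∀ σ η, (f σ - f η) * (g σ - g η) ≤ (f' σ - f' η) * (g' σ - g' η)) :
    energyForm L w f g ≤ energyForm L w f' g' := by
  refine mul_le_mul_of_nonneg_left (Finset.sum_le_sum fun σ _ => Finset.sum_le_sum fun η _ => ?_)
    (by norm_num)
  by_cases hse : σ = η
  · subst hse; simp
  · exact mul_le_mul_of_nonneg_left (H σ η) (mul_nonneg (h.pos σ).le (h.nonneg σ η hse))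

theorem energyForm_rpow_le {f : Ω → ℝ} (hf : ∀ σ, 0 < f σ) {q : ℝ} (hq : 1 < q) :
    4 * (q - 1) / q ^ 2 * energyForm L w (fun σ => f σ ^ (q / 2)) (fun σ => f σ ^ (q / 2)) ≤
      energyForm L w (fun σ => f σ ^ (q - 1)) f := by
  have e : 4 * (q - 1) / q ^ 2 *
      energyForm L w (fun σ => f σ ^ (q / 2)) (fun σ => f σ ^ (q / 2)) =
      energyForm L w (fun σ => 4 * (q - 1) / q ^ 2 * f σ ^ (q / 2)) (fun σ => f σ ^ (q / 2)) := by
    simp only [energyForm, Finset.mul_sum]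
    exact Finset.sum_congr rfl fun σ _ => Finset.sum_congr rfl fun η _ => by ring
  rw [e]
  refine h.energyForm_mono fun σ η => ?_
  refine le_trans (le_of_eq ?_) (rpow_half_sub_sq_le (hf σ) (hf η) hq)
  ring

/-- The Poincaré inequality follows from the logarithmic Sobolev inequality. -/
theorem avg_sq_le_energyForm {C : ℝ}
    (H : ∀ f : Ω → ℝ, (∀ σ, 0 ≤ f σ) →
      entropy w f ≤ C * energyForm L w (fun σ => √(f σ)) (fun σ => √(f σ)))
    {g : Ω → ℝ} (hg : avg w g = 0) : avg w (fun σ => g σ ^ 2) ≤ C * energyForm L w g g := by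
  -- The shift makes `g + c` nonnegative, so that `√((g + c) ^ 2) = g + c`.
  set c := ∑ σ, |g σ|
  have hc : ∀ σ, 0 ≤ g σ + c := fun σ => by
    have := Finset.single_le_sum (f := fun σ => |g σ|) (fun σ _ => abs_nonneg _)
      (Finset.mem_univ σ)
    have h2 := neg_abs_le (g σ)
    linarith
  have h1 := H (fun σ => (g σ + c) ^ 2) fun σ => sq_nonneg _
  have h2 := avg_sub_sq_avg_sqrt_le_entropy h.isProb (f := fun σ => (g σ + c) ^ 2)
    fun σ => sq_nonneg _
  simp only [Real.sqrt_sq (hc _)] at h1 h2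
  have e1 : avg w (fun σ => (g σ + c) ^ 2) = avg w (fun σ => g σ ^ 2) + c ^ 2 := by
    have : (fun σ => (g σ + c) ^ 2) = fun σ => (g σ ^ 2 + 2 * c * g σ) + c ^ 2 := by
      funext σ; ring
    rw [this, avg_add, avg_add, avg_const h.isProb, avg_const_mul, hg]
    ring
  have e2 : avg w (fun σ => g σ + c) = c := by
    rw [avg_add, avg_const h.isProb, hg, zero_add]
  have e3 : energyForm L w (fun σ => g σ + c) (fun σ => g σ + c) = energyForm L w g g := by
    simp only [energyForm, add_sub_add_right_eq_sub]
  rw [e1, e2] at h2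
  rw [e3] at h1
  linarith

end

variable [DecidableEq Ω] {L : Matrix Ω Ω ℝ} {w : Ω → ℝ} (h : IsReversible L w)
include h

/-- The Poincaré inequality makes `exp (2 * t / C)` times the left side nonincreasing in `t`. -/
theorem avg_flow_sq_le {C : ℝ} (hC : 0 < C)
    (H : ∀ g : Ω → ℝ, avg w g = 0 → avg w (fun σ => g σ ^ 2) ≤ C * energyForm L w g g)
    {g : Ω → ℝ} (hg : avg w g = 0) {t : ℝ} (ht : 0 ≤ t) :
    avg w (fun σ => flow L t g σ ^ 2) ≤ Real.exp (-(2 * t / C)) * avg w (fun σ => g σ ^ 2) := by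
  have hd : ∀ t, HasDerivAt (fun t => avg w (fun σ => flow L t g σ ^ 2))
      (-(2 * energyForm L w (flow L t g) (flow L t g))) t := by
    intro t
    have h1 : HasDerivAt (fun t => avg w (fun σ => flow L t g σ ^ 2))
        (∑ σ, w σ * (2 * flow L t g σ * ∑ η, L σ η * flow L t g η)) t := by
      simp only [avg]
      refine HasDerivAt.fun_sum fun σ _ => HasDerivAt.const_mul _ ?_
      simpa using (hasDerivAt_flow L g t σ).fun_pow 2
    convert h1 using 1
    rw [← mul_neg, ← h.avg_mul_gen, avg, Finset.mul_sum]
    exact Finset.sum_congr rfl fun σ _ => by ring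
  have hd2 : ∀ t, HasDerivAt (fun t => Real.exp (2 / C * t) * avg w (fun σ => flow L t g σ ^ 2))
      (Real.exp (2 / C * t) * (2 / C) * avg w (fun σ => flow L t g σ ^ 2) +
        Real.exp (2 / C * t) * (-(2 * energyForm L w (flow L t g) (flow L t g)))) t := fun t => by
    have h1 : HasDerivAt (fun t : ℝ => Real.exp (2 / C * t)) (Real.exp (2 / C * t) * (2 / C)) t := by
      simpa using ((hasDerivAt_id t).const_mul (2 / C)).exp
    exact h1.mul (hd t)
  have hanti : Antitone fun t => Real.exp (2 / C * t) * avg w (fun σ => flow L t g σ ^ 2) := by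
    refine antitone_of_deriv_nonpos (fun t => (hd2 t).differentiableAt) fun t => ?_
    rw [(hd2 t).deriv]
    have h1 := H (flow L t g) (by rw [h.avg_flow, hg])
    have h2 : 2 / C * avg w (fun σ => flow L t g σ ^ 2) ≤
        2 * energyForm L w (flow L t g) (flow L t g) := by
      rw [div_mul_eq_mul_div, div_le_iff₀ hC]
      linarith
    have := Real.exp_pos (2 / C * t)
    nlinarith
  have := hanti ht
  simp only [mul_zero, Real.exp_zero, one_mul, flow_zero] at this
  rw [Real.exp_neg, ← div_eq_inv_mul, le_div_iff₀ (Real.exp_pos _), mul_comm]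
  convert this using 3
  ring

/-- Gross's hypercontractivity theorem. -/
theorem log_avg_flow_rpow_le {C : ℝ} (hC : 0 < C)
    (H : ∀ f : Ω → ℝ, (∀ σ, 0 ≤ f σ) →
      entropy w f ≤ C * energyForm L w (fun σ => √(f σ)) (fun σ => √(f σ)))
    {f : Ω → ℝ} (hf : ∀ σ, 1 ≤ f σ) {a : ℝ} (ha : 0 < a) {t : ℝ} (ht : 0 ≤ t) :
    Real.log (avg w fun σ => flow L t f σ ^ (1 + a * Real.exp (4 / C * t))) /
        (1 + a * Real.exp (4 / C * t)) ≤
      Real.log (avg w fun σ => f σ ^ (1 + a)) / (1 + a) := by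
  -- The solution of `q' = (4 / C) (q - 1)`: at this speed the entropy produced by the growing
  -- exponent is just compensated by the energy, through the logarithmic Sobolev and
  -- Stroock–Varopoulos inequalities.
  set q : ℝ → ℝ := fun t => 1 + a * Real.exp (4 / C * t)
  have hq1 : ∀ t, 1 < q t := fun t => by
    have := mul_pos ha (Real.exp_pos (4 / C * t))
    simp only [q]; linarith
  have hqd : ∀ t, HasDerivAt q (4 / C * (q t - 1)) t := fun t => by
    have h1 : HasDerivAt (fun t : ℝ => Real.exp (4 / C * t)) (Real.exp (4 / C * t) * (4 / C)) t := by
      simpa using ((hasDerivAt_id t).const_mul (4 / C)).exp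
    refine ((h1.const_mul a).const_add 1).congr_deriv ?_
    simp only [q]; ring
  have hF : ∀ t, 0 ≤ t → ∀ σ, 0 < flow L t f σ := fun t ht σ => by
    have := h.flow_le_flow hf ht σ
    rw [h.flow_const] at this
    linarith
  set φ : ℝ → ℝ := fun t => avg w fun σ => flow L t f σ ^ q t
  have hφ : ∀ t, 0 ≤ t → 0 < φ t := fun t ht => by
    have : Nonempty Ω := by
      by_contra hne
      rw [not_nonempty_iff] at hne
      have := h.sum_eq_one
      simp at this
    exact Finset.sum_pos (fun σ _ => mul_pos (h.pos σ) (Real.rpow_pos_of_pos (hF t ht σ) _))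
      Finset.univ_nonempty
  have hφd : ∀ t, 0 ≤ t → HasDerivAt φ
      (4 / C * (q t - 1) * avg w (fun σ => flow L t f σ ^ q t * Real.log (flow L t f σ)) -
        q t * energyForm L w (fun σ => flow L t f σ ^ (q t - 1)) (flow L t f)) t := by
    intro t ht
    have h1 : HasDerivAt φ (∑ σ, w σ * ((∑ η, L σ η * flow L t f η) * q t *
        flow L t f σ ^ (q t - 1) + 4 / C * (q t - 1) * flow L t f σ ^ q t *
          Real.log (flow L t f σ))) t := by
      simp only [φ, avg]
      exact HasDerivAt.fun_sum fun σ _ => HasDerivAt.const_mul _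
        ((hasDerivAt_flow L f t σ).rpow (hqd t) (hF t ht σ))
    convert h1 using 1
    rw [sub_eq_add_neg, ← mul_neg, ← h.avg_mul_gen, avg, avg, Finset.mul_sum, Finset.mul_sum,
      ← Finset.sum_add_distrib]
    exact Finset.sum_congr rfl fun σ _ => by ring
  have hψd : ∀ t, 0 ≤ t → HasDerivAt (fun t => Real.log (φ t) / q t)
      (((4 / C * (q t - 1) * avg w (fun σ => flow L t f σ ^ q t * Real.log (flow L t f σ)) -
        q t * energyForm L w (fun σ => flow L t f σ ^ (q t - 1)) (flow L t f)) / φ t * q t -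
        Real.log (φ t) * (4 / C * (q t - 1))) / q t ^ 2) t := fun t ht =>
    ((hφd t ht).log (hφ t ht).ne').div (hqd t) (by linarith [hq1 t])
  have hneg : ∀ t, 0 ≤ t →
      ((4 / C * (q t - 1) * avg w (fun σ => flow L t f σ ^ q t * Real.log (flow L t f σ)) -
        q t * energyForm L w (fun σ => flow L t f σ ^ (q t - 1)) (flow L t f)) / φ t * q t -
        Real.log (φ t) * (4 / C * (q t - 1))) / q t ^ 2 ≤ 0 := by
    intro t ht
    refine div_nonpos_of_nonpos_of_nonneg ?_ (sq_nonneg _)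
    have hp := hφ t ht
    have hq := hq1 t
    have hent := H (fun σ => flow L t f σ ^ q t) fun σ => (Real.rpow_pos_of_pos (hF t ht σ) _).le
    have hs : ∀ σ, √(flow L t f σ ^ q t) = flow L t f σ ^ (q t / 2) := fun σ => by
      rw [Real.sqrt_eq_rpow, ← Real.rpow_mul (hF t ht σ).le, mul_one_div]
    simp only [hs] at hent
    have hlog : entropy w (fun σ => flow L t f σ ^ q t) =
        q t * avg w (fun σ => flow L t f σ ^ q t * Real.log (flow L t f σ)) -
          φ t * Real.log (φ t) := by
      rw [entropy, ← avg_const_mul]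
      congr 2
      funext σ
      rw [Real.log_rpow (hF t ht σ)]
      ring
    have hsv := h.energyForm_rpow_le (hF t ht) hq
    set E1 := energyForm L w (fun σ => flow L t f σ ^ (q t - 1)) (flow L t f)
    set E2 := energyForm L w (fun σ => flow L t f σ ^ (q t / 2)) (fun σ => flow L t f σ ^ (q t / 2))
    set A := avg w (fun σ => flow L t f σ ^ q t * Real.log (flow L t f σ))
    rw [hlog] at hent
    have h3 : 4 * (q t - 1) * E2 ≤ E1 * q t ^ 2 := by
      have h0 : (0 : ℝ) < q t ^ 2 := by positivity
      rwa [div_mul_eq_mul_div, div_le_iff₀ h0] at hsv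
    have h4 : 4 / C * (q t - 1) * (q t * A - φ t * Real.log (φ t)) ≤ 4 * (q t - 1) * E2 := by
      calc _ ≤ 4 / C * (q t - 1) * (C * E2) :=
            mul_le_mul_of_nonneg_left hent (mul_nonneg (by positivity) (by linarith))
        _ = _ := by field_simp
    have e : (4 / C * (q t - 1) * A - q t * E1) / φ t * q t -
        Real.log (φ t) * (4 / C * (q t - 1)) =
        (4 / C * (q t - 1) * (q t * A - φ t * Real.log (φ t)) - E1 * q t ^ 2) / φ t := by
      field_simp
      ring
    rw [e]
    exact div_nonpos_of_nonpos_of_nonneg (by linarith) hp.le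
  have hanti : AntitoneOn (fun t => Real.log (φ t) / q t) (Set.Ici 0) := by
    refine antitoneOn_of_deriv_nonpos (convex_Ici 0)
      (fun t ht => (hψd t ht).continuousAt.continuousWithinAt)
      (fun t ht => ?_) (fun t ht => ?_)
    · rw [interior_Ici] at ht
      exact (hψd t (le_of_lt ht)).differentiableAt.differentiableWithinAt
    · rw [interior_Ici] at ht
      rw [(hψd t (le_of_lt ht)).deriv]
      exact hneg t (le_of_lt ht)
  have := hanti (Set.self_mem_Ici) ht ht
  simpa only [φ, q, mul_zero, Real.exp_zero, mul_one, flow_zero] using this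

end IsReversible

end

section

/-! ### Uniform mixing -/

namespace IsReversible

variable {Ω : Type*} [Fintype Ω] [DecidableEq Ω] {L : Matrix Ω Ω ℝ} {w : Ω → ℝ}
  (h : IsReversible L w)
include h

theorem flow_single (t : ℝ) (σ η : Ω) :
    flow L t (Pi.single σ (1 / w σ)) η = heat L t σ η / w η := by
  simp only [flow, Pi.single_apply, mul_ite, mul_zero, Finset.sum_ite_eq', Finset.mem_univ, if_true]
  have h1 := h.heat_symm t σ η
  rw [mul_one_div, div_eq_div_iff (h.pos σ).ne' (h.pos η).ne']
  linarith

theorem avg_single (σ : Ω) : avg w (Pi.single σ (1 / w σ)) = 1 := by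
  simp only [avg, Pi.single_apply, mul_ite, mul_zero, Finset.sum_ite_eq', Finset.mem_univ, if_true]
  exact mul_one_div_cancel (h.pos σ).ne'

/-- The initial density is at most `r ^ (-n)`, so its power `1 / n` is bounded and its moment of
exponent `1 + 1 / n` is bounded uniformly in `n`. Hypercontractivity reaches exponent `2` exactly at
time `(C / 4) log n`. The added `1` keeps the observable at least `1`. -/
theorem avg_flow_single_sq_le {C : ℝ} (hC : 0 < C)
    (H : ∀ f : Ω → ℝ, (∀ σ, 0 ≤ f σ) →
      entropy w f ≤ C * energyForm L w (fun σ => √(f σ)) (fun σ => √(f σ)))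
    {r : ℝ} (hr : 0 < r) (hr1 : r ≤ 1) {n : ℕ} (hn : 0 < n) (hw : ∀ σ, r ^ n ≤ w σ) (σ : Ω) :
    avg w (fun η => flow L (C / 4 * Real.log n)
      (fun η => (Pi.single σ (1 / w σ) : Ω → ℝ) η + 1) η ^ 2) ≤ (4 / r) ^ 2 := by
  set f : Ω → ℝ := fun η => (Pi.single σ (1 / w σ) : Ω → ℝ) η + 1
  have hn' : (0 : ℝ) < n := by exact_mod_cast hn
  have hn1 : (1 : ℝ) ≤ n := by exact_mod_cast hn
  have hs : ∀ η, 0 ≤ (Pi.single σ (1 / w σ) : Ω → ℝ) η := fun η => by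
    rw [Pi.single_apply]
    split_ifs
    · exact (one_div_pos.2 (h.pos σ)).le
    · exact le_rfl
  have hf : ∀ η, 1 ≤ f η := fun η => by simp only [f]; linarith [hs η]
  have hfle : ∀ η, f η ≤ (2 / r) ^ n := fun η => by
    have h1 : (Pi.single σ (1 / w σ) : Ω → ℝ) η ≤ 1 / r ^ n := by
      rw [Pi.single_apply]
      split_ifs
      · exact one_div_le_one_div_of_le (by positivity) (hw σ)
      · positivity
    have h2 : 1 ≤ 1 / r ^ n := by
      rw [le_div_iff₀ (by positivity), one_mul]; exact pow_le_one₀ hr.le hr1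
    have h3 : (2 : ℝ) ≤ 2 ^ n := by
      simpa using pow_le_pow_right₀ (by norm_num : (1 : ℝ) ≤ 2) hn
    rw [div_pow, ← mul_one_div]
    simp only [f]
    nlinarith
  have hroot : ∀ η, f η ^ (1 / (n : ℝ)) ≤ 2 / r := fun η => by
    have h1 := Real.rpow_le_rpow (by linarith [hf η]) (hfle η)
      (by positivity : (0 : ℝ) ≤ 1 / (n : ℝ))
    rwa [← Real.rpow_natCast, ← Real.rpow_mul (by positivity), mul_one_div_cancel hn'.ne',
      Real.rpow_one] at h1
  have havg : avg w (fun η => f η ^ (1 + 1 / (n : ℝ))) ≤ 4 / r := by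
    have h1 : ∀ η, f η ^ (1 + 1 / (n : ℝ)) ≤ f η * (2 / r) := fun η => by
      rw [Real.rpow_add (by linarith [hf η]), Real.rpow_one]
      exact mul_le_mul_of_nonneg_left (hroot η) (by linarith [hf η])
    refine (avg_mono h.isProb.1 h1).trans (le_of_eq ?_)
    rw [avg_mul_const]
    have : avg w f = 2 := by
      simp only [f]
      rw [avg_add, avg_const h.isProb, h.avg_single]; norm_num
    rw [this]; ring
  have havg1 : 1 ≤ avg w (fun η => f η ^ (1 + 1 / (n : ℝ))) := by
    have := avg_mono (w := w) (f := fun _ => (1 : ℝ)) (g := fun η => f η ^ (1 + 1 / (n : ℝ)))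
      h.isProb.1 fun η => Real.one_le_rpow (hf η) (by positivity)
    rwa [avg_const h.isProb] at this
  have hK : 1 ≤ 4 / r := havg1.trans havg
  have ht : 0 ≤ C / 4 * Real.log n := mul_nonneg (by positivity) (Real.log_nonneg hn1)
  have key := h.log_avg_flow_rpow_le hC H hf (a := 1 / (n : ℝ)) (by positivity) ht
  have e : 1 / (n : ℝ) * Real.exp (4 / C * (C / 4 * Real.log n)) = 1 := by
    rw [← mul_assoc, div_mul_div_cancel₀ hC.ne', div_self (by norm_num : (4 : ℝ) ≠ 0), one_mul,
      Real.exp_log hn', one_div_mul_cancel hn'.ne']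
  rw [e] at key
  norm_num only at key
  simp only [Real.rpow_ofNat] at key
  have h1 : Real.log (avg w fun η => f η ^ (1 + 1 / (n : ℝ))) / (1 + 1 / n) ≤ Real.log (4 / r) := by
    refine (div_le_self (Real.log_nonneg havg1) ?_).trans
      (Real.log_le_log (by linarith) havg)
    have : 0 ≤ 1 / (n : ℝ) := by positivity
    linarith
  have h2 : Real.log (avg w fun η => flow L (C / 4 * Real.log n) f η ^ 2) ≤
      Real.log ((4 / r) ^ 2) := by
    rw [Real.log_pow]
    push_cast
    have := key.trans h1
    linarith
  have hpos : 0 < avg w fun η => flow L (C / 4 * Real.log n) f η ^ 2 := by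
    have h3 := avg_mono (w := w) (f := fun _ => (1 : ℝ))
      (g := fun η => flow L (C / 4 * Real.log n) f η ^ 2) h.isProb.1 fun η => by
        have := h.flow_le_flow hf ht η
        rw [h.flow_const] at this
        nlinarith
    rw [avg_const h.isProb] at h3
    linarith
  exact (Real.log_le_log_iff hpos (by positivity)).1 h2

/-- By symmetry, the density at twice a time, minus `1`, is the inner product of two centred
densities at that time, so Cauchy–Schwarz applies. Their squared norms are at most `(4 / r) ^ 2`
after the hypercontractive phase, and the time `s` is such that Poincaré decay turns this into `exp
(-1)`. -/
theorem abs_heat_div_sub_one_le {C : ℝ} (hC : 0 < C)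
    (H : ∀ f : Ω → ℝ, (∀ σ, 0 ≤ f σ) →
      entropy w f ≤ C * energyForm L w (fun σ => √(f σ)) (fun σ => √(f σ)))
    {r : ℝ} (hr : 0 < r) (hr1 : r ≤ 1) {n : ℕ} (hn : 0 < n) (hw : ∀ σ, r ^ n ≤ w σ) (σ η : Ω) :
    |heat L (2 * (C / 4 * Real.log n + C * (Real.log (4 / r) + 1 / 2))) σ η / w η - 1| ≤
      Real.exp (-1) := by
  set t := C / 4 * Real.log n
  set s := C * (Real.log (4 / r) + 1 / 2)
  have hK : 1 ≤ 4 / r := by rw [le_div_iff₀ hr]; linarith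
  have hs : 0 ≤ s := mul_nonneg hC.le (by have := Real.log_nonneg hK; linarith)
  set D : Ω → Ω → ℝ := fun σ => Pi.single σ (1 / w σ)
  set G : Ω → Ω → ℝ := fun σ η => flow L (s + t) (D σ) η - 1
  have hG0 : ∀ σ, avg w (G σ) = 0 := fun σ => by
    have : avg w (flow L (s + t) (D σ)) = 1 := by rw [h.avg_flow, h.avg_single]
    simp only [G]
    rw [avg_sub, avg_const h.isProb]
    linarith
  have hG : ∀ σ, avg w (fun η => G σ η ^ 2) ≤ Real.exp (-1) := fun σ => by
    set F := flow L t (fun η => D σ η + 1)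
    have hF : avg w F = 2 := by
      rw [h.avg_flow, avg_add, avg_const h.isProb, h.avg_single]; norm_num
    have e1 : G σ = flow L s (fun η => F η - 2) := by
      funext η
      have h1 : flow L s F η = G σ η + 2 := by
        rw [flow_flow, flow_add, h.flow_const]; simp only [G]; ring
      have h2 := flow_add L s (fun η => F η - 2) (fun _ => 2) η
      rw [h.flow_const] at h2
      simp only [sub_add_cancel] at h2
      linarith
    have h1 := h.avg_flow_sq_le hC (fun g => h.avg_sq_le_energyForm H) (g := fun η => F η - 2)
      (by rw [avg_sub, avg_const h.isProb, hF, sub_self]) hs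
    rw [← e1] at h1
    have h2 : avg w (fun η => (F η - 2) ^ 2) ≤ (4 / r) ^ 2 := by
      refine le_trans ?_ (h.avg_flow_single_sq_le hC H hr hr1 hn hw σ)
      have : (fun η => (F η - 2) ^ 2) = fun η => (F η ^ 2 - 4 * F η) + 4 := by
        funext η; ring
      rw [this, avg_add, avg_sub, avg_const_mul, hF, avg_const h.isProb]
      have : avg w (fun η => F η ^ 2) - 4 * 2 + 4 ≤ avg w (fun η => F η ^ 2) := by linarith
      exact this
    refine h1.trans ((mul_le_mul_of_nonneg_left h2 (Real.exp_pos _).le).trans (le_of_eq ?_))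
    rw [← Real.exp_log (show 0 < (4 / r) ^ 2 by positivity), ← Real.exp_add, Real.log_pow]
    congr 1
    simp only [s]
    push_cast
    field_simp
    ring
  have e : heat L (2 * (t + s)) σ η / w η - 1 = avg w (fun ξ => G σ ξ * G η ξ) := by
    have h1 : heat L (2 * (t + s)) σ η / w η = flow L (s + t) (flow L (s + t) (D σ)) η := by
      rw [flow_flow, ← h.flow_single, show 2 * (t + s) = s + t + (s + t) by ring]
    have h2 : flow L (s + t) (flow L (s + t) (D σ)) η =
        avg w fun ξ => flow L (s + t) (D σ) ξ * flow L (s + t) (D η) ξ := by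
      rw [flow, avg]
      refine Finset.sum_congr rfl fun ξ _ => ?_
      have := (h.pos ξ).ne'
      rw [h.flow_single _ η]
      field_simp
    have h3 : (fun ξ => flow L (s + t) (D σ) ξ * flow L (s + t) (D η) ξ) =
        fun ξ => (G σ ξ * G η ξ + (G σ ξ + G η ξ)) + 1 := by
      funext ξ; simp only [G]; ring
    rw [h1, h2, h3, avg_add, avg_add, avg_add, hG0, hG0, avg_const h.isProb]
    ring
  rw [e]
  refine abs_le_of_sq_le_sq ?_ (Real.exp_pos _).le
  refine (avg_mul_sq_le h.isProb.1 _ _).trans ?_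
  rw [sq (Real.exp (-1))]
  exact mul_le_mul (hG σ) (hG η) (avg_nonneg h.isProb.1 fun ξ => sq_nonneg _) (Real.exp_pos _).le

end IsReversible

/-! ### The Glauber dynamics -/

variable {b : ℕ} (β h : ℝ) (m : ℕ) (τ : Vertex b → Bool)

theorem toMatrix_generator_apply (σ η : Config b m) :
    LinearMap.toMatrix' (generator β h m τ) σ η =
      ∑ x : tree b m, rate β h m τ x σ *
        ((if flipAt σ x = η then 1 else 0) - if σ = η then 1 else 0) := by
  rw [LinearMap.toMatrix'_apply]
  simp [generator, Pi.single_apply]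

theorem sum_toMatrix_generator_mul (g : Config b m → ℝ) (σ : Config b m) :
    ∑ η, LinearMap.toMatrix' (generator β h m τ) σ η * g η = generator β h m τ g σ := by
  have := LinearMap.toMatrix'_mulVec (generator β h m τ) g
  exact congrFun this σ

theorem sum_flipAt (x : tree b m) (F : Config b m → ℝ) : ∑ σ, F (flipAt σ x) = ∑ σ, F σ :=
  Equiv.sum_comp (Function.Involutive.toPerm (fun σ : Config b m => flipAt σ x)
    fun σ => flipAt_flipAt σ x) F

theorem isReversible_generator :
    IsReversible (LinearMap.toMatrix' (generator β h m τ)) (mu β h m τ) where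
  pos := mu_pos β h m τ
  sum_eq_one := (isProb_mu β h m τ).2
  nonneg σ η hne := by
    rw [toMatrix_generator_apply]
    refine Finset.sum_nonneg fun x _ => mul_nonneg (rate_nonneg _ _ _ _ _ _) ?_
    rw [if_neg hne, sub_zero]
    positivity
  row_sum σ := by
    have := sum_toMatrix_generator_mul β h m τ (fun _ => 1) σ
    simpa [generator] using this
  symm σ η := by
    simp only [toMatrix_generator_apply, Finset.mul_sum]
    refine Finset.sum_congr rfl fun x _ => ?_
    by_cases h1 : σ = η
    · subst h1; rfl
    · by_cases h2 : flipAt σ x = η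
      · subst h2
        rw [if_pos rfl, if_neg h1, flipAt_flipAt, if_pos rfl, if_neg (Ne.symm h1)]
        linarith [mu_mul_rate β h m τ x σ]
      · have h3 : flipAt η x ≠ σ := fun h3 => h2 (by rw [← h3, flipAt_flipAt])
        rw [if_neg h1, if_neg h2, if_neg (Ne.symm h1), if_neg h3]
        simp

/-- Both sides equal minus the expectation of `g * generator g`. -/
theorem energyForm_generator (g : Config b m → ℝ) :
    energyForm (LinearMap.toMatrix' (generator β h m τ)) (mu β h m τ) g g =
      dirichlet β h m τ g := by
  have h1 := (isReversible_generator β h m τ).avg_mul_gen g g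
  simp only [sum_toMatrix_generator_mul] at h1
  have h2 : avg (mu β h m τ) (fun σ => g σ * generator β h m τ g σ) =
      ∑ x : tree b m, ∑ σ, mu β h m τ σ * rate β h m τ x σ * (g σ * (g (flipAt σ x) - g σ)) := by
    rw [Finset.sum_comm, avg]
    refine Finset.sum_congr rfl fun σ _ => ?_
    simp only [generator, LinearMap.coe_mk, AddHom.coe_mk, Finset.mul_sum]
    exact Finset.sum_congr rfl fun x _ => by ring
  have h3 : ∀ x : tree b m,
      ∑ σ, mu β h m τ σ * rate β h m τ x σ * (g σ * (g (flipAt σ x) - g σ)) =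
      ∑ σ, mu β h m τ σ * rate β h m τ x σ * (g (flipAt σ x) * (g σ - g (flipAt σ x))) := by
    intro x
    rw [← sum_flipAt m x]
    refine Finset.sum_congr rfl fun σ _ => ?_
    rw [flipAt_flipAt, ← mu_mul_rate]
  have h4 : 2 * avg (mu β h m τ) (fun σ => g σ * generator β h m τ g σ) =
      -(2 * dirichlet β h m τ g) := by
    rw [two_mul]
    nth_rewrite 2 [h2]
    rw [Finset.sum_congr rfl fun x _ => h3 x, h2, dirichlet, ← Finset.sum_add_distrib,
      ← mul_assoc, mul_one_div_cancel two_ne_zero, one_mul, ← Finset.sum_neg_distrib]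
    refine Finset.sum_congr rfl fun x _ => ?_
    rw [← Finset.sum_add_distrib, ← Finset.sum_neg_distrib]
    exact Finset.sum_congr rfl fun σ _ => by ring
  linarith

theorem isProbabilityMeasure_muMeasure :
    MeasureTheory.IsProbabilityMeasure (muMeasure β h m τ) := by
  constructor
  rw [muMeasure, MeasureTheory.Measure.finsetSum_apply]
  simp only [MeasureTheory.Measure.smul_apply, MeasureTheory.measure_univ, smul_eq_mul, mul_one]
  rw [← ENNReal.ofReal_sum_of_nonneg fun σ _ => (mu_pos β h m τ σ).le, (isProb_mu β h m τ).2,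
    ENNReal.ofReal_one]

/-- The density is within `1 / e` of `1` uniformly, hence in every `L^p` of a probability measure.
-/
theorem mixingTime_le {β : ℝ} (hβ : 0 ≤ β) {C : ℝ} (hC : 0 < C)
    (H : ∀ f : Config b m → ℝ, (∀ σ, 0 ≤ f σ) →
      ent β h m τ f ≤ C * dirichlet β h m τ fun σ => √(f σ)) (p : ℝ≥0∞) :
    mixingTime β h m τ p ≤ ENNReal.ofReal
      (2 * (C / 4 * Real.log (tree b m).card +
        C * (Real.log (4 / gibbsFloor b β h) + 1 / 2))) := by
  have hr := gibbsFloor_pos b β h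
  have hr1 := gibbsFloor_le_half b hβ h
  have hn : 0 < (tree b m).card := Finset.card_pos.2 ⟨[], (mem_tree m _).2 (by simp)⟩
  have hn1 : (1 : ℝ) ≤ (tree b m).card := by exact_mod_cast hn
  have hK : 1 ≤ 4 / gibbsFloor b β h := by rw [le_div_iff₀ hr]; linarith
  refine iInf₂_le_of_le _ ⟨?_, fun σ => ?_⟩ le_rfl
  · have h1 := Real.log_nonneg hn1
    have h2 := Real.log_nonneg hK
    have : 0 < C * (Real.log (4 / gibbsFloor b β h) + 1 / 2) := mul_pos hC (by linarith)
    have : 0 ≤ C / 4 * Real.log (tree b m).card := mul_nonneg (by positivity) h1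
    linarith
  · have := isProbabilityMeasure_muMeasure β h m τ
    have h1 := MeasureTheory.eLpNorm_le_of_ae_bound (p := p) (μ := muMeasure β h m τ)
      (f := fun η => density β h m τ (2 * (C / 4 * Real.log (tree b m).card +
        C * (Real.log (4 / gibbsFloor b β h) + 1 / 2))) σ η - 1) (C := Real.exp (-1))
      (Filter.Eventually.of_forall fun η => by
        rw [Real.norm_eq_abs]
        refine (isReversible_generator β h m τ).abs_heat_div_sub_one_le hC (fun f hf => ?_)
          hr (by linarith) hn (gibbsFloor_pow_le_mu hβ h m τ) σ η
        rw [energyForm_generator, ← ent_eq_entropy]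
        exact H f hf)
    simpa using h1

theorem exists_mixingTime_le {b : ℕ} (hb : 2 ≤ b) {β : ℝ} (hβ : 0 ≤ β) (h : ℝ) {C : ℝ} (hC : 0 < C) :
    ∃ C', 0 < C' ∧ ∀ (m : ℕ) (τ : Vertex b → Bool), (∀ f : Config b m → ℝ, (∀ σ, 0 ≤ f σ) →
      ent β h m τ f ≤ C * dirichlet β h m τ fun σ => √(f σ)) →
      1 / C' ≤ logSobolev β h m τ ∧ (1 ≤ m → ∀ p : ℝ≥0∞,
        mixingTime β h m τ p ≤ ENNReal.ofReal (C' * Real.log ((tree b m).card : ℝ))) := by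
  have hr := gibbsFloor_pos b β h
  have hr1 := gibbsFloor_le_half b hβ h
  have hK : 1 ≤ 4 / gibbsFloor b β h := by rw [le_div_iff₀ hr]; linarith
  have hlog := Real.log_nonneg hK
  set K := Real.log (4 / gibbsFloor b β h)
  have hC' : C ≤ C * (2 + 2 * K) := le_mul_of_one_le_right hC.le (by linarith)
  refine ⟨C * (2 + 2 * K), by linarith, fun m τ H => ⟨?_, fun hm p => ?_⟩⟩
  · exact (one_div_le_one_div_of_le hC hC').trans (le_logSobolev β h m τ hC H)
  · refine (mixingTime_le h m τ hβ hC H p).trans (ENNReal.ofReal_le_ofReal ?_)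
    -- For `m ≥ 1` the root and its children give `n ≥ 3 > e`, so `log n ≥ 1` absorbs the additive
    -- constant; for `m = 0` it would vanish.
    have h3 : 3 ≤ (tree b m).card := by
      have hsub : insert [] (children []) ⊆ tree b m := by
        intro x hx
        rw [mem_tree]
        rcases Finset.mem_insert.1 hx with rfl | hx
        · simp
        · simp only [children, Finset.mem_image] at hx
          obtain ⟨i, -, rfl⟩ := hx
          simpa using hm
      refine le_trans ?_ (Finset.card_le_card hsub)
      rw [Finset.card_insert_of_notMem (by simp [children]), children,
        Finset.card_image_of_injective _ fun i j hij => (List.cons.inj hij).1]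
      simp only [Finset.card_univ, Fintype.card_fin]
      omega
    have h3' : (3 : ℝ) ≤ (tree b m).card := by exact_mod_cast h3
    have hl : 1 ≤ Real.log (tree b m).card := by
      rw [Real.le_log_iff_exp_le (by linarith)]
      linarith [Real.exp_one_lt_d9]
    set l := Real.log (tree b m).card
    have h4 : 0 ≤ C * K := mul_nonneg hC.le hlog
    nlinarith

end

section

variable {b : ℕ}

/-! ### The recursion for the effective fields -/

theorem continuous_msgFun (β : ℝ) : Continuous (msgFun β) :=
  continuous_iff_continuousAt.2 fun a => (hasDerivAt_msgFun β a).continuousAt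

theorem continuous_influence (β : ℝ) : Continuous (influence β) := by
  have h : Continuous fun a => pr a true :=
    continuous_iff_continuousAt.2 fun a => (hasDerivAt_pr_true a).continuousAt
  exact (h.comp (continuous_id.add continuous_const)).sub
    (h.comp (continuous_id.sub continuous_const))

/-- The effective field at a vertex whose `b` children all have effective field `a`. -/
def fieldMap (b : ℕ) (β g a : ℝ) : ℝ := g + b * msgFun β a

theorem fieldMap_mono (b : ℕ) {β : ℝ} (hβ : 0 ≤ β) (g : ℝ) : Monotone (fieldMap b β g) :=
  fun _ _ h => add_le_add le_rfl (mul_le_mul_of_nonneg_left (msgFun_mono hβ h) b.cast_nonneg)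

theorem continuous_fieldMap (b : ℕ) (β g : ℝ) : Continuous (fieldMap b β g) :=
  continuous_const.add (continuous_const.mul (continuous_msgFun β))

theorem hasDerivAt_fieldMap (b : ℕ) (β g a : ℝ) :
    HasDerivAt (fieldMap b β g) (b * influence β a) a :=
  ((hasDerivAt_msgFun β a).const_mul _).const_add _

theorem fieldMap_le (b : ℕ) {β : ℝ} (hβ : 0 ≤ β) (g a : ℝ) : fieldMap b β g a ≤ g + b * β :=
  add_le_add le_rfl (mul_le_mul_of_nonneg_left (abs_le.1 (abs_msgFun_le hβ a)).2 b.cast_nonneg)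

theorem le_fieldMap (b : ℕ) {β : ℝ} (hβ : 0 ≤ β) (g a : ℝ) : g - b * β ≤ fieldMap b β g a := by
  have := mul_le_mul_of_nonneg_left (abs_le.1 (abs_msgFun_le hβ a)).1 (Nat.cast_nonneg (α := ℝ) b)
  rw [fieldMap]; linarith

theorem le_iterate_fieldMap (b : ℕ) {β : ℝ} (hβ : 0 ≤ β) (g : ℝ) {a a0 : ℝ}
    (ha : a ≤ fieldMap b β g a) (ha0 : a ≤ a0) (k : ℕ) : a ≤ (fieldMap b β g)^[k] a0 := by
  induction k with
  | zero => exact ha0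
  | succ k ih =>
    rw [Function.iterate_succ_apply']
    exact ha.trans (fieldMap_mono b hβ g ih)

theorem iterate_fieldMap_le (b : ℕ) {β : ℝ} (hβ : 0 ≤ β) (g : ℝ) {a a0 : ℝ}
    (ha : fieldMap b β g a ≤ a) (ha0 : a0 ≤ a) (k : ℕ) : (fieldMap b β g)^[k] a0 ≤ a := by
  induction k with
  | zero => exact ha0
  | succ k ih =>
    rw [Function.iterate_succ_apply']
    exact (fieldMap_mono b hβ g ih).trans ha

open Filter Topology

/-- The fields under the plus boundary condition converge to the largest fixed point. -/
theorem exists_tendsto_upper (b : ℕ) {β : ℝ} (hβ : 0 ≤ β) (g : ℝ) :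
    ∃ a, fieldMap b β g a = a ∧ b * influence β a ≤ 1 ∧
      Tendsto (fun k => (fieldMap b β g)^[k] (g + b * β)) atTop (𝓝 a) := by
  have hanti := (fieldMap_mono b hβ g).antitone_iterate_of_map_le (fieldMap_le b hβ g (g + b * β))
  have hbβ : (0 : ℝ) ≤ b * β := by positivity
  have hbdd : BddBelow (Set.range fun k => (fieldMap b β g)^[k] (g + b * β)) := by
    refine ⟨g - b * β, ?_⟩
    rintro _ ⟨k, rfl⟩
    exact le_iterate_fieldMap b hβ g (le_fieldMap b hβ g _) (by linarith) k
  have htend := tendsto_atTop_ciInf hanti hbdd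
  set a := ⨅ k, (fieldMap b β g)^[k] (g + b * β)
  have hfix : fieldMap b β g a = a :=
    isFixedPt_of_tendsto_iterate htend (continuous_fieldMap b β g).continuousAt
  refine ⟨a, hfix, ?_, htend⟩
  -- If the map exceeded `y` at `y`, all iterates would stay above `y`, against convergence to `a <
  -- y`. So slopes from `a` to the right are at most `1`.
  have hlt : ∀ y, a < y → fieldMap b β g y ≤ y := by
    intro y hy
    by_contra! hcon
    have h1 := fun k => le_iterate_fieldMap b hβ g hcon.le
      (hcon.le.trans (fieldMap_le b hβ g y)) k
    exact absurd (ge_of_tendsto' htend h1) (not_le.2 hy)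
  have hs := (hasDerivAt_iff_tendsto_slope.1 (hasDerivAt_fieldMap b β g a)).mono_left
    (nhdsGT_le_nhdsNE a)
  refine le_of_tendsto hs ?_
  filter_upwards [self_mem_nhdsWithin] with y hy
  have hy : a < y := hy
  rw [slope_def_field, hfix, div_le_one (by linarith)]
  linarith [hlt y hy]

theorem exists_tendsto_lower (b : ℕ) {β : ℝ} (hβ : 0 ≤ β) (g : ℝ) :
    ∃ a, fieldMap b β g a = a ∧
      Tendsto (fun k => (fieldMap b β g)^[k] (g - b * β)) atTop (𝓝 a) := by
  have hmono := (fieldMap_mono b hβ g).monotone_iterate_of_le_map (le_fieldMap b hβ g (g - b * β))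
  have hbβ : (0 : ℝ) ≤ b * β := by positivity
  have hbdd : BddAbove (Set.range fun k => (fieldMap b β g)^[k] (g - b * β)) := by
    refine ⟨g + b * β, ?_⟩
    rintro _ ⟨k, rfl⟩
    exact iterate_fieldMap_le b hβ g (fieldMap_le b hβ g _) (by linarith) k
  have htend := tendsto_atTop_ciSup hmono hbdd
  exact ⟨_, isFixedPt_of_tendsto_iterate htend (continuous_fieldMap b β g).continuousAt, htend⟩

theorem sum_boundaryMsg_le {β : ℝ} (hβ : 0 ≤ β) (g : ℝ) (τ : Vertex b → Bool) (k : ℕ) :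
    ∀ x : Vertex b, g + ∑ i, boundaryMsg β g τ k (i :: x) ≤ (fieldMap b β g)^[k] (g + b * β) := by
  induction k with
  | zero =>
    intro x
    refine add_le_add le_rfl ((Finset.sum_le_sum fun i _ =>
      (abs_le.1 (abs_boundaryMsg_le hβ g τ 0 (i :: x))).2).trans ?_)
    simp
  | succ k ih =>
    intro x
    rw [Function.iterate_succ_apply']
    refine add_le_add le_rfl ((Finset.sum_le_sum fun i _ => msgFun_mono hβ (ih (i :: x))).trans ?_)
    simp

theorem le_sum_boundaryMsg {β : ℝ} (hβ : 0 ≤ β) (g : ℝ) (τ : Vertex b → Bool) (k : ℕ) :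
    ∀ x : Vertex b, (fieldMap b β g)^[k] (g - b * β) ≤ g + ∑ i, boundaryMsg β g τ k (i :: x) := by
  induction k with
  | zero =>
    intro x
    have := Finset.sum_le_sum (s := Finset.univ) fun i _ =>
      (abs_le.1 (abs_boundaryMsg_le hβ g τ 0 (i :: x))).1
    simp only [Finset.sum_const, Finset.card_univ, Fintype.card_fin, nsmul_eq_mul] at this
    rw [Function.iterate_zero, id]
    linarith
  | succ k ih =>
    intro x
    rw [Function.iterate_succ_apply']
    refine add_le_add le_rfl (le_trans ?_ (Finset.sum_le_sum fun i _ => msgFun_mono hβ (ih (i :: x))))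
    simp

theorem sum_boundaryMsg_plus (β g : ℝ) (k : ℕ) : ∀ x : Vertex b,
    g + ∑ i, boundaryMsg β g (fun _ => true) k (i :: x) = (fieldMap b β g)^[k] (g + b * β) := by
  induction k with
  | zero => intro x; simp [boundaryMsg, spin]
  | succ k ih =>
    intro x
    rw [Function.iterate_succ_apply']
    simp only [boundaryMsg, ih, fieldMap, Finset.sum_const, Finset.card_univ, Fintype.card_fin,
      nsmul_eq_mul]

/-! ### Decay of the influences in the effective fields -/

theorem fieldBounds_effField {β : ℝ} (hβ : 0 ≤ β) (g : ℝ) {m J : ℕ} {τ : Vertex b → Bool} {ρ : ℝ}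
    (H : ∀ y : Vertex b, ∀ k, y.length + k = m → J ≤ k → b * Real.tanh β *
      influence β (g + ∑ i, boundaryMsg β g τ k (i :: y)) ≤ ρ) :
    FieldBounds b β g m J ρ (effField β g m τ) where
  recursion _ hy := effField_recursion β g τ hy
  abs_le y := abs_effField_le hβ g m τ y
  decay y hy := by
    rw [effField, if_pos (by omega)]
    exact H y _ (by omega) (by omega)

/-- `β₁` is the solution of `tanh β = 1 / √b`. -/
theorem mul_sq_tanh_lt_one (hb : 2 ≤ b) {β : ℝ} (hβ : 0 ≤ β) (h1 : β < beta1 b) :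
    b * Real.tanh β ^ 2 < 1 := by
  have hb' : (2 : ℝ) ≤ b := by exact_mod_cast hb
  set s := √(b : ℝ)
  have hs : s ^ 2 = b := Real.sq_sqrt (by linarith)
  have hs0 : 0 ≤ s := Real.sqrt_nonneg _
  have hs1 : 1 < s := by nlinarith
  have h2 : 2 * β < Real.log ((s + 1) / (s - 1)) := by
    rw [beta1] at h1; linarith
  have hpos : 0 < (s + 1) / (s - 1) := div_pos (by linarith) (by linarith)
  have h3 : Real.exp (2 * β) < (s + 1) / (s - 1) := by
    rwa [← Real.lt_log_iff_exp_lt hpos]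
  rw [lt_div_iff₀ (by linarith)] at h3
  have ht : Real.tanh β = (Real.exp (2 * β) - 1) / (Real.exp (2 * β) + 1) := by
    rw [Real.tanh_eq_sinh_div_cosh, Real.sinh_eq, Real.cosh_eq, two_mul, Real.exp_add, Real.exp_neg]
    have := Real.exp_pos β
    field_simp
  have h4 : s * Real.tanh β < 1 := by
    have := Real.exp_pos (2 * β)
    rw [ht, ← mul_div_assoc, div_lt_one (by linarith)]
    linarith
  have h5 : 0 ≤ s * Real.tanh β := mul_nonneg hs0 (tanh_nonneg' hβ)
  rw [← hs, ← mul_pow]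
  exact pow_lt_one₀ h5 h4 two_ne_zero

theorem exists_fieldBounds_of_lt_beta1 (hb : 2 ≤ b) {β : ℝ} (hβ : 0 ≤ β) (h1 : β < beta1 b)
    (g : ℝ) : ∃ (J : ℕ) (ρ : ℝ), 0 < ρ ∧ ρ < 1 ∧ ∀ (m : ℕ) (τ : Vertex b → Bool),
      FieldBounds b β g m J ρ (effField β g m τ) := by
  have h2 := mul_sq_tanh_lt_one hb hβ h1
  have ht := tanh_nonneg' hβ
  -- The midpoint between `b * tanh β ^ 2` and `1` is positive even at `β = 0`; no exceptional
  -- levels are needed.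
  refine ⟨0, (1 + b * Real.tanh β ^ 2) / 2, by positivity, by linarith, fun m τ =>
    fieldBounds_effField hβ g fun y k _ _ => ?_⟩
  have := mul_le_mul_of_nonneg_left
    (influence_le_tanh hβ (g + ∑ i, boundaryMsg β g τ k (i :: y)))
    (show 0 ≤ b * Real.tanh β by positivity)
  linarith

/-- `b * influence` may equal `1` at the fixed point; strictness comes from `tanh β < 1`, and
continuity carries it to a neighbourhood. -/
theorem exists_nhds_influence_le {β : ℝ} (hβ : 0 ≤ β) {a : ℝ} (ha : b * influence β a ≤ 1) :
    ∃ ρ : ℝ, 0 < ρ ∧ ρ < 1 ∧ ∀ᶠ y in 𝓝 a, b * Real.tanh β * influence β y ≤ ρ := by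
  have ht := tanh_nonneg' hβ
  have ht1 := Real.tanh_lt_one β
  refine ⟨(1 + Real.tanh β) / 2, by linarith, by linarith, ?_⟩
  have hc : Continuous fun y => b * Real.tanh β * influence β y :=
    continuous_const.mul (continuous_influence β)
  have : b * Real.tanh β * influence β a < (1 + Real.tanh β) / 2 := by
    have := mul_le_mul_of_nonneg_left ha ht
    linarith
  exact (hc.continuousAt.eventually_lt_const this).mono fun y hy => hy.le

/-- Under the plus boundary condition all vertices of one level have the same field, an iterate of
`fieldMap`; outside the last `J` levels it is close to the largest fixed point. -/
theorem exists_fieldBounds_plus (b : ℕ) {β : ℝ} (hβ : 0 ≤ β) (g : ℝ) :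
    ∃ (J : ℕ) (ρ : ℝ), 0 < ρ ∧ ρ < 1 ∧ ∀ m : ℕ,
      FieldBounds b β g m J ρ (effField β g m fun _ => true) := by
  obtain ⟨a, -, ha, htend⟩ := exists_tendsto_upper b hβ g
  obtain ⟨ρ, h0, h1, hρ⟩ := exists_nhds_influence_le hβ ha
  obtain ⟨J, hJ⟩ := eventually_atTop.1 (htend.eventually hρ)
  refine ⟨J, ρ, h0, h1, fun m => fieldBounds_effField hβ g fun y k _ hk => ?_⟩
  rw [sum_boundaryMsg_plus]
  exact hJ k hk

/-- For every boundary condition the fields lie between the iterates from below and from above, and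
with a unique fixed point both converge to it. -/
theorem exists_fieldBounds_of_unique (b : ℕ) {β : ℝ} (hβ : 0 ≤ β) (g : ℝ)
    (H : ∀ a a', fieldMap b β g a = a → fieldMap b β g a' = a' → a = a') :
    ∃ (J : ℕ) (ρ : ℝ), 0 < ρ ∧ ρ < 1 ∧ ∀ (m : ℕ) (τ : Vertex b → Bool),
      FieldBounds b β g m J ρ (effField β g m τ) := by
  obtain ⟨a, hfix, ha, htend⟩ := exists_tendsto_upper b hβ g
  obtain ⟨a', hfix', htend'⟩ := exists_tendsto_lower b hβ g
  obtain rfl := H a a' hfix hfix'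
  obtain ⟨ρ, h0, h1, hρ⟩ := exists_nhds_influence_le hβ ha
  obtain ⟨l, u, hlu, hsub⟩ := mem_nhds_iff_exists_Ioo_subset.1 hρ
  obtain ⟨J, hJ⟩ := eventually_atTop.1 ((htend.eventually_lt_const hlu.2).and
    (htend'.eventually_const_lt hlu.1))
  refine ⟨J, ρ, h0, h1, fun m τ => fieldBounds_effField hβ g fun y k _ hk => ?_⟩
  obtain ⟨h2, h3⟩ := hJ k hk
  exact hsub ⟨h3.trans_le (le_sum_boundaryMsg hβ g τ k y),
    (sum_boundaryMsg_le hβ g τ k y).trans_lt h2⟩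

end

section

variable {b : ℕ}

open MeasureTheory

/-! ### Cylinders -/

/-- The configurations that agree with `ξ` on `A`. -/
def cyl (A : Finset (Vertex b)) (ξ : Vertex b → Bool) : Set (Vertex b → Bool) :=
  {η | ∀ x ∈ A, η x = ξ x}

theorem measurableSet_cyl (A : Finset (Vertex b)) (ξ : Vertex b → Bool) :
    MeasurableSet (cyl A ξ) := by
  have : cyl A ξ = ⋂ x ∈ A, (fun η : Vertex b → Bool => η x) ⁻¹' {ξ x} := by
    ext η; simp [cyl]
  rw [this]
  exact Finset.measurableSet_biInter _ fun x _ => measurable_pi_apply x (measurableSet_singleton _)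

theorem exists_subset_tree (A : Finset (Vertex b)) (m0 : ℕ) : ∃ m, m0 ≤ m ∧ A ⊆ tree b m :=
  ⟨max m0 (A.sup List.length), le_max_left _ _, fun _ hx => (mem_tree _ _).2
    ((Finset.le_sup (f := List.length) hx).trans (le_max_right _ _))⟩

/-- Every finite set of vertices lies in a deep enough tree, so the measures have the same
finite-dimensional marginals. -/
theorem measure_ext_of_cyl {μ ν : Measure (Vertex b → Bool)} [IsFiniteMeasure ν] (m0 : ℕ)
    (H : ∀ m, m0 ≤ m → ∀ ξ, μ (cyl (tree b m) ξ) = ν (cyl (tree b m) ξ)) : μ = ν := by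
  refine IsProjectiveLimit.unique (P := fun I => ν.map I.restrict) (fun I => ?_) fun I => rfl
  obtain ⟨m, hm, hI⟩ := exists_subset_tree I m0
  have hJ : μ.map (tree b m).restrict = ν.map (tree b m).restrict := by
    refine Measure.ext_of_singleton fun ζ => ?_
    have hζ : (tree b m).restrict (π := fun _ => Bool) ⁻¹' {ζ} = cyl (tree b m) (glue (tree b m) (fun _ => true) ζ) := by
      ext η
      simp only [Set.mem_preimage, Set.mem_singleton_iff, cyl, Set.mem_ofPred_eq]
      constructor
      · rintro rfl x hx
        rw [glue_of_mem hx]; rfl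
      · intro h
        funext x
        have := h x.1 x.2
        rwa [glue_of_mem x.2] at this
    rw [Measure.map_apply (Finset.measurable_restrict _) (measurableSet_singleton _),
      Measure.map_apply (Finset.measurable_restrict _) (measurableSet_singleton _), hζ, H m hm]
  have hr : (I.restrict : (Vertex b → Bool) → _) =
      Finset.restrict₂ hI ∘ (tree b m).restrict := rfl
  dsimp only
  rw [hr, ← Measure.map_map (Finset.measurable_restrict₂ hI) (Finset.measurable_restrict _),
    ← Measure.map_map (Finset.measurable_restrict₂ hI) (Finset.measurable_restrict _), hJ]

/-! ### Finite-volume Gibbs distributions as functions of the boundary condition -/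

theorem measurable_glue (A : Finset (Vertex b)) (ζ : A → Bool) :
    Measurable fun η : Vertex b → Bool => glue A η ζ := by
  refine measurable_pi_iff.2 fun x => ?_
  by_cases hx : x ∈ A
  · simp only [glue_of_mem hx]; exact measurable_const
  · simp only [glue_of_notMem hx]; exact measurable_pi_apply x

theorem measurable_weight (β h : ℝ) (A : Finset (Vertex b)) : Measurable (weight β h A) := by
  have hs : ∀ x : Vertex b, Measurable fun η : Vertex b → Bool => spin (η x) := fun x =>
    (measurable_of_countable spin).comp (measurable_pi_apply x)
  refine Real.measurable_exp.comp (Measurable.const_mul (Measurable.add ?_ ?_) _)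
  · exact Finset.measurable_fun_sum _ fun c _ => (hs c).mul (hs c.tail)
  · exact (Finset.measurable_fun_sum _ fun x _ => hs x).const_mul _

theorem measurable_gibbs (β h : ℝ) (A : Finset (Vertex b)) (ζ : A → Bool) :
    Measurable fun η : Vertex b → Bool => gibbs β h A η ζ :=
  ((measurable_weight β h A).comp (measurable_glue A ζ)).div
    (Finset.measurable_fun_sum _ fun ξ _ => (measurable_weight β h A).comp (measurable_glue A ξ))

theorem weight_congr (β h : ℝ) {A : Finset (Vertex b)} {k : ℕ} (hA : A ⊆ tree b k)
    {η η' : Vertex b → Bool} (H : ∀ x ∈ tree b (k + 1), η x = η' x) :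
    weight β h A η = weight β h A η' := by
  have h1 : ∀ x ∈ A, x ∈ tree b (k + 1) := fun x hx => by
    have := (mem_tree _ _).1 (hA hx)
    exact (mem_tree _ _).2 (by omega)
  have h2 : ∀ c ∈ edgesMeeting A, η c = η' c ∧ η c.tail = η' c.tail := by
    intro c hc
    have hl : c.tail.length = c.length - 1 := List.length_tail
    rcases (mem_edgesMeeting.1 hc).2 with h | h <;> have := (mem_tree _ _).1 (hA h)
    · exact ⟨H _ ((mem_tree _ _).2 (by omega)), H _ ((mem_tree _ _).2 (by omega))⟩
    · exact ⟨H _ ((mem_tree _ _).2 (by omega)), H _ ((mem_tree _ _).2 (by omega))⟩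
  have e1 : ∑ c ∈ edgesMeeting A, spin (η c) * spin (η c.tail) =
      ∑ c ∈ edgesMeeting A, spin (η' c) * spin (η' c.tail) :=
    Finset.sum_congr rfl fun c hc => by rw [(h2 c hc).1, (h2 c hc).2]
  have e2 : ∑ x ∈ A, spin (η x) = ∑ x ∈ A, spin (η' x) :=
    Finset.sum_congr rfl fun x hx => by rw [H x (h1 x hx)]
  rw [weight, weight, e1, e2]

theorem glue_self (A : Finset (Vertex b)) (ξ : Vertex b → Bool) :
    glue A ξ (fun x => ξ x) = ξ := by
  funext x
  by_cases hx : x ∈ A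
  · rw [glue_of_mem hx]
  · rw [glue_of_notMem hx]

/-! ### The Dobrushin–Lanford–Ruelle equations on cylinders -/

theorem glue_mem_cyl_iff {A B : Finset (Vertex b)} (hA : A ⊆ B) (ξ η : Vertex b → Bool)
    (ζ : A → Bool) : glue A η ζ ∈ cyl B ξ ↔ (ζ = fun x : A => ξ x) ∧ η ∈ cyl (B \ A) ξ := by
  simp only [cyl, Set.mem_ofPred_eq, Finset.mem_sdiff]
  constructor
  · refine fun h => ⟨funext fun x => ?_, fun x hx => ?_⟩
    · rw [← h x (hA x.2), glue_of_mem x.2]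
    · rw [← h x hx.1, glue_of_notMem hx.2]
  · rintro ⟨rfl, h⟩ x hx
    by_cases hxA : x ∈ A
    · rw [glue_of_mem hxA]
    · rw [glue_of_notMem hxA, h x ⟨hx, hxA⟩]

theorem measure_cyl_sdiff (ν : Measure (Vertex b → Bool)) {A B : Finset (Vertex b)} (hA : A ⊆ B)
    (ξ : Vertex b → Bool) : ν (cyl (B \ A) ξ) = ∑ ζ : A → Bool, ν (cyl B (glue A ξ ζ)) := by
  have hu : cyl (B \ A) ξ = ⋃ ζ ∈ (Finset.univ : Finset (A → Bool)), cyl B (glue A ξ ζ) := by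
    ext η
    simp only [Set.mem_iUnion, Finset.mem_univ, exists_prop, true_and, cyl, Set.mem_ofPred_eq,
      Finset.mem_sdiff]
    constructor
    · refine fun h => ⟨fun x : A => η x, fun x hx => ?_⟩
      by_cases hxA : x ∈ A
      · rw [glue_of_mem hxA]
      · rw [glue_of_notMem hxA, h x ⟨hx, hxA⟩]
    · rintro ⟨ζ, h⟩ x ⟨hx, hxA⟩
      rw [h x hx, glue_of_notMem hxA]
  rw [hu, measure_biUnion_finset]
  · intro ζ _ ζ' _ hne
    refine Set.disjoint_left.2 fun η h h' => hne (funext fun x => ?_)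
    have h1 := h x.1 (hA x.2)
    have h2 := h' x.1 (hA x.2)
    rw [glue_of_mem x.2] at h1 h2
    rw [← h1, h2]
  · exact fun ζ _ => measurableSet_cyl _ _

/-- The DLR equation equates two measures, so cylinders suffice. On a cylinder one level deeper than
`A` the kernel is constant, since the neighbours of `A` are fixed, and the equation says that `P` is
proportional to the Gibbs weight under changes inside `A`. -/
theorem isGibbsMeasure_of_cyl {β h : ℝ} {ν : Measure (Vertex b → Bool)} [IsProbabilityMeasure ν]
    {P : ℕ → (Vertex b → Bool) → ℝ} (hP : ∀ m ξ, 0 ≤ P m ξ)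
    (hν : ∀ m ξ, ν (cyl (tree b m) ξ) = ENNReal.ofReal (P m ξ))
    (hw : ∀ (m : ℕ) (A : Finset (Vertex b)), A ⊆ tree b m → ∀ ξ η : Vertex b → Bool,
      (∀ x ∉ A, η x = ξ x) → P (m + 1) η * weight β h A ξ = P (m + 1) ξ * weight β h A η) :
    IsGibbsMeasure β h ν := by
  refine ⟨inferInstance, fun A B hB => ?_⟩
  set ν' : Measure (Vertex b → Bool) := ∑ ζ : A → Bool, Measure.map (fun η => glue A η ζ)
    (ν.withDensity fun η => ENNReal.ofReal (gibbs β h A η ζ))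
  have hν' : ∀ B : Set (Vertex b → Bool), MeasurableSet B → ν' B =
      ∫⁻ η, ∑ ζ : A → Bool, ENNReal.ofReal (gibbs β h A η ζ) * B.indicator 1 (glue A η ζ) ∂ν := by
    intro B hB
    have hm : ∀ ζ : A → Bool, MeasurableSet ((fun η => glue A η ζ) ⁻¹' B) := fun ζ =>
      measurable_glue A ζ hB
    rw [Measure.finsetSum_apply, lintegral_finsetSum]
    · refine Finset.sum_congr rfl fun ζ _ => ?_
      rw [Measure.map_apply (measurable_glue A ζ) hB, withDensity_apply _ (hm ζ),
        ← lintegral_indicator (hm ζ)]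
      refine lintegral_congr fun η => ?_
      by_cases hη : glue A η ζ ∈ B
      · rw [Set.indicator_of_mem (by exact hη), Set.indicator_of_mem hη, Pi.one_apply, mul_one]
      · rw [Set.indicator_of_notMem (by exact hη), Set.indicator_of_notMem hη, mul_zero]
    · exact fun ζ _ => (measurable_gibbs β h A ζ).ennreal_ofReal.mul
        ((measurable_one.indicator hB).comp (measurable_glue A ζ))
  rw [← hν' B hB]
  obtain ⟨k, -, hAk⟩ := exists_subset_tree A 0
  refine congrArg (fun ν : Measure _ => ν B) (measure_ext_of_cyl (k + 1) fun m hm ξ => ?_)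
  obtain ⟨m, rfl⟩ : ∃ l, m = l + 1 := ⟨m - 1, by omega⟩
  have hAm : A ⊆ tree b m := fun x hx => by
    have := (mem_tree _ _).1 (hAk hx)
    exact (mem_tree _ _).2 (by omega)
  have hAm' : A ⊆ tree b (m + 1) := fun x hx => by
    have := (mem_tree _ _).1 (hAk hx)
    exact (mem_tree _ _).2 (by omega)
  have hint : ∀ η, ∑ ζ : A → Bool, ENNReal.ofReal (gibbs β h A η ζ) *
      (cyl (tree b (m + 1)) ξ).indicator 1 (glue A η ζ) =
      (cyl (tree b (m + 1) \ A) ξ).indicator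
        (fun _ => ENNReal.ofReal (gibbs β h A ξ fun x => ξ x)) η := by
    intro η
    rw [Finset.sum_eq_single fun x : A => ξ x]
    · by_cases hη : η ∈ cyl (tree b (m + 1) \ A) ξ
      · rw [Set.indicator_of_mem ((glue_mem_cyl_iff hAm' ξ η fun x => ξ x).2 ⟨rfl, hη⟩),
          Set.indicator_of_mem hη, Pi.one_apply, mul_one]
        congr 1
        have e : ∀ ζ, weight β h A (glue A η ζ) = weight β h A (glue A ξ ζ) := fun ζ => by
          refine weight_congr β h hAm fun x hx => ?_
          by_cases hxA : x ∈ A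
          · rw [glue_of_mem hxA, glue_of_mem hxA]
          · rw [glue_of_notMem hxA, glue_of_notMem hxA, hη x (Finset.mem_sdiff.2 ⟨hx, hxA⟩)]
        simp only [gibbs, e]
      · rw [Set.indicator_of_notMem fun h => hη ((glue_mem_cyl_iff hAm' ξ η fun x => ξ x).1 h).2,
          Set.indicator_of_notMem hη, mul_zero]
    · intro ζ _ hζ
      rw [Set.indicator_of_notMem fun h => hζ ((glue_mem_cyl_iff hAm' ξ η ζ).1 h).1, mul_zero]
    · exact fun h => absurd (Finset.mem_univ _) h
  rw [hν' _ (measurableSet_cyl _ _), lintegral_congr hint,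
    lintegral_indicator (measurableSet_cyl _ _), setLIntegral_const, measure_cyl_sdiff ν hAm' ξ]
  simp only [hν]
  rw [← ENNReal.ofReal_sum_of_nonneg fun ζ _ => hP _ _, ← ENNReal.ofReal_mul (gibbs_nonneg _ _ _ _ _)]
  congr 1
  have hpos : 0 < ∑ ζ : A → Bool, weight β h A (glue A ξ ζ) :=
    Finset.sum_pos (fun _ _ => weight_pos _ _ _ _) Finset.univ_nonempty
  rw [gibbs, glue_self, div_mul_eq_mul_div, div_eq_iff hpos.ne', Finset.mul_sum, Finset.mul_sum]
  refine Finset.sum_congr rfl fun ζ _ => ?_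
  rw [mul_comm]
  exact hw m A hAm ξ _ fun x hx => glue_of_notMem hx

/-! ### Tree-indexed Markov chains -/

/-- The law of a spin in the field `a`, as a measure. -/
def spinLaw (a : ℝ) : Measure Bool := ∑ s, ENNReal.ofReal (pr a s) • Measure.dirac s

theorem spinLaw_singleton (a : ℝ) (s : Bool) : spinLaw a {s} = ENNReal.ofReal (pr a s) := by
  rw [spinLaw, Measure.finsetSum_apply]
  cases s <;> simp

instance (a : ℝ) : IsProbabilityMeasure (spinLaw a) := by
  constructor
  rw [spinLaw, Measure.finsetSum_apply]
  simp only [Measure.smul_apply, measure_univ, smul_eq_mul, mul_one]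
  rw [← ENNReal.ofReal_sum_of_nonneg fun s _ => (pr_pos a s).le, (isProb_pr a).2,
    ENNReal.ofReal_one]

/-- The field at a vertex when the spin of its parent is given. -/
def chainField (β a : ℝ) : Vertex b × Bool → ℝ
  | ([], _) => a
  | (_ :: _, s) => a + β * spin s

/-- The spin of the parent, `true` at the root. -/
def parentSpin (ξ : Vertex b → Bool) : Vertex b → Bool
  | [] => true
  | _ :: x => ξ x

theorem chainField_parentSpin (β a : ℝ) (ξ : Vertex b → Bool) (c : Vertex b) :
    chainField β a (c, parentSpin ξ c) = a + parentField β ξ c := by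
  cases c <;> simp [chainField, parentSpin, parentField]

/-- The configuration built from the spins that each vertex has for each spin of its parent. -/
def chain (ω : Vertex b × Bool → Bool) : Vertex b → Bool
  | [] => ω ([], true)
  | i :: x => ω (i :: x, chain ω x)

theorem chain_eq (ω : Vertex b × Bool → Bool) (c : Vertex b) :
    chain ω c = ω (c, parentSpin (chain ω) c) := by cases c <;> rfl

theorem measurable_chain : Measurable (chain (b := b)) := by
  refine measurable_pi_iff.2 fun c => ?_
  induction c with
  | nil => exact measurable_pi_apply _
  | cons i x ih =>
    have e : (fun ω : Vertex b × Bool → Bool => chain ω (i :: x)) =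
        fun ω => if chain ω x = true then ω (i :: x, true) else ω (i :: x, false) := by
      funext ω
      rw [chain]
      cases chain ω x <;> simp
    rw [e]
    exact Measurable.ite (ih (measurableSet_singleton true)) (measurable_pi_apply _)
      (measurable_pi_apply _)

/-- The law of the tree-indexed Markov chain in which every vertex has effective field `a`. -/
def chainLaw (b : ℕ) (β a : ℝ) : Measure (Vertex b → Bool) :=
  (Measure.infinitePi fun p : Vertex b × Bool => spinLaw (chainField β a p)).map chain

instance (β a : ℝ) : IsProbabilityMeasure (chainLaw b β a) :=
  Measure.isProbabilityMeasure_map measurable_chain.aemeasurable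

/-- Agreement with `ξ` up to level `m` constrains only the noise at pairs of a vertex and the spin
of its parent under `ξ`. The event is thus a box in the product space. -/
theorem chain_preimage_cyl (m : ℕ) (ξ : Vertex b → Bool) :
    chain ⁻¹' cyl (tree b m) ξ =
      Set.pi ((tree b m).image fun c => (c, parentSpin ξ c)) fun p => {ξ p.1} := by
  have htail : ∀ ω, ∀ c ∈ tree b m, (∀ i x, c = i :: x → chain ω x = ξ x) →
      parentSpin (chain ω) c = parentSpin ξ c := by
    intro ω c hc h
    cases c with
    | nil => rfl
    | cons i x => exact h i x rfl
  ext ω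
  simp only [Set.mem_preimage, cyl, Set.mem_ofPred_eq, Set.mem_pi, Finset.coe_image, Set.mem_image,
    Finset.mem_coe, Set.mem_singleton_iff, forall_exists_index, and_imp]
  constructor
  · rintro h _ c hc rfl
    rw [← htail ω c hc fun i x hx => h x ?_, ← chain_eq ω c, h c hc]
    subst hx
    rw [mem_tree] at hc ⊢
    simp only [List.length_cons] at hc
    omega
  · intro h c
    induction c with
    | nil => intro hc; rw [chain_eq]; exact h _ [] hc rfl
    | cons i x ih =>
      intro hc
      rw [chain_eq, htail ω _ hc fun j y hy => ?_]
      · exact h _ _ hc rfl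
      · obtain ⟨-, rfl⟩ := List.cons.inj hy
        refine ih ?_
        rw [mem_tree] at hc ⊢
        simp only [List.length_cons] at hc
        omega

/-- The probability that the Markov chain agrees with `ξ` up to level `m`. -/
def chainProb (β a : ℝ) (m : ℕ) (ξ : Vertex b → Bool) : ℝ :=
  ∏ c ∈ tree b m, pr (a + parentField β ξ c) (ξ c)

theorem chainLaw_cyl (β a : ℝ) (m : ℕ) (ξ : Vertex b → Bool) :
    chainLaw b β a (cyl (tree b m) ξ) = ENNReal.ofReal (chainProb β a m ξ) := by
  rw [chainLaw, Measure.map_apply measurable_chain (measurableSet_cyl _ _), chain_preimage_cyl,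
    Measure.infinitePi_pi _ fun _ _ => measurableSet_singleton _,
    Finset.prod_image fun c _ c' _ hc => congrArg Prod.fst hc, chainProb,
    ENNReal.ofReal_prod_of_nonneg fun c _ => (pr_pos _ _).le]
  refine Finset.prod_congr rfl fun c _ => ?_
  rw [chainField_parentSpin, spinLaw_singleton]

theorem sum_tree_succ (m : ℕ) (f : Vertex b → ℝ) :
    ∑ c ∈ tree b (m + 1), f c = ∑ c ∈ tree b m, f c + ∑ c ∈ level b (m + 1), f c := by
  rw [sum_tree, Finset.sum_range_succ, ← sum_tree]

theorem sum_tree_succ' (m : ℕ) (f : Vertex b → ℝ) :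
    ∑ c ∈ tree b (m + 1), f c = f [] + ∑ x ∈ tree b m, ∑ i, f (i :: x) := by
  rw [sum_tree, Finset.sum_range_succ', sum_level_zero, sum_tree, add_comm]
  simp only [sum_level_succ]

theorem weight_tree_eq (β h : ℝ) (m : ℕ) (ξ : Vertex b → Bool) :
    weight β h (tree b m) ξ = Real.exp (∑ c ∈ tree b (m + 1), parentField β ξ c * spin (ξ c) +
      β * h * ∑ x ∈ tree b m, spin (ξ x)) := by
  have e : edgesMeeting (tree b m) = (tree b (m + 1)).erase [] := edgesMeeting_tree m
  have h0 : [] ∈ tree b (m + 1) := (mem_tree _ _).2 (by simp)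
  rw [weight, e, ← Finset.add_sum_erase _ (fun c => parentField β ξ c * spin (ξ c)) h0, mul_add,
    Finset.mul_sum, ← mul_assoc, parentField, zero_mul, zero_add]
  congr 2
  refine Finset.sum_congr rfl fun c hc => ?_
  cases c with
  | nil => simp at hc
  | cons i x => simp only [parentField, List.tail_cons]; ring

/-- Each child's normalization contributes `-msgFun β a` to the field at its parent. The `b`
children together turn `a` into `a - b * msgFun β a`, which is `β h` by the fixed point equation;
only in the last level does the field `a` survive. -/
theorem exists_chainProb_eq {β h a : ℝ} (ha : fieldMap b β (β * h) a = a) (m : ℕ) :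
    ∃ K : ℝ, ∀ ξ : Vertex b → Bool, chainProb β a (m + 1) ξ =
      K * weight β h (tree b m) ξ * Real.exp (a * ∑ c ∈ level b (m + 1), spin (ξ c)) := by
  obtain ⟨B, hB, hcosh⟩ := cosh_add_mul_spin β a
  set M : (Vertex b → Bool) → Vertex b → ℝ := fun ξ c => match c with
    | [] => 0
    | _ :: x => spin (ξ x) * msgFun β a
  set N : Vertex b → ℝ := fun c => match c with
    | [] => 1 / (2 * Real.cosh a)
    | _ :: _ => 1 / (2 * B)
  have hpr : ∀ (ξ : Vertex b → Bool) (c : Vertex b), pr (a + parentField β ξ c) (ξ c) =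
      N c * Real.exp ((a + parentField β ξ c) * spin (ξ c) - M ξ c) := by
    intro ξ c
    rw [pr, Real.exp_sub]
    cases c with
    | nil => simp only [parentField, N, M, add_zero, Real.exp_zero]; ring
    | cons i x =>
      simp only [parentField, N, M]
      rw [hcosh]
      have := Real.exp_pos (spin (ξ x) * msgFun β a)
      field_simp
  refine ⟨∏ c ∈ tree b (m + 1), N c, fun ξ => ?_⟩
  rw [chainProb, Finset.prod_congr rfl fun c _ => hpr ξ c, Finset.prod_mul_distrib, ← Real.exp_sum,
    mul_assoc, weight_tree_eq, ← Real.exp_add]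
  congr 2
  have e1 : ∑ c ∈ tree b (m + 1), M ξ c = b * msgFun β a * ∑ x ∈ tree b m, spin (ξ x) := by
    rw [sum_tree_succ']
    simp only [M, Finset.sum_const, Finset.card_univ, Fintype.card_fin, nsmul_eq_mul]
    rw [← Finset.mul_sum, ← Finset.sum_mul]
    ring
  have e2 : ∑ c ∈ tree b (m + 1), ((a + parentField β ξ c) * spin (ξ c) - M ξ c) =
      a * ∑ c ∈ tree b (m + 1), spin (ξ c) + ∑ c ∈ tree b (m + 1), parentField β ξ c * spin (ξ c) -
        ∑ c ∈ tree b (m + 1), M ξ c := by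
    rw [Finset.mul_sum, ← Finset.sum_add_distrib, ← Finset.sum_sub_distrib]
    exact Finset.sum_congr rfl fun c _ => by ring
  rw [fieldMap] at ha
  rw [e2, e1, sum_tree_succ m fun c => spin (ξ c)]
  linear_combination (-∑ x ∈ tree b m, spin (ξ x)) * ha

theorem isGibbsMeasure_chainLaw {β h a : ℝ} (ha : fieldMap b β (β * h) a = a) :
    IsGibbsMeasure β h (chainLaw b β a) := by
  refine isGibbsMeasure_of_cyl (P := chainProb β a) (fun m ξ => Finset.prod_nonneg fun c _ => (pr_pos _ _).le)
    (chainLaw_cyl β a) fun m A hA ξ η hη => ?_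
  obtain ⟨K, hK⟩ := exists_chainProb_eq ha m
  rw [hK, hK]
  have e : ∑ c ∈ level b (m + 1), spin (η c) = ∑ c ∈ level b (m + 1), spin (ξ c) := by
    refine Finset.sum_congr rfl fun c hc => ?_
    rw [hη c fun h => ?_]
    have := (mem_tree _ _).1 (hA h)
    have := (mem_level _ _).1 hc
    omega
  rw [e]
  linear_combination K * Real.exp (a * ∑ c ∈ level b (m + 1), spin (ξ c)) *
    weight_mul_weight β h hA hη

/-- The two chains differ already in the law of the root, since `pr · true` is injective. -/
theorem multipleGibbs_of_ne {β h a a' : ℝ} (ha : fieldMap b β (β * h) a = a)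
    (ha' : fieldMap b β (β * h) a' = a') (hne : a ≠ a') : MultipleGibbs b β h := by
  refine ⟨_, _, isGibbsMeasure_chainLaw ha, isGibbsMeasure_chainLaw ha', fun heq => hne ?_⟩
  have h1 := congrArg (fun ν : Measure _ => ν (cyl (tree b 0) fun _ => true)) heq
  simp only [chainLaw_cyl] at h1
  have hnn : ∀ a, 0 ≤ chainProb (b := b) β a 0 fun _ => true := fun a =>
    Finset.prod_nonneg fun c _ => (pr_pos _ _).le
  rw [ENNReal.ofReal_eq_ofReal_iff (hnn _) (hnn _)] at h1
  have ht : tree b 0 = {[]} := by ext x; simp [mem_tree]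
  simp only [chainProb, ht, Finset.prod_singleton, parentField, add_zero] at h1
  have h2 := abs_sub_le_pr_true (le_max_left |a| |a'|) (le_max_right |a| |a'|)
  rw [h1, sub_self, abs_zero, mul_zero] at h2
  exact sub_eq_zero.1 (abs_nonpos_iff.1 h2)

end

section

variable {b : ℕ}

open MeasureTheory Filter Topology

/-! ### Uniqueness of the Gibbs measure -/

/-- The top `k` levels of a configuration. -/
def takeTop : (k n : ℕ) → Conf b n → Conf b k
  | 0, _, _ => .nil
  | k + 1, 0, σ => .node true fun _ => takeTop k 0 σ
  | k + 1, n + 1, .node s sub => .node s fun i => takeTop k n (sub i)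

theorem takeTop_readConf (η : Vertex b → Bool) (k : ℕ) : ∀ (n : ℕ) (x : Vertex b), k ≤ n →
    takeTop k n (readConf η n x) = readConf η k x := by
  induction k with
  | zero => intro n x _; cases n <;> rfl
  | succ k ih =>
    intro n x hn
    obtain ⟨n, rfl⟩ : ∃ l, n = l + 1 := ⟨n - 1, by omega⟩
    simp only [readConf, takeTop]
    congr 1
    funext i
    exact ih n _ (by omega)

open Classical in
theorem avg_treeW_takeTop (β : ℝ) (α : Vertex b → ℝ) (k : ℕ) : ∀ (n : ℕ) (x : Vertex b) (c : ℝ)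
    (ζ : Conf b k), k ≤ n →
    avg (treeW β α n x c) (fun σ => if takeTop k n σ = ζ then 1 else 0) = treeW β α k x c ζ := by
  induction k with
  | zero =>
    intro n x c ζ _
    cases ζ
    simp only [takeTop, if_true, avg_const (isProb_treeW β α n x c), treeW_zero]
  | succ k ih =>
    intro n x c ζ hn
    obtain ⟨n, rfl⟩ : ∃ l, n = l + 1 := ⟨n - 1, by omega⟩
    cases ζ with
    | node s z =>
      have e : ∀ s' : Bool, avg (subW β α n x s') (fun sub =>
          if takeTop (k + 1) (n + 1) (.node s' sub) = .node s z then (1 : ℝ) else 0) =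
          if s' = s then ∏ i, treeW β α k (i :: x) (β * spin s) (z i) else 0 := by
        intro s'
        have e1 : ∀ sub : Fin b → Conf b n,
            (if takeTop (k + 1) (n + 1) (.node s' sub) = .node s z then (1 : ℝ) else 0) =
            if s' = s then ∏ i, (if takeTop k n (sub i) = z i then (1 : ℝ) else 0) else 0 := by
          intro sub
          rw [Finset.prod_ite_zero, Finset.prod_const_one, ← ite_and]
          simp only [takeTop, Conf.node.injEq, funext_iff, Finset.mem_univ, true_implies]
        simp only [e1]
        by_cases hs : s' = s
        · subst hs
          simp only [if_true]
          rw [subW, avg_piW_prod (fun i => treeW β α n (i :: x) (β * spin s'))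
            (fun i σ => if takeTop k n σ = z i then (1 : ℝ) else 0)]
          exact Finset.prod_congr rfl fun i _ => ih n _ _ _ (by omega)
        · simp [hs, avg]
      rw [avg_treeW_succ]
      simp only [e]
      simp only [avg, mul_ite, mul_zero, Finset.sum_ite_eq', Finset.mem_univ, if_true, treeW]

theorem treeW_le_one (β : ℝ) (α : Vertex b → ℝ) (n : ℕ) (x : Vertex b) (c : ℝ) (ζ : Conf b n) :
    treeW β α n x c ζ ≤ 1 := by
  have h := isProb_treeW β α n x c
  rw [← h.2]
  exact Finset.single_le_sum (fun σ _ => h.1 σ) (Finset.mem_univ ζ)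

theorem continuous_pr (s : Bool) : Continuous fun a => pr a s := by
  unfold pr
  refine (Real.continuous_exp.comp (continuous_id.mul continuous_const)).div
    (continuous_const.mul Real.continuous_cosh) fun a => ?_
  have := Real.cosh_pos a
  positivity

theorem tendsto_treeW {β a : ℝ} {α : ℕ → Vertex b → ℝ}
    (H : ∀ y, Tendsto (fun m => α m y) atTop (𝓝 a)) : ∀ (n : ℕ) (x : Vertex b) (c : ℝ)
    (ζ : Conf b n), Tendsto (fun m => treeW β (α m) n x c ζ) atTop
      (𝓝 (treeW β (fun _ => a) n x c ζ))
  | 0, x, c, ζ => by simp only [treeW_zero]; exact tendsto_const_nhds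
  | n + 1, x, c, .node s sub => by
    simp only [treeW]
    exact (((continuous_pr s).tendsto _).comp ((H x).add_const c)).mul
      (tendsto_finsetProd _ fun i _ => tendsto_treeW H n _ _ _)

theorem tendsto_effField {β g a : ℝ} (hβ : 0 ≤ β)
    (H : ∀ a', fieldMap b β g a' = a' → a' = a) (τ : Vertex b → Bool) (y : Vertex b) :
    Tendsto (fun m => effField β g m τ y) atTop (𝓝 a) := by
  obtain ⟨a₁, h1, -, ht1⟩ := exists_tendsto_upper b hβ g
  obtain ⟨a₂, h2, ht2⟩ := exists_tendsto_lower b hβ g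
  rw [H a₁ h1] at ht1
  rw [H a₂ h2] at ht2
  have hsub := tendsto_sub_atTop_nat y.length
  refine tendsto_of_tendsto_of_tendsto_of_le_of_le' (ht2.comp hsub) (ht1.comp hsub) ?_ ?_ <;>
    filter_upwards [eventually_ge_atTop y.length] with m hm
  · rw [effField, if_pos hm]
    exact le_sum_boundaryMsg hβ g τ _ y
  · rw [effField, if_pos hm]
    exact sum_boundaryMsg_le hβ g τ _ y

theorem sum_gibbs_mul_indicator (β h : ℝ) {k m : ℕ} (hk : k ≤ m) (η ξ : Vertex b → Bool) :
    ∑ ζ : tree b m → Bool, ENNReal.ofReal (gibbs β h (tree b m) η ζ) *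
      (cyl (tree b k) ξ).indicator 1 (glue (tree b m) η ζ) =
    ENNReal.ofReal (treeW β (effField β (β * h) m η) (k + 1) [] 0 (readConf ξ (k + 1) [])) := by
  classical
  have e : ∀ ζ : tree b m → Bool, ENNReal.ofReal (gibbs β h (tree b m) η ζ) *
      (cyl (tree b k) ξ).indicator 1 (glue (tree b m) η ζ) =
      ENNReal.ofReal (mu β h m η ζ * if takeTop (k + 1) (m + 1) (configEquiv m η ζ) =
        readConf ξ (k + 1) [] then 1 else 0) := by
    intro ζ
    have hiff : glue (tree b m) η ζ ∈ cyl (tree b k) ξ ↔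
        takeTop (k + 1) (m + 1) (configEquiv m η ζ) = readConf ξ (k + 1) [] := by
      rw [configEquiv_apply, takeTop_readConf _ _ _ _ (by omega)]
      constructor
      · intro h
        refine readConf_congr fun w hw => ?_
        rw [List.append_nil]
        exact h w ((mem_tree _ _).2 (by omega))
      · intro h x hx
        have := eq_of_readConf_eq h x (by have := (mem_tree _ _).1 hx; omega)
        rwa [List.append_nil] at this
    by_cases hc : glue (tree b m) η ζ ∈ cyl (tree b k) ξ
    · rw [Set.indicator_of_mem hc, if_pos (hiff.1 hc), Pi.one_apply, mul_one, mul_one]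
      rfl
    · rw [Set.indicator_of_notMem hc, if_neg fun h' => hc (hiff.2 h'), mul_zero, mul_zero,
        ENNReal.ofReal_zero]
  simp only [e]
  rw [← ENNReal.ofReal_sum_of_nonneg fun ζ _ =>
    mul_nonneg (mu_pos β h m η ζ).le (by split_ifs <;> norm_num)]
  congr 1
  exact (avg_mu β h m η fun σ => if takeTop (k + 1) (m + 1) σ = readConf ξ (k + 1) [] then 1
    else 0).trans (avg_treeW_takeTop β _ (k + 1) (m + 1) [] 0 _ (by omega))

/-- Apply the DLR equation in deeper and deeper trees: with a unique fixed point the effective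
fields converge to `a` for every boundary configuration, and dominated convergence determines the
cylinder probabilities. -/
theorem IsGibbsMeasure.cyl_eq {β h a : ℝ} (hβ : 0 ≤ β)
    (H : ∀ a', fieldMap b β (β * h) a' = a' → a' = a) {ν : Measure (Vertex b → Bool)}
    (hν : IsGibbsMeasure β h ν) (k : ℕ) (ξ : Vertex b → Bool) :
    ν (cyl (tree b k) ξ) =
      ENNReal.ofReal (treeW β (fun _ => a) (k + 1) [] 0 (readConf ξ (k + 1) [])) := by
  have := hν.1
  set F : ℕ → (Vertex b → Bool) → ℝ≥0∞ := fun m η =>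
    ∑ ζ : tree b m → Bool, ENNReal.ofReal (gibbs β h (tree b m) η ζ) *
      (cyl (tree b k) ξ).indicator 1 (glue (tree b m) η ζ)
  have hF : ∀ m, Measurable (F m) := fun m =>
    Finset.measurable_fun_sum _ fun ζ _ => (measurable_gibbs β h _ ζ).ennreal_ofReal.mul
      ((measurable_one.indicator (measurableSet_cyl _ _)).comp (measurable_glue _ ζ))
  have hlim : Tendsto (fun m => ∫⁻ η, F (m + k) η ∂ν) atTop (𝓝 (∫⁻ _, ENNReal.ofReal
      (treeW β (fun _ => a) (k + 1) [] 0 (readConf ξ (k + 1) [])) ∂ν)) := by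
    refine tendsto_lintegral_of_dominated_convergence (fun _ => 1) (fun m => hF _) (fun m => ?_)
      (by simp) ?_
    · refine Eventually.of_forall fun η => ?_
      simp only [F]
      rw [sum_gibbs_mul_indicator β h (by omega) η ξ]
      exact ENNReal.ofReal_le_one.2 (treeW_le_one _ _ _ _ _ _)
    · refine Eventually.of_forall fun η => ?_
      simp only [F]
      simp only [sum_gibbs_mul_indicator β h (Nat.le_add_left k _) η ξ]
      refine (ENNReal.continuous_ofReal.tendsto _).comp ?_
      exact tendsto_treeW (α := fun m => effField β (β * h) (m + k) η)
        (fun y => (tendsto_effField hβ H η y).comp (tendsto_add_atTop_nat k)) _ _ _ _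
  have hconst : ∀ m, ∫⁻ η, F (m + k) η ∂ν = ν (cyl (tree b k) ξ) := fun m =>
    hν.2 _ _ (measurableSet_cyl _ _)
  simp only [hconst, lintegral_const, measure_univ, mul_one] at hlim
  exact tendsto_nhds_unique tendsto_const_nhds hlim

theorem not_multipleGibbs_of_unique {β h : ℝ} (hβ : 0 ≤ β)
    (H : ∀ a a', fieldMap b β (β * h) a = a → fieldMap b β (β * h) a' = a' → a = a') :
    ¬ MultipleGibbs b β h := by
  rintro ⟨ν₁, ν₂, h1, h2, hne⟩
  obtain ⟨a, ha, -⟩ := exists_tendsto_upper b hβ (β * h)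
  have := h2.1
  exact hne (measure_ext_of_cyl 0 fun m _ ξ => by
    rw [h1.cyl_eq hβ (fun a' ha' => H a' a ha' ha) m ξ,
      h2.cyl_eq hβ (fun a' ha' => H a' a ha' ha) m ξ])

/-! ### The critical field -/

/-- Two fixed points give, by the mean value theorem, a point `c` within `b * β` of `g` with `b *
influence β c = 1`. For large `|g|` this is impossible, as the influence decays in `|c|`. -/
theorem fieldMap_unique_of_large {β g : ℝ} (hβ : 0 ≤ β)
    (hg : b * β + b * Real.sinh (2 * β) ≤ |g|) (a a' : ℝ)
    (ha : fieldMap b β g a = a) (ha' : fieldMap b β g a' = a') : a = a' := by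
  wlog hlt : a < a' generalizing a a'
  · rcases eq_or_lt_of_not_gt hlt with h | h
    · exact h.symm
    · exact (this a' a ha' ha h).symm
  exfalso
  obtain ⟨c, hc, hs⟩ := exists_hasDerivAt_eq_slope (fieldMap b β g) (fun x => b * influence β x) hlt
    (continuous_fieldMap b β g).continuousOn fun x _ => hasDerivAt_fieldMap b β g x
  rw [ha, ha', div_self (by linarith)] at hs
  have h1 := le_fieldMap b hβ g a
  have h2 := fieldMap_le b hβ g a'
  rw [ha] at h1
  rw [ha'] at h2
  have h3 : |g - c| ≤ b * β := abs_le.2 ⟨by linarith [hc.2], by linarith [hc.1]⟩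
  have h4 : b * Real.sinh (2 * β) ≤ |c| := by
    have := abs_sub_abs_le_abs_sub g c
    linarith
  have h5 : |c| < Real.cosh (2 * c) := by
    rw [← Real.cosh_abs, Real.cosh_eq]
    have h6 := Real.add_one_le_exp |2 * c|
    have h7 := Real.exp_pos (-|2 * c|)
    rw [abs_mul, abs_two] at *
    linarith
  rw [influence_eq] at hs
  have h8 := Real.cosh_pos (2 * β)
  have h9 : 0 < Real.cosh (2 * c) + Real.cosh (2 * β) := by positivity
  rw [← mul_div_assoc, div_eq_one_iff_eq h9.ne'] at hs
  linarith

/-- The real `sSup` of an unbounded set is `0`; without this bound, `|h| > h_c` would carry no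
information. -/
theorem bddAbove_criticalField (b : ℕ) {β : ℝ} (hβ : 0 < β) :
    BddAbove {r : ℝ | ∃ h : ℝ, |h| = r ∧ MultipleGibbs b β h} := by
  refine ⟨(b * β + b * Real.sinh (2 * β)) / β, ?_⟩
  rintro _ ⟨h, rfl, hm⟩
  by_contra! hlt
  refine not_multipleGibbs_of_unique hβ.le (fieldMap_unique_of_large hβ.le ?_) hm
  rw [abs_mul, abs_of_pos hβ]
  rw [div_lt_iff₀ hβ] at hlt
  linarith

/-- Two fixed points would give two Gibbs measures, hence `|h| ≤ h_c`. At `β = 0`, where the set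
need not be known to be bounded, `fieldMap` is constant. -/
theorem fieldMap_unique_of_criticalField_lt {β h : ℝ} (hβ : 0 ≤ β) (hh : criticalField b β < |h|)
    (a a' : ℝ) (ha : fieldMap b β (β * h) a = a) (ha' : fieldMap b β (β * h) a' = a') : a = a' := by
  rcases hβ.eq_or_lt with rfl | hpos
  · have h0 : ∀ x, msgFun 0 x = 0 := fun x => abs_nonpos_iff.1 (abs_msgFun_le le_rfl x)
    rw [← ha, ← ha', fieldMap, fieldMap, h0, h0]
  · by_contra hne
    exact absurd (le_csSup (bddAbove_criticalField b hpos) ⟨h, rfl, multipleGibbs_of_ne ha ha' hne⟩)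
      (not_le.2 hh)

/-! ### Logarithmic Sobolev constant and mixing time -/

theorem exists_logSobolev_mixingTime (hb : 2 ≤ b) {β : ℝ} (hβ : 0 ≤ β) (h : ℝ) {J : ℕ} {ρ : ℝ}
    (hρ : 0 < ρ) (hρ1 : ρ < 1) :
    ∃ C, 0 < C ∧ ∀ (m : ℕ) (τ : Vertex b → Bool),
      FieldBounds b β (β * h) m J ρ (effField β (β * h) m τ) →
      1 / C ≤ logSobolev β h m τ ∧ (1 ≤ m → ∀ p : ℝ≥0∞,
        mixingTime β h m τ p ≤ ENNReal.ofReal (C * Real.log ((tree b m).card : ℝ))) := by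
  obtain ⟨C, hC, H⟩ := exists_ent_le_dirichlet hb hβ h J hρ hρ1
  obtain ⟨C', hC', H'⟩ := exists_mixingTime_le hb hβ h hC
  exact ⟨C', hC', fun m τ hF => H' m τ (H m τ hF)⟩

end

end IsingTree

end

/-! ### The two situations of the theorem -/

theorem theorem2 (b : ℕ) (hb : 2 ≤ b) (β h : ℝ) (hβ : 0 ≤ β) :
    ((β < IsingTree.beta1 b ∨ IsingTree.criticalField b β < |h|) →
      ∃ C : ℝ, 0 < C ∧ ∀ (τ : IsingTree.Vertex b → Bool) (m : ℕ),
        1 / C ≤ IsingTree.logSobolev β h m τ ∧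
        (1 ≤ m → ∀ p : ℝ≥0∞, 1 ≤ p →
          IsingTree.mixingTime β h m τ p ≤
            ENNReal.ofReal (C * Real.log ((IsingTree.tree b m).card : ℝ)))) ∧
    (∃ C : ℝ, 0 < C ∧ ∀ m : ℕ,
        1 / C ≤ IsingTree.logSobolev β h m (fun _ : IsingTree.Vertex b => true) ∧
        (1 ≤ m → ∀ p : ℝ≥0∞, 1 ≤ p →
          IsingTree.mixingTime β h m (fun _ : IsingTree.Vertex b => true) p ≤
            ENNReal.ofReal (C * Real.log ((IsingTree.tree b m).card : ℝ)))) := by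
  constructor
  · intro hcase
    obtain ⟨J, ρ, h0, h1, hF⟩ : ∃ (J : ℕ) (ρ : ℝ), 0 < ρ ∧ ρ < 1 ∧
        ∀ (m : ℕ) (τ : IsingTree.Vertex b → Bool), IsingTree.FieldBounds b β (β * h) m J ρ
          (IsingTree.effField β (β * h) m τ) := by
      rcases hcase with hlt | hlt
      · exact IsingTree.exists_fieldBounds_of_lt_beta1 hb hβ hlt _
      · exact IsingTree.exists_fieldBounds_of_unique b hβ _
          (IsingTree.fieldMap_unique_of_criticalField_lt hβ hlt)
    obtain ⟨C, hC, H⟩ := IsingTree.exists_logSobolev_mixingTime hb hβ h (J := J) h0 h1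
    exact ⟨C, hC, fun τ m => ⟨(H m τ (hF m τ)).1, fun hm p _ => (H m τ (hF m τ)).2 hm p⟩⟩
  · obtain ⟨J, ρ, h0, h1, hF⟩ := IsingTree.exists_fieldBounds_plus b hβ (β * h)
    obtain ⟨C, hC, H⟩ := IsingTree.exists_logSobolev_mixingTime hb hβ h (J := J) h0 h1
    exact ⟨C, hC, fun m => ⟨(H m _ (hF m)).1, fun hm p _ => (H m _ (hF m)).2 hm p⟩⟩
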